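/- Let $M$ be a (Hausdorff) smooth manifold of dimension $n>1$ with a smooth Riemannian metric $h$, let $p\colon M\to\mathbb R$ be smooth, $\bar g>0$, and let $\mathbf G^T=-\bar g\,\nabla_h p$ be the gravitational wind. Let $\eta,\tilde\eta\in[0,1]$. A craft at $x$ with self-velocity $u\in T_xM$, $\|u\|_h=1$, has the resultant velocity $v=u+\mathbf G_{\eta\tilde\eta}$, where $$\mathbf G_{\eta\tilde\eta}=(\eta-\tilde\eta)\,\mathbf G_{MAT}+(1-\eta)\,\mathbf G^T,\qquad \mathbf G_{MAT}=\mathrm{Proj}_u\mathbf G^T .$$ A trajectory is a piecewise smooth curve, parametrized by time, whose velocity is a resultant velocity at every time other than the break times; it is time-minimal if no trajectory with the same initial and final point takes less time, and locally time-minimal if all its sufficiently short pieces are time-minimal. A slope metric of type $(\eta,\tilde\eta)$ is a function $\tilde F=\tilde F_{\eta\tilde\eta}\colon TM\to[0,\infty)$, positively homogeneous of degree one on the fibres, whose indicatrix $\{\tilde F=1\}$ is the set of resultant velocities. A Finsler metric is a continuous $F\colon TM\to[0,\infty)$, smooth off the zero section, positively homogeneous of degree one, and strongly convex, i.e. with $\frac12\partial^2F^2/\partial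 y^i\partial y^j$ positive definite for $y\ne0$; its geodesics are the smooth regular curves with $\ddot\gamma^i+2\mathcal G^i(\gamma,\dot\gamma)=0$, where $\mathcal G^i=\frac14g^{il}\{[F^2]_{x^ky^l}y^k-[F^2]_{x^l}\}$ and $g_{ij}=\frac12\partial^2F^2/\partial y^i\partial y^j$. Put $\alpha=\|y\|_h$ and $\beta=-\frac1{\bar g}h(y,\mathbf G^T)$. Let $\mathcal S=[0,1]^2\setminus\{(1,1)\}$ and $$\mathcal D_1=\{(\eta,\tilde\eta)\in\mathcal S:\eta\ge\tilde\eta>2\eta-1\},\qquad \mathcal D_2=\{(\eta,\tilde\eta)\in\mathcal S:\tfrac{3\tilde\eta-1}2<\eta<\tilde\eta\},$$ $$\mathcal D_3=\{(\eta,\tilde\eta)\in\mathcal S:\eta\ge\tfrac12,\ \tilde\eta\le2\eta-1\},\qquad \mathcal D_4=\{(\eta,\tilde\eta)\in\mathcal S:\tilde\eta\ge\tfrac13,\ \eta\le\tfrac{3\tilde\eta-1}2\}.$$ **(a)** $\mathcal S=\mathcal D_1\cup\mathcal D_2\cup\mathcal D_3\cup\mathcal D_4$, and the four sets are pairwise disjoint.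 **(b)** Let (W) be the condition: either $(\eta,\tilde\eta)\in\mathcal D_1\cup\mathcal D_2$ and $\|\mathbf G^T\|_h<\frac1{1-\tilde\eta}$ on $M$, or $(\eta,\tilde\eta)\in\mathcal D_3\cup\mathcal D_4$ and $\|\mathbf G^T\|_h<\frac1{2|\eta-\tilde\eta|}$ on $M$, or $\eta=\tilde\eta=1$ (no restriction). If (W) holds, then there is exactly one slope metric of type $(\eta,\tilde\eta)$. A slope metric of type $(\eta,\tilde\eta)$ is a (strongly convex) Finsler metric if and only if (W) holds. Now assume (W), and let $\tilde F$ be the slope metric of type $(\eta,\tilde\eta)$. **(c)** $\tilde F$ satisfies on $TM$ $$\tilde F\sqrt{\alpha^2+2(1-\eta)\bar g\beta\tilde F+(1-\eta)^2\|\mathbf G^T\|_h^2\tilde F^2}=\alpha^2+(2-\eta-\tilde\eta)\bar g\beta\tilde F+(1-\eta)(1-\tilde\eta)\|\mathbf G^T\|_h^2\tilde F^2,$$ and it is the only Finsler metric on $M$ satisfying this equation. **(d)** Every time-minimal trajectory $\gamma\colon[a,b]\to M$, $a<b$, is a geodesic of $\tilde F$ with $\tilde F(\gamma,\dot\gamma)=1$.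 A curve $\gamma\colon[a,b]\to M$ is a locally time-minimal trajectory if and only if it is a geodesic of $\tilde F$ with $\tilde F(\gamma,\dot\gamma)=1$. **(e)** For $(\eta,\tilde\eta)=(0,0)$, $\tilde F$ is a Randers metric (the sum of the norm of a Riemannian metric $a$ and a smooth $1$-form $b$ with $|b|<\|\cdot\|_a$ off the zero section), namely $$\tilde F(x,y)=\frac{\sqrt{h(y,\mathbf G^T)^2+\lambda\|y\|_h^2}-h(y,\mathbf G^T)}{\lambda},\qquad \lambda=1-\|\mathbf G^T\|_h^2 .$$ For $(1,0)$ it is a Matsumoto metric (of the form $A^2/(A-b)$, with $A$ the norm of a Riemannian metric and $b$ a smooth $1$-form with $|b|<\frac12A$ off the zero section), namely $\tilde F=\frac{\alpha^2}{\alpha-\bar g\beta}$ (with value $0$ at $y=0$). For $(0,1)$ it is the cross slope metric, i.e. the Finsler metric with indicatrix $\{u+(\mathbf G^T-\mathrm{Proj}_u\mathbf G^T):\|u\|_h=1\}$, which satisfies $\tilde F\sqrt{\alpha^2+2\bar g\beta\tilde F+\|\mathbf G^T\|_h^2\tilde F^2}=\alpha^2+\bar g\beta\tilde F$. For $(1,1)$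 it is the Riemannian metric: $\tilde F=\|\cdot\|_h$. -/

import Mathlib

open Set Bundle
open scoped Manifold ContDiff

noncomputable section

namespace SlopeNav

variable {n : ℕ} {M : Type*} [TopologicalSpace M] [ChartedSpace (EuclideanSpace ℝ (Fin n)) M]

/-! ### Finsler metrics on `M` -/

section Finsler

variable [IsManifold (𝓡 n) ∞ M]

/-- `F : TM → [0, ∞)` is a Finsler metric: continuous, smooth off the zero section, positively
homogeneous of degree one on the fibres, and strongly convex. The last condition says that the
fundamental tensor `½ ∂²F²/∂yⁱ∂yʲ` is positive definite at every `y ≠ 0`; it is written with the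
value of the Hessian on `(w, w)`, the second derivative of `½ F²` along the line `y + t w`. -/
structure IsFinslerMetric (F : TangentBundle (𝓡 n) M → ℝ) : Prop where
  nonneg : ∀ v, 0 ≤ F v
  continuous : Continuous F
  smooth : ContMDiffOn (𝓡 n).tangent 𝓘(ℝ, ℝ) ∞ F {v | v.2 ≠ 0}
  homogeneous : ∀ (x : M) (y : TangentSpace (𝓡 n) x) (c : ℝ), 0 < c →
    F ⟨x, c • y⟩ = c * F ⟨x, y⟩
  strongly_convex : ∀ (x : M) (y w : TangentSpace (𝓡 n) x), y ≠ 0 → w ≠ 0 →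
    0 < 1 / 2 * iteratedDeriv 2 (fun t : ℝ => F ⟨x, y + t • w⟩ ^ 2) 0

end Finsler

/-! ### Geodesics of a Finsler metric -/

section Geodesics

variable [IsManifold (𝓡 n) ∞ M]

/-- The function `F²` in the local coordinates `(x, y)` of `TM` induced by the chart at `x₀`. -/
def localSq (F : TangentBundle (𝓡 n) M → ℝ) (x₀ : M) (x y : EuclideanSpace ℝ (Fin n)) : ℝ :=
  F ⟨(extChartAt (𝓡 n) x₀).symm x,
    mfderiv 𝓘(ℝ, EuclideanSpace ℝ (Fin n)) (𝓡 n) (extChartAt (𝓡 n) x₀).symm x y⟩ ^ 2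

/-- The coordinate vector `∂/∂xⁱ`. -/
abbrev coordVec (i : Fin n) : EuclideanSpace ℝ (Fin n) := EuclideanSpace.single i 1

/-- The fundamental tensor `g_{ij}(x, y) = ½ ∂²F²/∂yⁱ∂yʲ` in local coordinates. -/
def fundTensor (F : TangentBundle (𝓡 n) M → ℝ) (x₀ : M) (x y : EuclideanSpace ℝ (Fin n)) :
    Matrix (Fin n) (Fin n) ℝ :=
  Matrix.of fun i j =>
    1 / 2 * lineDeriv ℝ (fun y' => lineDeriv ℝ (fun y'' => localSq F x₀ x y'') y' (coordVec j)) y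
      (coordVec i)

/-- The spray coefficients
`Gⁱ(x, y) = ¼ gⁱˡ ([F²]_{xᵏyˡ} yᵏ - [F²]_{xˡ})` in local coordinates. -/
def spray (F : TangentBundle (𝓡 n) M → ℝ) (x₀ : M) (x y : EuclideanSpace ℝ (Fin n))
    (i : Fin n) : ℝ :=
  1 / 4 * ∑ l : Fin n, (fundTensor F x₀ x y)⁻¹ i l *
    ((∑ k : Fin n,
        lineDeriv ℝ (fun x' => lineDeriv ℝ (fun y' => localSq F x₀ x' y') y (coordVec l)) x
          (coordVec k) * y k)
      - lineDeriv ℝ (fun x' => localSq F x₀ x' y) x (coordVec l))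

/-- The velocity vector of a curve. -/
def velocity (γ : ℝ → M) (t : ℝ) : TangentSpace (𝓡 n) (γ t) :=
  mfderiv 𝓘(ℝ, ℝ) (𝓡 n) γ t (1 : ℝ)

/-- `γ` restricted to `[a, b]` is a geodesic of `F`: a smooth regular curve which solves
`γ̈ⁱ + 2 Gⁱ(γ, γ̇) = 0` in local coordinates. -/
structure IsGeodesicOn (F : TangentBundle (𝓡 n) M → ℝ) (γ : ℝ → M) (a b : ℝ) : Prop where
  smooth : ContMDiffOn 𝓘(ℝ, ℝ) (𝓡 n) ∞ γ (Icc a b)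
  regular : ∀ t ∈ Ioo a b, velocity (n := n) γ t ≠ 0
  ode : ∀ x₀ : M, ∀ t ∈ Ioo a b, γ t ∈ (extChartAt (𝓡 n) x₀).source → ∀ i : Fin n,
    (deriv (deriv fun s => extChartAt (𝓡 n) x₀ (γ s)) t) i
      + 2 * spray F x₀ (extChartAt (𝓡 n) x₀ (γ t))
          (deriv (fun s => extChartAt (𝓡 n) x₀ (γ s)) t) i = 0

end Geodesics

/-! ### The slope of a mountain, its gravitational wind and the active wind -/

section Slope

variable [IsManifold (𝓡 n) ∞ M]

variable (n M) in
/-- Smooth Riemannian metrics on `M`. -/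
abbrev RiemMetric : Type _ :=
  ContMDiffRiemannianMetric (𝓡 n) ∞ (EuclideanSpace ℝ (Fin n))
    (fun x : M => TangentSpace (𝓡 n) x)

/-- The norm `‖y‖_h`; this is also the function `α(x, y)`. -/
def hnorm (h : RiemMetric n M) (x : M) (y : TangentSpace (𝓡 n) x) : ℝ :=
  Real.sqrt (h.inner x y y)

theorem exists_riesz {V : Type*} [NormedAddCommGroup V] [NormedSpace ℝ V] [FiniteDimensional ℝ V]
    (B : V →L[ℝ] V →L[ℝ] ℝ) (hB : ∀ v, v ≠ 0 → 0 < B v v) (f : V →L[ℝ] ℝ) :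
    ∃ w, ∀ y, B w y = f y := by
  let T : V →ₗ[ℝ] Module.Dual ℝ V := (ContinuousLinearMap.coeLM ℝ).comp B.toLinearMap
  have hT : Function.Injective T := by
    rw [← LinearMap.ker_eq_bot, LinearMap.ker_eq_bot']
    intro w hw
    by_contra hne
    have h2 : B w w = 0 := LinearMap.congr_fun hw w
    exact absurd h2 (hB w hne).ne'
  have hs : Function.Surjective T :=
    (LinearMap.injective_iff_surjective_of_finrank_eq_finrank
      (by rw [Subspace.dual_finrank_eq])).1 hT
  obtain ⟨w, hw⟩ := hs f.toLinearMap
  exact ⟨w, fun y => LinearMap.congr_fun hw y⟩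

theorem exists_gradient (h : RiemMetric n M) (p : M → ℝ) (x : M) :
    ∃ w : TangentSpace (𝓡 n) x, ∀ y : TangentSpace (𝓡 n) x,
      h.inner x w y = mfderiv (𝓡 n) 𝓘(ℝ, ℝ) p x y :=
  exists_riesz (V := EuclideanSpace ℝ (Fin n)) (h.inner x) (h.pos x)
    (mfderiv (𝓡 n) 𝓘(ℝ, ℝ) p x)

/-- The gradient `ω♯` of `p` with respect to `h`, determined by `h(ω♯, y) = dp(y)`. -/
def gradient (h : RiemMetric n M) (p : M → ℝ) (x : M) : TangentSpace (𝓡 n) x :=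
  (exists_gradient h p x).choose

theorem inner_gradient (h : RiemMetric n M) (p : M → ℝ) (x : M) (y : TangentSpace (𝓡 n) x) :
    h.inner x (gradient h p x) y = mfderiv (𝓡 n) 𝓘(ℝ, ℝ) p x y :=
  (exists_gradient h p x).choose_spec y

/-- The gravitational wind `Gᵀ = -ḡ ω♯`. -/
def gravWind (h : RiemMetric n M) (p : M → ℝ) (g : ℝ) (x : M) : TangentSpace (𝓡 n) x :=
  -(g • gradient h p x)

/-- `β(x, y) = -(1/ḡ) h(y, Gᵀ)`. -/
def beta (h : RiemMetric n M) (p : M → ℝ) (g : ℝ) (x : M) (y : TangentSpace (𝓡 n) x) : ℝ :=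
  -(1 / g) * h.inner x y (gravWind h p g x)

/-- The orthogonal projection of the gravitational wind onto the direction of `u`. -/
def gravMAT (h : RiemMetric n M) (p : M → ℝ) (g : ℝ) (x : M) (u : TangentSpace (𝓡 n) x) :
    TangentSpace (𝓡 n) x :=
  (h.inner x (gravWind h p g x) u / h.inner x u u) • u

/-- The active wind `(η - η̃) G_MAT + (1 - η) Gᵀ` met by a craft with self-velocity `u`. -/
def activeWind (h : RiemMetric n M) (p : M → ℝ) (g η η' : ℝ) (x : M)
    (u : TangentSpace (𝓡 n) x) : TangentSpace (𝓡 n) x :=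
  (η - η') • gravMAT h p g x u + (1 - η) • gravWind h p g x

/-- `v` is a resultant velocity at `x`: `v = u + G_{ηη̃}` for a self-velocity `u`, `‖u‖_h = 1`. -/
def IsResultantVelocity (h : RiemMetric n M) (p : M → ℝ) (g η η' : ℝ) (x : M)
    (v : TangentSpace (𝓡 n) x) : Prop :=
  ∃ u : TangentSpace (𝓡 n) x, hnorm h x u = 1 ∧ v = u + activeWind h p g η η' x u

/-! ### Time-minimal paths -/

/-- `γ` restricted to `[a, b]` is a trajectory of the craft, parametrized by time: it is piecewise
smooth, the finitely many break times being in `P`, and away from them its velocity is a resultant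
velocity. -/
def IsTrajectoryOn (h : RiemMetric n M) (p : M → ℝ) (g η η' : ℝ) (γ : ℝ → M) (a b : ℝ) : Prop :=
  ∃ P : Finset ℝ, ∀ c d : ℝ, a ≤ c → c < d → d ≤ b → (∀ t ∈ P, t ∉ Ioo c d) →
    ContMDiffOn 𝓘(ℝ, ℝ) (𝓡 n) ∞ γ (Icc c d) ∧
      ∀ t ∈ Ioo c d, IsResultantVelocity h p g η η' (γ t) (velocity γ t)

/-- A trajectory on `[a, b]` is time-minimal if no trajectory from `γ a` to `γ b` takes less
time. -/
def IsTimeMinimalOn (h : RiemMetric n M) (p : M → ℝ) (g η η' : ℝ) (γ : ℝ → M) (a b : ℝ) : Prop :=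
  IsTrajectoryOn h p g η η' γ a b ∧
    ∀ (σ : ℝ → M) (c d : ℝ), c ≤ d → IsTrajectoryOn h p g η η' σ c d →
      σ c = γ a → σ d = γ b → b - a ≤ d - c

/-- A trajectory on `[a, b]` is locally time-minimal if its short pieces are time-minimal. -/
def IsLocallyTimeMinimalOn (h : RiemMetric n M) (p : M → ℝ) (g η η' : ℝ) (γ : ℝ → M) (a b : ℝ) :
    Prop :=
  IsTrajectoryOn h p g η η' γ a b ∧
    ∀ t ∈ Icc a b, ∃ ε > 0, ∀ c ∈ Icc a b, ∀ d ∈ Icc a b, |c - t| < ε → |d - t| < ε → c < d →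
      IsTimeMinimalOn h p g η η' γ c d

/-! ### Slope metrics -/

/-- The slope metric of type `(η, η̃)`: the nonnegative, positively homogeneous function on `TM`
whose indicatrix `F = 1` consists of the resultant velocities. Smoothness and strong convexity
are not part of the definition. -/
structure IsSlopeMetric (h : RiemMetric n M) (p : M → ℝ) (g η η' : ℝ)
    (F : TangentBundle (𝓡 n) M → ℝ) : Prop where
  nonneg : ∀ v, 0 ≤ F v
  homogeneous : ∀ (x : M) (y : TangentSpace (𝓡 n) x) (c : ℝ), 0 < c →
    F ⟨x, c • y⟩ = c * F ⟨x, y⟩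
  indicatrix : ∀ (x : M) (y : TangentSpace (𝓡 n) x),
    F ⟨x, y⟩ = 1 ↔ IsResultantVelocity h p g η η' x y

/-- The irrational equation of the `(η, η̃)`-slope metric. -/
def SatisfiesSlopeEq (h : RiemMetric n M) (p : M → ℝ) (g η η' : ℝ)
    (F : TangentBundle (𝓡 n) M → ℝ) : Prop :=
  ∀ (x : M) (y : TangentSpace (𝓡 n) x),
    F ⟨x, y⟩ * Real.sqrt (hnorm h x y ^ 2 + 2 * (1 - η) * g * beta h p g x y * F ⟨x, y⟩
        + (1 - η) ^ 2 * hnorm h x (gravWind h p g x) ^ 2 * F ⟨x, y⟩ ^ 2)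
      = hnorm h x y ^ 2 + (2 - η - η') * g * beta h p g x y * F ⟨x, y⟩
        + (1 - η) * (1 - η') * hnorm h x (gravWind h p g x) ^ 2 * F ⟨x, y⟩ ^ 2

/-- A smooth `1`-form on `M`, given as a function on `TM` that is linear on the fibres. -/
def IsSmoothOneForm (b : ∀ x : M, TangentSpace (𝓡 n) x →ₗ[ℝ] ℝ) : Prop :=
  ContMDiff (𝓡 n).tangent 𝓘(ℝ, ℝ) ∞ (fun v : TangentBundle (𝓡 n) M => b v.1 v.2)

/-- Randers metrics `α + β`: `α` is the norm of a Riemannian metric `a`, and `β` is a `1`-form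
with `‖β‖_a < 1`. -/
def IsRandersMetric (F : TangentBundle (𝓡 n) M → ℝ) : Prop :=
  ∃ (a : RiemMetric n M) (b : ∀ x : M, TangentSpace (𝓡 n) x →ₗ[ℝ] ℝ), IsSmoothOneForm b ∧
    (∀ (x : M) (y : TangentSpace (𝓡 n) x), y ≠ 0 → |b x y| < hnorm a x y) ∧
    ∀ (x : M) (y : TangentSpace (𝓡 n) x), F ⟨x, y⟩ = hnorm a x y + b x y

/-- Matsumoto metrics `α² / (α - β)`: `α` is the norm of a Riemannian metric `a`, and `β` is a
`1`-form with `‖β‖_a < 1/2`. -/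
def IsMatsumotoMetric (F : TangentBundle (𝓡 n) M → ℝ) : Prop :=
  ∃ (a : RiemMetric n M) (b : ∀ x : M, TangentSpace (𝓡 n) x →ₗ[ℝ] ℝ), IsSmoothOneForm b ∧
    (∀ (x : M) (y : TangentSpace (𝓡 n) x), y ≠ 0 → |b x y| < 1 / 2 * hnorm a x y) ∧
    ∀ (x : M) (y : TangentSpace (𝓡 n) x),
      F ⟨x, y⟩ = hnorm a x y ^ 2 / (hnorm a x y - b x y)

/-- The cross slope metric: the Finsler metric whose indicatrix consists of the velocities
`u + Proj_{u^⊥} Gᵀ`, `‖u‖_h = 1`, and which solves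
`F √(α² + 2ḡβF + ‖Gᵀ‖² F²) = α² + ḡβF`. -/
structure IsCrossSlopeMetric (h : RiemMetric n M) (p : M → ℝ) (g : ℝ)
    (F : TangentBundle (𝓡 n) M → ℝ) : Prop where
  finsler : IsFinslerMetric F
  indicatrix : ∀ (x : M) (y : TangentSpace (𝓡 n) x), F ⟨x, y⟩ = 1 ↔
    ∃ u : TangentSpace (𝓡 n) x, hnorm h x u = 1 ∧
      y = u + (gravWind h p g x - gravMAT h p g x u)
  equation : ∀ (x : M) (y : TangentSpace (𝓡 n) x),
    F ⟨x, y⟩ * Real.sqrt (hnorm h x y ^ 2 + 2 * g * beta h p g x y * F ⟨x, y⟩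
        + hnorm h x (gravWind h p g x) ^ 2 * F ⟨x, y⟩ ^ 2)
      = hnorm h x y ^ 2 + g * beta h p g x y * F ⟨x, y⟩

end Slope

/-! ### The diagram of the traction coefficients -/

/-- The square `[0, 1] × [0, 1]` without the corner `(1, 1)`. -/
def domS : Set (ℝ × ℝ) := (Icc 0 1 ×ˢ Icc 0 1) \ {(1, 1)}

def domD1 : Set (ℝ × ℝ) := {q | q ∈ domS ∧ q.1 ≥ q.2 ∧ q.2 > 2 * q.1 - 1}

def domD2 : Set (ℝ × ℝ) := {q | q ∈ domS ∧ (3 * q.2 - 1) / 2 < q.1 ∧ q.1 < q.2}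

def domD3 : Set (ℝ × ℝ) := {q | q ∈ domS ∧ q.1 ≥ 1 / 2 ∧ q.2 ≤ 2 * q.1 - 1}

def domD4 : Set (ℝ × ℝ) := {q | q ∈ domS ∧ q.2 ≥ 1 / 3 ∧ q.1 ≤ (3 * q.2 - 1) / 2}

/-- The restriction on the force of the gravitational wind. -/
def WindCondition [IsManifold (𝓡 n) ∞ M] (h : RiemMetric n M) (p : M → ℝ) (g η η' : ℝ) : Prop :=
  ((η, η') ∈ domD1 ∪ domD2 ∧ ∀ x : M, hnorm h x (gravWind h p g x) < 1 / (1 - η')) ∨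
  ((η, η') ∈ domD3 ∪ domD4 ∧ ∀ x : M, hnorm h x (gravWind h p g x) < 1 / (2 * |η - η'|)) ∨
  (η, η') = (1, 1)

end SlopeNav

end

set_option linter.unusedSectionVars false

noncomputable section

namespace SlopeNav

open Filter Topology

/-! Slope metrics. Write G for the gravitational wind at a point, γ = ‖G‖, c = η - η̃, k = 1 - η. If
y/z is the resultant velocity of the self-velocity u, then Y = y - zkG equals z(1 + c⟨G,u⟩)u. As
long as 1 + c⟨G,u⟩ > 0, eliminating u gives ‖Y‖² = z(‖Y‖ + c⟨Y,G⟩), that is Φ(y - zkG) = z with Φ(Y)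
= ‖Y‖²/(‖Y‖ + c⟨Y,G⟩). So the slope metric is Zermelo navigation with wind kG on top of a
Matsumoto-type norm Φ whose unit sphere is a limaçon. Everything rests on two scalar inequalities,
collected in `IsMildWind`: 2|c|γ < 1 (the limaçon is strongly convex) and (c + k)γ < 1 (the
remaining wind is weaker than the craft: Φ(-kG) < 1). The case distinction of the wind condition
only records which of the two is the stronger one (`windCondition_iff`).

Under these inequalities z ↦ Φ(y - zkG) grows with slope less than one (`IsMildWind.windNorm_le`),
so there is exactly one root. The derivative of the equation in z does not vanish
(`IsMildWind.transversal`), so the root is smooth. Differentiating the equation twice along a line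
in a fibre expresses F'' through a square and a Cauchy–Schwarz defect (`convexity_algebra`), which
gives strong convexity. Conversely, (c + k)γ ≥ 1 would put two different multiples of one vector on
the indicatrix, or the zero vector, and strong convexity at the two points of the indicatrix on the
axis of G forces 1 ± 2cγ > 0 (`one_add_two_mul_pos_of_convex`, `IsSlopeMetric.isMildWind`).

Time-minimal paths. Trajectories are exactly the piecewise smooth paths of unit F-speed, so it
remains to prove, for an arbitrary Finsler metric, that locally shortest unit-speed paths are the
unit-speed geodesics (`isLocallyShortestOn_iff`). In one direction the first variation and the lemma
of du Bois-Reymond give the Euler–Lagrange equation on both sides of a possible break and the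
equality of the momenta there. The strict fundamental inequality makes velocity a function of
momentum, so there is no corner (`IsLocalFinsler.geodesic_of_minimal`).

In the other direction a short geodesic c is calibrated: there is a function S with dS ≤ F and
S(c(t)) = t (`IsLocalFinsler.exists_calibration`). Integrating dS along a competitor bounds its
duration from below. The function S is written down explicitly, as a first-order expansion along c
corrected by a quadratic term, so that neither an exponential map nor a field of geodesics is
needed. Competitors that leave the chart take too long for a simpler reason: they must cross a shell
of fixed width. -/

theorem hasDerivAt_comp_line {X G : Type*} [NormedAddCommGroup X] [NormedSpace ℝ X]
    [NormedAddCommGroup G] [NormedSpace ℝ G] {f : X → G} {f' : X →L[ℝ] G} {p w : X} {s : ℝ}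
    (h : HasFDerivAt f f' (p + s • w)) : HasDerivAt (fun s : ℝ => f (p + s • w)) (f' w) s := by
  have h1 : HasDerivAt (fun s : ℝ => p + s • w) w s := by
    simpa using ((hasDerivAt_id s).smul_const w).const_add p
  exact h.comp_hasDerivAt s h1

theorem hasDerivAt_comp_line_apply {X G : Type*} [NormedAddCommGroup X] [NormedSpace ℝ X]
    [NormedAddCommGroup G] [NormedSpace ℝ G] {f : X → X →L[ℝ] G} {f' : X →L[ℝ] X →L[ℝ] G}
    {p w z : X} {s : ℝ} (h : HasFDerivAt f f' (p + s • w)) :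
    HasDerivAt (fun s : ℝ => f (p + s • w) z) (f' w z) s := by
  simpa using (hasDerivAt_comp_line h).clm_apply (hasDerivAt_const s z)

/-! ### Finsler metrics in coordinates: Euler's identity and the fundamental inequality. -/

section LocalFinsler

variable {E : Type*} [NormedAddCommGroup E] [NormedSpace ℝ E]

/-- A Finsler metric in the coordinates `(x, y)` of an open subset `U` of a Euclidean space. -/
structure IsLocalFinsler (U : Set E) (Φ : E × E → ℝ) : Prop where
  isOpen : IsOpen U
  smooth : ContDiffOn ℝ ∞ Φ (U ×ˢ {0}ᶜ)
  pos : ∀ x ∈ U, ∀ y, y ≠ 0 → 0 < Φ (x, y)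
  homog : ∀ x ∈ U, ∀ (y : E) (c : ℝ), 0 < c → Φ (x, c • y) = c * Φ (x, y)
  convex : ∀ x ∈ U, ∀ y w : E, y ≠ 0 → w ≠ 0 →
    0 < fderiv ℝ (fderiv ℝ (fun p => Φ p ^ 2)) (x, y) (0, w) (0, w)

/-- The Euler–Lagrange equation of the energy `Φ²` at a point `x` for the velocity `v` and the
acceleration `a`. -/
def EulerLagrange (Φ : E × E → ℝ) (x v a : E) : Prop :=
  ∀ w : E, fderiv ℝ (fderiv ℝ (fun p => Φ p ^ 2)) (x, v) (v, a) (0, w)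
    = fderiv ℝ (fun p => Φ p ^ 2) (x, v) (w, 0)

namespace IsLocalFinsler

variable {U : Set E} {Φ : E × E → ℝ} (hΦ : IsLocalFinsler U Φ)
include hΦ

theorem isOpen_domain : IsOpen (U ×ˢ ({0}ᶜ : Set E)) :=
  hΦ.isOpen.prod isOpen_compl_singleton

theorem mem_nhds {x v : E} (hx : x ∈ U) (hv : v ≠ 0) : U ×ˢ ({0}ᶜ : Set E) ∈ 𝓝 (x, v) :=
  hΦ.isOpen_domain.mem_nhds ⟨hx, hv⟩

theorem contDiffAt {x v : E} (hx : x ∈ U) (hv : v ≠ 0) : ContDiffAt ℝ ∞ Φ (x, v) :=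
  hΦ.smooth.contDiffAt (hΦ.mem_nhds hx hv)

theorem contDiffAt_sq {x v : E} (hx : x ∈ U) (hv : v ≠ 0) :
    ContDiffAt ℝ ∞ (fun p => Φ p ^ 2) (x, v) :=
  (hΦ.contDiffAt hx hv).pow 2

theorem hasFDerivAt {x v : E} (hx : x ∈ U) (hv : v ≠ 0) :
    HasFDerivAt Φ (fderiv ℝ Φ (x, v)) (x, v) :=
  ((hΦ.contDiffAt hx hv).differentiableAt (by simp)).hasFDerivAt

theorem contDiffAt_fderiv {x v : E} (hx : x ∈ U) (hv : v ≠ 0) :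
    ContDiffAt ℝ ∞ (fderiv ℝ Φ) (x, v) :=
  (hΦ.contDiffAt hx hv).fderiv_right (m := ∞) (by simp)

theorem contDiffAt_fderiv_sq {x v : E} (hx : x ∈ U) (hv : v ≠ 0) :
    ContDiffAt ℝ ∞ (fderiv ℝ (fun p => Φ p ^ 2)) (x, v) :=
  (hΦ.contDiffAt_sq hx hv).fderiv_right (m := ∞) (by simp)

theorem contDiffAt_fderiv_fderiv {x v : E} (hx : x ∈ U) (hv : v ≠ 0) :
    ContDiffAt ℝ ∞ (fderiv ℝ (fderiv ℝ Φ)) (x, v) :=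
  (hΦ.contDiffAt_fderiv hx hv).fderiv_right (m := ∞) (by simp)

theorem contDiffAt_fderiv_fderiv_sq {x v : E} (hx : x ∈ U) (hv : v ≠ 0) :
    ContDiffAt ℝ ∞ (fderiv ℝ (fderiv ℝ (fun p => Φ p ^ 2))) (x, v) :=
  (hΦ.contDiffAt_fderiv_sq hx hv).fderiv_right (m := ∞) (by simp)

theorem hasFDerivAt_fderiv {x v : E} (hx : x ∈ U) (hv : v ≠ 0) :
    HasFDerivAt (fderiv ℝ Φ) (fderiv ℝ (fderiv ℝ Φ) (x, v)) (x, v) :=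
  ((hΦ.contDiffAt_fderiv hx hv).differentiableAt (by simp)).hasFDerivAt

theorem hasFDerivAt_fderiv_sq {x v : E} (hx : x ∈ U) (hv : v ≠ 0) :
    HasFDerivAt (fderiv ℝ (fun p => Φ p ^ 2)) (fderiv ℝ (fderiv ℝ (fun p => Φ p ^ 2)) (x, v))
      (x, v) :=
  ((hΦ.contDiffAt_fderiv_sq hx hv).differentiableAt (by simp)).hasFDerivAt

theorem hasFDerivAt_sq {x v : E} (hx : x ∈ U) (hv : v ≠ 0) :
    HasFDerivAt (fun p => Φ p ^ 2) (fderiv ℝ (fun p => Φ p ^ 2) (x, v)) (x, v) :=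
  ((hΦ.contDiffAt_sq hx hv).differentiableAt (by simp)).hasFDerivAt

theorem fderiv_sq {x v : E} (hx : x ∈ U) (hv : v ≠ 0) :
    fderiv ℝ (fun p => Φ p ^ 2) (x, v) = (2 * Φ (x, v)) • fderiv ℝ Φ (x, v) := by
  have := ((hΦ.hasFDerivAt hx hv).pow 2).fderiv
  rw [this]; simp

theorem fderiv_fderiv_sq {x v : E} (hx : x ∈ U) (hv : v ≠ 0) (w w' : E × E) :
    fderiv ℝ (fderiv ℝ (fun p => Φ p ^ 2)) (x, v) w w'
      = 2 * fderiv ℝ Φ (x, v) w * fderiv ℝ Φ (x, v) w'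
        + 2 * Φ (x, v) * fderiv ℝ (fderiv ℝ Φ) (x, v) w w' := by
  have h1 : fderiv ℝ (fun p => Φ p ^ 2) =ᶠ[𝓝 (x, v)] fun p => (2 * Φ p) • fderiv ℝ Φ p := by
    filter_upwards [hΦ.mem_nhds hx hv] with p hp
    exact hΦ.fderiv_sq hp.1 hp.2
  have h2 := ((hΦ.hasFDerivAt hx hv).const_mul 2).smul (hΦ.hasFDerivAt_fderiv hx hv)
  rw [h1.fderiv_eq]
  rw [show (fun p => (2 * Φ p) • fderiv ℝ Φ p) = ((fun y => 2 * Φ y) • fderiv ℝ Φ) from rfl,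
    h2.fderiv]
  simp
  ring

theorem map_zero {x : E} (hx : x ∈ U) : Φ (x, 0) = 0 := by
  have := hΦ.homog x hx 0 2 (by norm_num)
  simp at this
  linarith

theorem euler {x v : E} (hx : x ∈ U) (hv : v ≠ 0) : fderiv ℝ Φ (x, v) (0, v) = Φ (x, v) := by
  have h1 : HasDerivAt (fun s : ℝ => ((x, s • v) : E × E)) (0, (1 : ℝ) • v) 1 :=
    (hasDerivAt_const _ _).prodMk ((hasDerivAt_id (1 : ℝ)).smul_const v)
  have h2 : HasFDerivAt Φ (fderiv ℝ Φ (x, v)) ((fun s : ℝ => ((x, s • v) : E × E)) 1) := by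
    simpa using hΦ.hasFDerivAt hx hv
  have h3 := h2.comp_hasDerivAt (1 : ℝ) h1
  have h4 : HasDerivAt (fun s : ℝ => s * Φ (x, v)) (1 * Φ (x, v)) 1 :=
    (hasDerivAt_id (1 : ℝ)).mul_const _
  have h5 : (Φ ∘ fun s : ℝ => ((x, s • v) : E × E)) =ᶠ[𝓝 1] fun s : ℝ => s * Φ (x, v) := by
    filter_upwards [lt_mem_nhds (show (0 : ℝ) < 1 by norm_num)] with s hs
    exact hΦ.homog x hx v s hs
  have := (h4.congr_of_eventuallyEq h5).unique h3
  simpa using this.symm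

/-- The fundamental inequality, with its equality case. -/
theorem fderiv_lt_of_ne {x v y : E} (hx : x ∈ U) (hv : Φ (x, v) = 1) (hy : Φ (x, y) = 1)
    (hne : y ≠ v) : fderiv ℝ Φ (x, v) (0, y) < 1 := by
  have hv0 : v ≠ 0 := by rintro rfl; rw [hΦ.map_zero hx] at hv; norm_num at hv
  have hy0 : y ≠ 0 := by rintro rfl; rw [hΦ.map_zero hx] at hy; norm_num at hy
  -- Convexity of Φ² is available only off the origin, hence the split. If the segment from v to y
  -- misses 0, then Φ² along it is strictly convex with equal end values, so its slope at v is
  -- negative, and by Euler's identity this slope is 2(dΦ(y) - 1). Otherwise y is a nonpositive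
  -- multiple of v and dΦ(y) ≤ 0.
  by_cases hseg : ∀ s ∈ Icc (0 : ℝ) 1, v + s • (y - v) ≠ 0
  · have hseg' : ∀ s ∈ Icc (0 : ℝ) 1, (x, v) + s • ((0, y - v) : E × E) = (x, v + s • (y - v)) := by
      intro s _; simp
    let q : ℝ → ℝ := fun s => (fun p => Φ p ^ 2) ((x, v) + s • ((0, y - v) : E × E))
    let q' : ℝ → ℝ := fun s =>
      fderiv ℝ (fun p => Φ p ^ 2) ((x, v) + s • ((0, y - v) : E × E)) (0, y - v)
    have hq : ∀ s ∈ Icc (0 : ℝ) 1, HasDerivAt q (q' s) s := fun s hs => by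
      refine hasDerivAt_comp_line (f := fun p => Φ p ^ 2) ?_
      rw [hseg' s hs]
      exact hΦ.hasFDerivAt_sq hx (hseg s hs)
    have hq' : ∀ s ∈ Icc (0 : ℝ) 1, HasDerivAt q'
        (fderiv ℝ (fderiv ℝ (fun p => Φ p ^ 2)) (x, v + s • (y - v)) (0, y - v) (0, y - v)) s := by
      intro s hs
      have h1 := hΦ.hasFDerivAt_fderiv_sq hx (hseg s hs)
      rw [← hseg' s hs] at h1 ⊢
      exact hasDerivAt_comp_line_apply h1
    have hmono : StrictMonoOn q' (Icc 0 1) := by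
      refine strictMonoOn_of_deriv_pos (convex_Icc 0 1)
        (fun s hs => (hq' s hs).continuousAt.continuousWithinAt) ?_
      intro s hs
      rw [interior_Icc] at hs
      rw [(hq' s (Ioo_subset_Icc_self hs)).deriv]
      exact hΦ.convex x hx _ _ (hseg s (Ioo_subset_Icc_self hs)) (sub_ne_zero.2 hne)
    obtain ⟨s, hs, hs'⟩ := exists_hasDerivAt_eq_slope q q' (show (0 : ℝ) < 1 by norm_num)
      (fun s hs => (hq s hs).continuousAt.continuousWithinAt)
      (fun s hs => hq s (Ioo_subset_Icc_self hs))
    have h0 : q 0 = 1 := by simp [q, hv]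
    have h1 : q 1 = 1 := by
      simp only [q]
      rw [hseg' 1 (right_mem_Icc.2 zero_le_one)]
      simp [hy]
    rw [h0, h1] at hs'
    have h2 := hmono (left_mem_Icc.2 zero_le_one) (Ioo_subset_Icc_self hs) hs.1
    have h3 : q' 0 = 2 * (fderiv ℝ Φ (x, v) (0, y) - 1) := by
      have : ((0, y - v) : E × E) = (0, y) - (0, v) := by simp
      simp only [q', zero_smul, add_zero]
      rw [hΦ.fderiv_sq hx hv0, this, hv]
      simp only [smul_apply, map_sub, hΦ.euler hx hv0, hv, smul_eq_mul]
      ring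
    rw [h3, hs'] at h2
    norm_num at h2
    linarith
  · push Not at hseg
    obtain ⟨s, hs, h0⟩ := hseg
    have h1 : s ≠ 0 := by rintro rfl; simp at h0; exact hv0 h0
    have hs0 : 0 < s := lt_of_le_of_ne hs.1 (Ne.symm h1)
    have h2 : s • y = -((1 - s) • v) := by
      have : v + s • (y - v) = s • y + (1 - s) • v := by module
      rw [this] at h0
      exact eq_neg_of_add_eq_zero_left h0
    have h3 : s * fderiv ℝ Φ (x, v) (0, y) = -((1 - s) * 1) := by
      have e1 : s * fderiv ℝ Φ (x, v) (0, y) = fderiv ℝ Φ (x, v) (0, s • y) := by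
        rw [show ((0, s • y) : E × E) = s • (0, y) by simp, map_smul, smul_eq_mul]
      have e2 : ((0, -((1 - s) • v)) : E × E) = -((1 - s) • (0, v)) := by simp
      rw [e1, h2, e2, map_neg, map_smul, hΦ.euler hx hv0, hv, smul_eq_mul]
    have : s * fderiv ℝ Φ (x, v) (0, y) ≤ 0 := by rw [h3]; linarith [hs.2]
    by_contra hcon
    push Not at hcon
    nlinarith

end IsLocalFinsler

end LocalFinsler

/-- Bootstrapping for a second-order equation: if (c, v) is of class Cᵏ, its derivative (v, V(c, v))
is of class Cᵏ too, so (c, v) gains one order. -/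
theorem contDiffOn_of_hasDerivAt_snd {E : Type*} [NormedAddCommGroup E] [NormedSpace ℝ E]
    {V : E × E → E} {O : Set (E × E)} (hV : ContDiffOn ℝ ∞ V O) {I : Set ℝ} (hI : IsOpen I)
    {c v : ℝ → E} (hc : ∀ t ∈ I, HasDerivAt c (v t) t)
    (hv : ∀ t ∈ I, HasDerivAt v (V (c t, v t)) t) (hO : ∀ t ∈ I, (c t, v t) ∈ O) :
    ContDiffOn ℝ ∞ (fun t => (c t, v t)) I := by
  have hd : ∀ t ∈ I, HasDerivAt (fun t => (c t, v t)) (v t, V (c t, v t)) t := fun t ht =>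
    (hc t ht).prodMk (hv t ht)
  rw [contDiffOn_infty]
  intro k
  induction k with
  | zero =>
    exact contDiffOn_zero.2 fun t ht => (hd t ht).continuousAt.continuousWithinAt
  | succ k ih =>
    push_cast
    rw [contDiffOn_succ_iff_deriv_of_isOpen hI]
    refine ⟨fun t ht => (hd t ht).differentiableAt.differentiableWithinAt, by simp, ?_⟩
    have h1 : ContDiffOn ℝ k (fun t => (v t, V (c t, v t))) I :=
      (contDiff_snd.comp_contDiffOn ih).prodMk ((hV.of_le (by exact_mod_cast le_top)).comp ih hO)
    exact h1.congr fun t ht => (hd t ht).deriv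

/-! ### The Euler–Lagrange equation as an explicit second-order equation. -/

section LocalFinsler

variable {E : Type*} [NormedAddCommGroup E] [NormedSpace ℝ E]

/-- The vertical Hessian of `Φ²`. -/
def vertHess (Φ : E × E → ℝ) (p : E × E) : E →L[ℝ] E →L[ℝ] ℝ :=
  ((ContinuousLinearMap.compL ℝ E (E × E) ℝ).flip (ContinuousLinearMap.inr ℝ E E)).comp
    ((fderiv ℝ (fderiv ℝ (fun p => Φ p ^ 2)) p).comp (ContinuousLinearMap.inr ℝ E E))

theorem vertHess_apply (Φ : E × E → ℝ) (p : E × E) (w w' : E) :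
    vertHess Φ p w w' = fderiv ℝ (fderiv ℝ (fun p => Φ p ^ 2)) p (0, w) (0, w') := by
  simp [vertHess]

/-- The right-hand side of the Euler–Lagrange equation solved for the vertical Hessian. -/
def vertForce (Φ : E × E → ℝ) (p : E × E) : E →L[ℝ] ℝ :=
  (fderiv ℝ (fun p => Φ p ^ 2) p).comp (ContinuousLinearMap.inl ℝ E E) -
    (fderiv ℝ (fderiv ℝ (fun p => Φ p ^ 2)) p (p.2, 0)).comp (ContinuousLinearMap.inr ℝ E E)

/-- The equation is affine in the acceleration, since (v, a) = (v, 0) + (0, a). Its linear part is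
the vertical Hessian, which strong convexity makes invertible; this is what `accel` inverts. -/
theorem eulerLagrange_iff_vertHess (Φ : E × E → ℝ) (x v a : E) :
    EulerLagrange Φ x v a ↔ vertHess Φ (x, v) a = vertForce Φ (x, v) := by
  have key : ∀ w, fderiv ℝ (fderiv ℝ (fun p => Φ p ^ 2)) (x, v) (v, a) (0, w)
      = fderiv ℝ (fderiv ℝ (fun p => Φ p ^ 2)) (x, v) (v, 0) (0, w)
        + fderiv ℝ (fderiv ℝ (fun p => Φ p ^ 2)) (x, v) (0, a) (0, w) := by
    intro w
    rw [show ((v, a) : E × E) = (v, 0) + (0, a) by simp, map_add, add_apply]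
  rw [ContinuousLinearMap.ext_iff]
  refine forall_congr' fun w => ?_
  rw [key, vertHess_apply]
  simp only [vertForce, sub_apply, ContinuousLinearMap.comp_apply,
    ContinuousLinearMap.inl_apply, ContinuousLinearMap.inr_apply]
  constructor <;> intro h <;> linarith

/-- The acceleration of the geodesic with a given velocity. -/
def accel (Φ : E × E → ℝ) (p : E × E) : E := (vertHess Φ p).inverse (vertForce Φ p)

namespace IsLocalFinsler

variable {U : Set E} {Φ : E × E → ℝ} (hΦ : IsLocalFinsler U Φ)
include hΦ

theorem exists_equiv_vertHess [FiniteDimensional ℝ E] {x v : E} (hx : x ∈ U) (hv : v ≠ 0) :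
    ∃ e : E ≃L[ℝ] (E →L[ℝ] ℝ), (e : E →L[ℝ] E →L[ℝ] ℝ) = vertHess Φ (x, v) := by
  have hinj : Function.Injective (vertHess Φ (x, v)).toLinearMap := by
    rw [← LinearMap.ker_eq_bot, LinearMap.ker_eq_bot']
    intro w hw
    by_contra hne
    have h2 : vertHess Φ (x, v) w w = 0 := by
      have : vertHess Φ (x, v) w = 0 := hw
      rw [this]; rfl
    rw [vertHess_apply] at h2
    exact absurd h2 (hΦ.convex x hx v w hv hne).ne'
  have hdim : Module.finrank ℝ E = Module.finrank ℝ (E →L[ℝ] ℝ) := by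
    rw [← (LinearMap.toContinuousLinearMap (𝕜 := ℝ) (E := E) (F' := ℝ)).finrank_eq]
    exact (Subspace.dual_finrank_eq (K := ℝ) (V := E)).symm
  refine ⟨(LinearEquiv.ofInjectiveOfFinrankEq (vertHess Φ (x, v)).toLinearMap hinj
    hdim).toContinuousLinearEquiv, ?_⟩
  ext w w'
  rfl

theorem eulerLagrange_iff [FiniteDimensional ℝ E] {x v : E} (hx : x ∈ U) (hv : v ≠ 0) (a : E) :
    EulerLagrange Φ x v a ↔ a = accel Φ (x, v) := by
  obtain ⟨e, he⟩ := hΦ.exists_equiv_vertHess hx hv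
  rw [eulerLagrange_iff_vertHess, accel, ← he, ContinuousLinearMap.inverse_equiv]
  constructor
  · intro h; rw [← h]; simp
  · rintro rfl; simp

theorem contDiffOn_accel [FiniteDimensional ℝ E] : ContDiffOn ℝ ∞ (accel Φ) (U ×ˢ {0}ᶜ) := by
  rintro ⟨x, v⟩ ⟨hx, hv⟩
  refine ContDiffAt.contDiffWithinAt ?_
  have h2 := hΦ.contDiffAt_fderiv_fderiv_sq hx hv
  have h1 := hΦ.contDiffAt_fderiv_sq hx hv
  have hH : ContDiffAt ℝ ∞ (vertHess Φ) (x, v) :=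
    contDiffAt_const.clm_comp (h2.clm_comp contDiffAt_const)
  have hF : ContDiffAt ℝ ∞ (vertForce Φ) (x, v) :=
    (h1.clm_comp contDiffAt_const).sub
      ((h2.clm_apply (contDiffAt_snd.prodMk contDiffAt_const)).clm_comp contDiffAt_const)
  obtain ⟨e, he⟩ := hΦ.exists_equiv_vertHess hx hv
  have hI : ContDiffAt ℝ ∞ (fun p => (vertHess Φ p).inverse) (x, v) := by
    have := contDiffAt_map_inverse (𝕜 := ℝ) (n := ∞) e
    rw [he] at this
    exact this.comp (x, v) hH
  exact hI.clm_apply hF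

/-- Conservation of energy. Differentiating Euler's identity for Φ² in the direction (v, a) and
inserting the Euler–Lagrange equation with w = v gives d(Φ²)(v, 0) + d(Φ²)(0, a) = 2 d(Φ²)(v, a),
and the left side is d(Φ²)(v, a). -/
theorem fderiv_sq_eq_zero {x v a : E} (hx : x ∈ U) (hv : v ≠ 0) (h : EulerLagrange Φ x v a) :
    fderiv ℝ (fun p => Φ p ^ 2) (x, v) (v, a) = 0 := by
  have h1 : (fun p : E × E => fderiv ℝ (fun p => Φ p ^ 2) p (0, p.2)) =ᶠ[𝓝 (x, v)]
      fun p => 2 * Φ p ^ 2 := by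
    filter_upwards [hΦ.mem_nhds hx hv] with p hp
    rw [show p = (p.1, p.2) from rfl, hΦ.fderiv_sq hp.1 hp.2]
    simp only [smul_apply, hΦ.euler hp.1 hp.2, smul_eq_mul]
    ring
  have h2 : HasFDerivAt (fun p : E × E => ((0, p.2) : E × E))
      ((0 : E × E →L[ℝ] E).prod (ContinuousLinearMap.snd ℝ E E)) (x, v) :=
    (hasFDerivAt_const _ _).prodMk hasFDerivAt_snd
  have h3 := ((hΦ.hasFDerivAt_fderiv_sq hx hv).clm_apply h2).congr_of_eventuallyEq h1.symm
  have h4 := DFunLike.congr_fun (h3.unique ((hΦ.hasFDerivAt_sq hx hv).const_mul 2)) (v, a)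
  simp only [add_apply, ContinuousLinearMap.comp_apply, ContinuousLinearMap.flip_apply,
    ContinuousLinearMap.prod_apply, zero_apply, ContinuousLinearMap.coe_snd', smul_apply,
    smul_eq_mul] at h4
  rw [h v] at h4
  have h5 : fderiv ℝ (fun p => Φ p ^ 2) (x, v) (v, a)
      = fderiv ℝ (fun p => Φ p ^ 2) (x, v) (v, 0) + fderiv ℝ (fun p => Φ p ^ 2) (x, v) (0, a) := by
    rw [← map_add]; simp
  linarith

/-- Along unit-speed curves the Euler–Lagrange equations of `Φ²` and of `Φ` agree. -/
theorem eulerLagrange_iff_of_eq_one {x v a : E} (hx : x ∈ U) (hv : v ≠ 0) (h1 : Φ (x, v) = 1) :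
    EulerLagrange Φ x v a ↔ fderiv ℝ Φ (x, v) (v, a) = 0 ∧
      ∀ w, fderiv ℝ (fderiv ℝ Φ) (x, v) (v, a) (0, w) = fderiv ℝ Φ (x, v) (w, 0) := by
  have key : ∀ w, fderiv ℝ (fun p => Φ p ^ 2) (x, v) w = 2 * fderiv ℝ Φ (x, v) w := by
    intro w
    rw [hΦ.fderiv_sq hx hv, h1]; simp
  constructor
  · intro h
    have h0 := hΦ.fderiv_sq_eq_zero hx hv h
    rw [key] at h0
    have h0' : fderiv ℝ Φ (x, v) (v, a) = 0 := by linarith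
    refine ⟨h0', fun w => ?_⟩
    have := h w
    rw [hΦ.fderiv_fderiv_sq hx hv, key, h0', h1] at this
    linarith
  · rintro ⟨h0, h⟩ w
    rw [hΦ.fderiv_fderiv_sq hx hv, key, h0, h1, h w]
    ring

theorem energy_deriv {c v : ℝ → E} {a : E} {t : ℝ} (hx : c t ∈ U) (hv : v t ≠ 0)
    (hc : HasDerivAt c (v t) t) (ha : HasDerivAt v a t) (h : EulerLagrange Φ (c t) (v t) a) :
    HasDerivAt (fun s => Φ (c s, v s) ^ 2) 0 t := by
  have := (hΦ.hasFDerivAt_sq hx hv).comp_hasDerivAt t (hc.prodMk ha)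
  rw [hΦ.fderiv_sq_eq_zero hx hv h] at this
  exact this

/-- Two geodesics which fit together to first order form a geodesic. -/
theorem hasDerivAt_accel_of_ne [FiniteDimensional ℝ E] {c v : ℝ → E} {t₀ : ℝ}
    (hx : c t₀ ∈ U) (hv : v t₀ ≠ 0) (cc : ContinuousAt c t₀) (cv : ContinuousAt v t₀)
    (hc : ∀ᶠ t in 𝓝[≠] t₀, HasDerivAt c (v t) t)
    (ha : ∀ᶠ t in 𝓝[≠] t₀, HasDerivAt v (accel Φ (c t, v t)) t) :
    HasDerivAt c (v t₀) t₀ ∧ HasDerivAt v (accel Φ (c t₀, v t₀)) t₀ := by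
  -- A continuous function whose derivative off a point has a limit there is differentiable at that
  -- point. This is applied from each side, to the position and then to the velocity.
  have aux : ∀ {f g : ℝ → E}, (∀ᶠ t in 𝓝[≠] t₀, HasDerivAt f (g t) t) → ContinuousAt f t₀ →
      ContinuousAt g t₀ → HasDerivAt f (g t₀) t₀ := by
    intro f g hfg hf hg
    have hd : ∀ᶠ t in 𝓝[≠] t₀, deriv f t = g t := hfg.mono fun t ht => ht.deriv
    have hdif : ∀ᶠ t in 𝓝[≠] t₀, DifferentiableAt ℝ f t := hfg.mono fun t ht => ht.differentiableAt
    have e : ∀ {l : Filter ℝ}, l ≤ 𝓝[≠] t₀ → Tendsto (deriv f) l (𝓝 (g t₀)) := by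
      intro l hl
      have : Tendsto g l (𝓝 (g t₀)) := hg.tendsto.mono_left (hl.trans nhdsWithin_le_nhds)
      exact this.congr' ((hd.filter_mono hl).mono fun t ht => ht.symm)
    have hr : HasDerivWithinAt f (g t₀) (Ici t₀) t₀ := by
      have hs : 𝓝[>] t₀ ≤ 𝓝[≠] t₀ := nhdsWithin_mono _ fun x hx => ne_of_gt hx
      obtain ⟨s, hs1, hs2⟩ := (hdif.filter_mono hs).exists_mem
      exact hasDerivWithinAt_Ici_of_tendsto_deriv (s := s)
        (fun x hx => (hs2 x hx).differentiableWithinAt) hf.continuousWithinAt hs1 (e hs)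
    have hl : HasDerivWithinAt f (g t₀) (Iic t₀) t₀ := by
      have hs : 𝓝[<] t₀ ≤ 𝓝[≠] t₀ := nhdsWithin_mono _ fun x hx => ne_of_lt hx
      obtain ⟨s, hs1, hs2⟩ := (hdif.filter_mono hs).exists_mem
      exact hasDerivWithinAt_Iic_of_tendsto_deriv (s := s)
        (fun x hx => (hs2 x hx).differentiableWithinAt) hf.continuousWithinAt hs1 (e hs)
    simpa using hl.union hr
  have hacc : ContinuousAt (fun t => accel Φ (c t, v t)) t₀ :=
    (((hΦ.contDiffOn_accel.contDiffAt (hΦ.mem_nhds hx hv)).continuousAt).comp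
      (f := fun t => (c t, v t)) (cc.prodMk cv))
  exact ⟨aux hc cc cv, aux ha cv hacc⟩

end IsLocalFinsler

end LocalFinsler

/-! ### Calibration of short geodesics. -/

theorem hasFDerivAt_comp_real {X G : Type*} [NormedAddCommGroup X] [NormedSpace ℝ X]
    [NormedAddCommGroup G] [NormedSpace ℝ G] {f : ℝ → G} {f' : G} {τ : X → ℝ} {τ' : X →L[ℝ] ℝ}
    {x : X} (hf : HasDerivAt f f' (τ x)) (hτ : HasFDerivAt τ τ' x) :
    HasFDerivAt (fun x => f (τ x)) (τ'.smulRight f') x := by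
  refine (hf.hasFDerivAt.comp x hτ).congr_fderiv ?_
  ext y
  simp

theorem continuousAt_comp_fst {X Y Z : Type*} [TopologicalSpace X] [TopologicalSpace Y]
    [TopologicalSpace Z] {f : X → Z} {x : X} {y : Y} (hf : ContinuousAt f x) :
    ContinuousAt (fun q : X × Y => f q.1) (x, y) :=
  ContinuousAt.comp (f := Prod.fst) (g := f) hf continuousAt_fst

theorem continuousAt_clm_apply_fst_snd {X Y Z : Type*} [TopologicalSpace X]
    [NormedAddCommGroup Y] [NormedSpace ℝ Y] [NormedAddCommGroup Z] [NormedSpace ℝ Z]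
    {f : X → Y →L[ℝ] Z} {x : X} {y : Y} (hf : ContinuousAt f x) :
    ContinuousAt (fun q : X × Y => f q.1 q.2) (x, y) :=
  (continuousAt_comp_fst hf).clm_apply continuousAt_snd

/-- First-order Taylor bound with a defect m in convexity: s ↦ f(p + sζ) + ms²/2 is convex on [0, 1]
and lies above its tangent at 0. -/
theorem le_of_second_derivative_add_nonneg {X : Type*} [NormedAddCommGroup X] [NormedSpace ℝ X]
    {f : X → ℝ} {f' : X → X →L[ℝ] ℝ} {f'' : X → X →L[ℝ] X →L[ℝ] ℝ} {p ζ : X} {m : ℝ}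
    (hf : ∀ s ∈ Icc (0 : ℝ) 1, HasFDerivAt f (f' (p + s • ζ)) (p + s • ζ))
    (hf' : ∀ s ∈ Icc (0 : ℝ) 1, HasFDerivAt f' (f'' (p + s • ζ)) (p + s • ζ))
    (hm : ∀ s ∈ Icc (0 : ℝ) 1, 0 ≤ f'' (p + s • ζ) ζ ζ + m) :
    f p + f' p ζ - m / 2 ≤ f (p + ζ) := by
  let q : ℝ → ℝ := fun s => f (p + s • ζ) + m / 2 * s ^ 2
  let q' : ℝ → ℝ := fun s => f' (p + s • ζ) ζ + m * s
  have hq : ∀ s ∈ Icc (0 : ℝ) 1, HasDerivAt q (q' s) s := fun s hs => by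
    refine ((hasDerivAt_comp_line (hf s hs)).add
      (((hasDerivAt_id s).pow 2).const_mul (m / 2))).congr_deriv ?_
    simp [q']; ring
  have hq' : ∀ s ∈ Icc (0 : ℝ) 1, HasDerivAt q' (f'' (p + s • ζ) ζ ζ + m) s := fun s hs => by
    refine ((hasDerivAt_comp_line_apply (hf' s hs)).add
      ((hasDerivAt_id s).const_mul m)).congr_deriv ?_
    simp
  have hmono : MonotoneOn q' (Icc 0 1) := by
    refine monotoneOn_of_deriv_nonneg (convex_Icc 0 1)
      (fun s hs => (hq' s hs).continuousAt.continuousWithinAt)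
      (fun s hs => (hq' s (interior_subset hs)).differentiableAt.differentiableWithinAt) ?_
    intro s hs
    rw [(hq' s (interior_subset hs)).deriv]
    exact hm s (interior_subset hs)
  obtain ⟨s, hs, hs'⟩ := exists_hasDerivAt_eq_slope q q' (show (0 : ℝ) < 1 by norm_num)
    (fun s hs => (hq s hs).continuousAt.continuousWithinAt)
    (fun s hs => hq s (Ioo_subset_Icc_self hs))
  have h2 := hmono (left_mem_Icc.2 zero_le_one) (Ioo_subset_Icc_self hs) hs.1.le
  rw [hs'] at h2
  simp only [q, q', zero_smul, add_zero, one_smul] at h2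
  norm_num at h2
  linarith

-- The Hessian of Φ is degenerate along the velocity and uncontrolled in the position variable. On
-- the kernel of l it is positive in w, and a large multiple of |z|² absorbs every term containing
-- z. The term with s is the one that the calibration below produces, s being the distance in time
-- from the base point.
set_option synthInstance.maxHeartbeats 200000 in
theorem exists_quadratic_bound {E : Type*} [NormedAddCommGroup E] [NormedSpace ℝ E]
    [FiniteDimensional ℝ E] {N : E →L[ℝ] E →L[ℝ] ℝ} (hN : ∀ z, ‖z‖ ^ 2 ≤ N z z)
    {B₀ : E × E →L[ℝ] E × E →L[ℝ] ℝ} {l : E →L[ℝ] ℝ}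
    (hB : ∀ w, l w = 0 → w ≠ 0 → 0 < B₀ (0, w) (0, w)) :
    ∃ K > 0, ∃ η > 0, ∀ B : E × E →L[ℝ] E × E →L[ℝ] ℝ, ‖B - B₀‖ < η → ∀ s : ℝ, |s| < η →
      ∀ z w, l w = 0 → 0 ≤ B (z, w) (z, w) + (K * N z z + 2 * K * s * N z w) := by
  obtain ⟨μ, hμ, hμB⟩ : ∃ μ > 0, ∀ w, l w = 0 → 2 * μ * ‖w‖ ^ 2 ≤ B₀ (0, w) (0, w) := by
    let C : Set E := Metric.sphere 0 1 ∩ {w | l w = 0}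
    have hC : IsCompact C :=
      (isCompact_sphere 0 1).inter_right (isClosed_eq l.continuous continuous_const)
    have hcont : Continuous fun w : E => B₀ (0, w) (0, w) := by fun_prop
    have hmin : ∃ μ > 0, ∀ w ∈ C, 2 * μ ≤ B₀ (0, w) (0, w) := by
      rcases C.eq_empty_or_nonempty with h | h
      · exact ⟨1, one_pos, by simp [h]⟩
      · obtain ⟨w, hw, hmin⟩ := hC.exists_isMinOn h hcont.continuousOn
        have hw0 : w ≠ 0 := by
          rintro rfl
          have := hw.1
          simp at this
        refine ⟨B₀ (0, w) (0, w) / 2, half_pos (hB w hw.2 hw0), fun w' hw' => ?_⟩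
        have : B₀ (0, w) (0, w) ≤ B₀ (0, w') (0, w') := hmin hw'
        linarith
    obtain ⟨μ, hμ, h⟩ := hmin
    refine ⟨μ, hμ, fun w hw => ?_⟩
    rcases eq_or_ne w 0 with rfl | hw0
    · simp [show ((0, 0) : E × E) = 0 from rfl]
    · have hn : ‖w‖ ≠ 0 := norm_ne_zero_iff.2 hw0
      have h1 := h (‖w‖⁻¹ • w) ⟨by simp [norm_smul, hn], by simp [hw]⟩
      have h2 : ((0, ‖w‖⁻¹ • w) : E × E) = ‖w‖⁻¹ • (0, w) := by simp
      rw [h2] at h1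
      simp only [map_smul, smul_apply, smul_eq_mul] at h1
      calc 2 * μ * ‖w‖ ^ 2 ≤ ‖w‖⁻¹ * (‖w‖⁻¹ * B₀ (0, w) (0, w)) * ‖w‖ ^ 2 := by gcongr
        _ = B₀ (0, w) (0, w) := by field_simp
  have hm0 : 0 ≤ ‖B₀‖ := norm_nonneg B₀
  set m := ‖B₀‖ with hm
  -- The summand m bounds B₀ on (z, 0), μ pays for B - B₀, and (m + 1)²/μ completes the square that
  -- absorbs 2(m + 1)‖z‖‖w‖. The additional 1 there stands for the term 2Ks N(z, w), which the
  -- choice of η keeps below 2‖z‖‖w‖.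
  set K := m + μ + (m + 1) ^ 2 / μ with hK
  have hK0 : 0 < K := by positivity
  set η := min μ (1 / (K * (‖N‖ + 1))) with hη
  have hη0 : 0 < η := by positivity
  refine ⟨K, hK0, η, hη0, fun B hBB s hs z w hw => ?_⟩
  have e1 : ∀ z' w' : E × E, |B₀ z' w'| ≤ m * ‖z'‖ * ‖w'‖ := fun z' w' => B₀.le_opNorm₂ z' w'
  have e2 : |(B - B₀) (z, w) (z, w)| ≤ μ * (‖z‖ ^ 2 + ‖w‖ ^ 2) := by
    have h1 : |(B - B₀) (z, w) (z, w)| ≤ ‖B - B₀‖ * ‖(z, w)‖ * ‖(z, w)‖ :=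
      (B - B₀).le_opNorm₂ _ _
    have h2 : ‖(z, w)‖ * ‖(z, w)‖ ≤ ‖z‖ ^ 2 + ‖w‖ ^ 2 := by
      rw [Prod.norm_mk]
      rcases max_choice ‖z‖ ‖w‖ with h | h <;> rw [h] <;> nlinarith [sq_nonneg ‖z‖, sq_nonneg ‖w‖]
    have h3 : ‖B - B₀‖ ≤ μ := hBB.le.trans (min_le_left _ _)
    calc _ ≤ ‖B - B₀‖ * (‖(z, w)‖ * ‖(z, w)‖) := by rw [← mul_assoc]; exact h1
      _ ≤ μ * (‖z‖ ^ 2 + ‖w‖ ^ 2) := by gcongr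
  have e3 : B₀ (z, w) (z, w) = B₀ (0, w) (0, w) + B₀ (z, 0) (0, w) + B₀ (0, w) (z, 0)
      + B₀ (z, 0) (z, 0) := by
    rw [show ((z, w) : E × E) = (z, 0) + (0, w) by simp]
    simp only [map_add, add_apply]
    ring
  have e4 := abs_le.1 (e1 (z, 0) (0, w))
  have e5 := abs_le.1 (e1 (0, w) (z, 0))
  have e6 := abs_le.1 (e1 (z, 0) (z, 0))
  simp only [Prod.norm_mk, norm_zero, norm_nonneg, max_eq_left, max_eq_right] at e4 e5 e6
  have e7 : |2 * K * s * N z w| ≤ 2 * ‖z‖ * ‖w‖ := by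
    have h1 : |N z w| ≤ ‖N‖ * ‖z‖ * ‖w‖ := N.le_opNorm₂ z w
    have h2 : |s| ≤ 1 / (K * (‖N‖ + 1)) := hs.le.trans (min_le_right _ _)
    have h3 : K * |s| * ‖N‖ ≤ 1 := by
      calc K * |s| * ‖N‖ ≤ K * (1 / (K * (‖N‖ + 1))) * (‖N‖ + 1) := by gcongr; linarith
        _ = 1 := by field_simp
    rw [abs_mul, abs_mul, abs_mul, abs_of_pos hK0, abs_of_pos (by norm_num : (0 : ℝ) < 2)]
    calc 2 * K * |s| * |N z w| ≤ 2 * K * |s| * (‖N‖ * ‖z‖ * ‖w‖) := by gcongr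
      _ = 2 * (K * |s| * ‖N‖) * (‖z‖ * ‖w‖) := by ring
      _ ≤ 2 * 1 * (‖z‖ * ‖w‖) := by gcongr
      _ = _ := by ring
  have e8 : B (z, w) (z, w) = B₀ (z, w) (z, w) + (B - B₀) (z, w) (z, w) := by simp
  have e9 : 2 * (m + 1) * ‖z‖ * ‖w‖ ≤ μ * ‖w‖ ^ 2 + (m + 1) ^ 2 / μ * ‖z‖ ^ 2 := by
    have : 0 ≤ (μ * ‖w‖ - (m + 1) * ‖z‖) ^ 2 / μ := by positivity
    have h2 : (μ * ‖w‖ - (m + 1) * ‖z‖) ^ 2 / μ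
        = μ * ‖w‖ ^ 2 + (m + 1) ^ 2 / μ * ‖z‖ ^ 2 - 2 * (m + 1) * ‖z‖ * ‖w‖ := by
      field_simp; ring
    linarith
  have e10 : K * ‖z‖ ^ 2 ≤ K * N z z := by gcongr; exact hN z
  have e11 : K * ‖z‖ ^ 2 = m * ‖z‖ ^ 2 + μ * ‖z‖ ^ 2 + (m + 1) ^ 2 / μ * ‖z‖ ^ 2 := by
    rw [hK]; ring
  have e12 := hμB w hw
  have e13 := (abs_le.1 e2).1
  have e14 := (abs_le.1 e7).1
  nlinarith [e4.1, e5.1, e6.1]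

namespace IsLocalFinsler

variable {E : Type*} [NormedAddCommGroup E] [NormedSpace ℝ E] [FiniteDimensional ℝ E]
  {U : Set E} {Φ : E × E → ℝ}

set_option maxHeartbeats 1000000 in
set_option synthInstance.maxHeartbeats 200000 in
/-- A subsolution of the eikonal equation calibrating a short geodesic. -/
theorem exists_calibration (hΦ : IsLocalFinsler U Φ) {N : E →L[ℝ] E →L[ℝ] ℝ}
    (hNs : ∀ z w, N z w = N w z) (hN : ∀ z, ‖z‖ ^ 2 ≤ N z z) {c v : ℝ → E} {t₀ : ℝ}
    (hgeo : ∀ᶠ t in 𝓝 t₀, c t ∈ U ∧ v t ≠ 0 ∧ HasDerivAt c (v t) t ∧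
      HasDerivAt v (accel Φ (c t, v t)) t ∧ Φ (c t, v t) = 1) :
    ∃ S : E → ℝ, (∀ᶠ x in 𝓝 (c t₀), ∃ S' : E →L[ℝ] ℝ, HasFDerivAt S S' x ∧
      ∀ y, S' y ≤ Φ (x, y)) ∧ ∀ᶠ t in 𝓝 t₀, S (c t) = t := by
  obtain ⟨hx₀, hv₀, hc₀, ha₀, h1₀⟩ := hgeo.self_of_nhds
  -- The momentum at the base time. It equals 1 on the velocity, so its level sets cut the curve
  -- transversally and define a time function. On its kernel the vertical Hessians of Φ² and of 2Φ
  -- agree, so that of Φ is positive there.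
  set l : E →L[ℝ] ℝ := (fderiv ℝ Φ (c t₀, v t₀)).comp (ContinuousLinearMap.inr ℝ E E) with hl
  have hlw : ∀ w, l w = fderiv ℝ Φ (c t₀, v t₀) (0, w) := fun w => by simp [hl]
  have hlv : l (v t₀) = 1 := by rw [hlw, hΦ.euler hx₀ hv₀, h1₀]
  obtain ⟨K, hK, η, hη, hquad⟩ := exists_quadratic_bound hN
    (B₀ := fderiv ℝ (fderiv ℝ Φ) (c t₀, v t₀)) (l := l) (by
      intro w hw hw0
      have h1 := hΦ.convex _ hx₀ _ w hv₀ hw0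
      rw [hΦ.fderiv_fderiv_sq hx₀ hv₀, ← hlw, hw, h1₀] at h1
      linarith)
  -- the time function
  have hlc : ∀ᶠ t in 𝓝 t₀, HasDerivAt (fun t => l (c t)) (l (v t)) t :=
    hgeo.mono fun t ht => l.hasFDerivAt.comp_hasDerivAt t ht.2.2.1
  have hvc : ContinuousAt v t₀ := ha₀.continuousAt
  have hcc : ContinuousAt c t₀ := hc₀.continuousAt
  have hstrict : HasStrictDerivAt (fun t => l (c t)) 1 t₀ := by
    have := hasStrictDerivAt_of_hasDerivAt_of_continuousAt hlc (l.continuous.continuousAt.comp hvc)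
    rwa [hlv] at this
  set e := (hstrict.hasStrictFDerivAt_equiv one_ne_zero).toOpenPartialHomeomorph
    (fun t => l (c t)) with he
  have hes : t₀ ∈ e.source :=
    (hstrict.hasStrictFDerivAt_equiv one_ne_zero).mem_toOpenPartialHomeomorph_source
  have hee : ∀ t, e t = l (c t) := fun t => rfl
  have het : l (c t₀) ∈ e.target := e.map_source hes
  set τ : E → ℝ := fun x => e.symm (l x) with hτ
  have hτ₀ : τ (c t₀) = t₀ := e.left_inv hes
  have hτc : ContinuousAt τ (c t₀) :=
    ContinuousAt.comp (f := l) (g := e.symm) (e.continuousAt_symm het) l.continuous.continuousAt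
  have hτt : Tendsto τ (𝓝 (c t₀)) (𝓝 t₀) := by
    have := hτc.tendsto
    rwa [hτ₀] at this
  have hlv_pos : ∀ᶠ t in 𝓝 t₀, 0 < l (v t) :=
    (l.continuous.continuousAt.comp hvc).eventually (lt_mem_nhds (by
      simp only [Function.comp_apply, hlv]; norm_num))
  set τ' : E → E →L[ℝ] ℝ := fun x => (l (v (τ x)))⁻¹ • l with hτ'
  have hτd : ∀ᶠ x in 𝓝 (c t₀), HasFDerivAt τ (τ' x) x := by
    have h1 : ∀ᶠ x in 𝓝 (c t₀), l x ∈ e.target :=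
      l.continuous.continuousAt.eventually (e.open_target.mem_nhds het)
    filter_upwards [h1, hτt.eventually hlc, hτt.eventually hlv_pos] with x hx1 hx2 hx3
    exact (e.hasDerivAt_symm hx1 hx3.ne' hx2).comp_hasFDerivAt x l.hasFDerivAt
  -- the momentum
  set P : ℝ → E →L[ℝ] ℝ := fun t =>
    (fderiv ℝ Φ (c t, v t)).comp (ContinuousLinearMap.inr ℝ E E) with hP
  set P' : ℝ → E →L[ℝ] ℝ := fun t =>
    (fderiv ℝ Φ (c t, v t)).comp (ContinuousLinearMap.inl ℝ E E) with hP'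
  have hPd : ∀ᶠ t in 𝓝 t₀, HasDerivAt P (P' t) t := by
    filter_upwards [hgeo] with t ⟨hx, hv, hc, ha, h1⟩
    have h2 := (hΦ.hasFDerivAt_fderiv hx hv).comp_hasDerivAt t (hc.prodMk ha)
    have h3 := h2.clm_comp (hasDerivAt_const t (ContinuousLinearMap.inr ℝ E E))
    refine h3.congr_deriv ?_
    ext w
    have := ((hΦ.eulerLagrange_iff_of_eq_one hx hv h1).1
      ((hΦ.eulerLagrange_iff hx hv _).2 rfl)).2 w
    simpa [hP'] using this
  have hpc : ContinuousAt (fun t => fderiv ℝ Φ (c t, v t)) t₀ :=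
    ContinuousAt.comp (f := fun t => (c t, v t)) (g := fderiv ℝ Φ)
      (hΦ.contDiffAt_fderiv hx₀ hv₀).continuousAt (hcc.prodMk hvc)
  have hPc : ContinuousAt P t₀ := hpc.clm_comp continuousAt_const
  have hPc' : ContinuousAt P' t₀ := hpc.clm_comp continuousAt_const
  set ζ : E → E := fun x => x - c (τ x) with hζ
  have hcτ : ContinuousAt (fun x => c (τ x)) (c t₀) :=
    ContinuousAt.comp (f := τ) (g := c) (by rwa [hτ₀]) hτc
  have hvτ : ContinuousAt (fun x => v (τ x)) (c t₀) :=
    ContinuousAt.comp (f := τ) (g := v) (by rwa [hτ₀]) hτc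
  have hζc : ContinuousAt ζ (c t₀) := continuousAt_id.sub hcτ
  have hζ₀ : ζ (c t₀) = 0 := by simp [hζ, hτ₀]
  set ζ' : E → E →L[ℝ] E := fun x =>
    ContinuousLinearMap.id ℝ E - (τ' x).smulRight (v (τ x)) with hζ'
  have hζd : ∀ᶠ x in 𝓝 (c t₀), HasFDerivAt ζ (ζ' x) x := by
    filter_upwards [hτd, hτt.eventually hgeo] with x hx hgx
    exact (hasFDerivAt_id x).sub (hasFDerivAt_comp_real hgx.2.2.1 hx)
  -- On the slice τ = t this is the value t plus the momentum P(t) applied to the offset from c(t),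
  -- minus a quadratic correction. The correction is zero on the slice of the base time, but
  -- differentiating its factor τ - t₀ contributes -(K/2) N(ζ, ζ) along the flow of time. This is
  -- the slack that makes S a subsolution.
  set S : E → ℝ := fun x =>
    τ x + P (τ x) (ζ x) - K / 2 * ((τ x - t₀) * N (ζ x) (ζ x)) with hS
  set S' : E → E →L[ℝ] ℝ := fun x => τ' x + ((P (τ x)).comp (ζ' x) + (P' (τ x) (ζ x)) • τ' x)
    - (K / 2) • ((N (ζ x) (ζ x)) • τ' x + (2 * (τ x - t₀)) • (N (ζ x)).comp (ζ' x)) with hS'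
  have hSd : ∀ᶠ x in 𝓝 (c t₀), HasFDerivAt S (S' x) x := by
    filter_upwards [hτd, hζd, hτt.eventually hPd] with x h1 h2 h3
    have h4 : HasFDerivAt (fun x => P (τ x)) ((τ' x).smulRight (P' (τ x))) x :=
      hasFDerivAt_comp_real h3 h1
    have h5 : HasFDerivAt (fun x => N (ζ x)) (N.comp (ζ' x)) x := N.hasFDerivAt.comp x h2
    have h6 := (h1.add (h4.clm_apply h2)).sub
      ((((h1.sub_const t₀).mul (h5.clm_apply h2))).const_mul (K / 2))
    refine h6.congr_fderiv ?_
    ext y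
    simp [hS']
    rw [hNs (ζ' x y) (ζ x)]
    ring
  have hτ'c : ContinuousAt τ' (c t₀) := by
    refine ContinuousAt.smul (ContinuousAt.inv₀ (l.continuous.continuousAt.comp hvτ) ?_)
      continuousAt_const
    simp [hτ₀, hlv]
  have hζ'c : ContinuousAt ζ' (c t₀) := by
    refine continuousAt_const.sub ?_
    have : ContinuousAt (fun x => ContinuousLinearMap.smulRightL ℝ E E (τ' x) (v (τ x))) (c t₀) :=
      ((ContinuousLinearMap.continuous _).continuousAt.comp hτ'c).clm_apply hvτ
    exact this
  have hPτ : ContinuousAt (fun x => P (τ x)) (c t₀) :=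
    ContinuousAt.comp (f := τ) (g := P) (by rwa [hτ₀]) hτc
  have hPτ' : ContinuousAt (fun x => P' (τ x)) (c t₀) :=
    ContinuousAt.comp (f := τ) (g := P') (by rwa [hτ₀]) hτc
  have hNc : ContinuousAt (fun x => N (ζ x)) (c t₀) := N.continuous.continuousAt.comp hζc
  have hS'c : ContinuousAt S' (c t₀) := by
    have h1 : ContinuousAt (fun x => 2 * (τ x - t₀)) (c t₀) :=
      continuousAt_const.mul (hτc.sub continuousAt_const)
    have h2 : ContinuousAt (fun x => N (ζ x) (ζ x) • τ' x + (2 * (τ x - t₀)) • (N (ζ x)).comp (ζ' x))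
        (c t₀) := ((hNc.clm_apply hζc).smul hτ'c).add (h1.smul (hNc.clm_comp hζ'c))
    exact (hτ'c.add ((hPτ.clm_comp hζ'c).add ((hPτ'.clm_apply hζc).smul hτ'c))).sub
      (h2.const_smul (K / 2))
  have hS'₀ : S' (c t₀) = l := by
    ext y
    simp [hS', hζ₀, hζ', hτ', hτ₀, hP, hlw, hΦ.euler hx₀ hv₀, h1₀]
  refine ⟨S, ?_, ?_⟩
  · -- directions near the velocity
    obtain ⟨ρ, hρ, hball⟩ : ∃ ρ > 0, ∀ p ∈ Metric.ball (c t₀, v t₀) ρ, p ∈ U ×ˢ ({0}ᶜ : Set E) ∧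
        ‖fderiv ℝ (fderiv ℝ Φ) p - fderiv ℝ (fderiv ℝ Φ) (c t₀, v t₀)‖ < η := by
      have h1 := (hΦ.contDiffAt_fderiv_fderiv hx₀ hv₀).continuousAt.eventually
        (Metric.ball_mem_nhds _ hη)
      obtain ⟨ρ, hρ, h⟩ := Metric.eventually_nhds_iff_ball.1
        ((Filter.eventually_of_mem (hΦ.mem_nhds hx₀ hv₀) fun _ h => h).and h1)
      exact ⟨ρ, hρ, fun p hp => ⟨(h p hp).1, by simpa [dist_eq_norm] using (h p hp).2⟩⟩
    set u₀ : E := ‖v t₀‖⁻¹ • v t₀ with hu₀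
    have hnv : 0 < ‖v t₀‖ := norm_pos_iff.2 hv₀
    have hcc' : ContinuousAt (fun q : E × E => τ q.1) (c t₀, u₀) :=
      continuousAt_comp_fst hτc
    have hvv' : ContinuousAt (fun q : E × E => v (τ q.1)) (c t₀, u₀) :=
      continuousAt_comp_fst hvτ
    have hxx' : ContinuousAt (fun q : E × E => c (τ q.1)) (c t₀, u₀) :=
      continuousAt_comp_fst hcτ
    have hlamc : ContinuousAt (fun q : E × E => τ' q.1 q.2) (c t₀, u₀) :=
      continuousAt_clm_apply_fst_snd hτ'c
    have hlam₀ : τ' (c t₀) u₀ = ‖v t₀‖⁻¹ := by simp [hτ', hτ₀, hlv, hu₀]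
    have hnear : ∀ᶠ q in 𝓝 (c t₀, u₀), S' q.1 q.2 ≤ Φ q := by
      have e1 : ∀ᶠ q : E × E in 𝓝 (c t₀, u₀), 0 < τ' q.1 q.2 :=
        hlamc.eventually (lt_mem_nhds (by dsimp only; rw [hlam₀]; positivity))
      have e2 : ∀ᶠ q : E × E in 𝓝 (c t₀, u₀), |τ q.1 - t₀| < η := by
        have := hcc'.eventually (Metric.ball_mem_nhds _ hη)
        simpa [hτ₀, Real.dist_eq] using this
      have e3 : ∀ᶠ q : E × E in 𝓝 (c t₀, u₀), (c (τ q.1), v (τ q.1)) ∈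
          Metric.ball (c t₀, v t₀) ρ := by
        refine (hxx'.prodMk hvv').eventually (Metric.isOpen_ball.mem_nhds ?_)
        simp [hτ₀, hρ]
      have e4 : ∀ᶠ q : E × E in 𝓝 (c t₀, u₀), (q.1, (τ' q.1 q.2)⁻¹ • q.2) ∈
          Metric.ball (c t₀, v t₀) ρ := by
        refine (continuousAt_fst.prodMk ((hlamc.inv₀ ?_).smul continuousAt_snd)).eventually
          (Metric.isOpen_ball.mem_nhds ?_)
        · rw [hlam₀]; positivity
        · change (c t₀, (τ' (c t₀) u₀)⁻¹ • u₀) ∈ _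
          rw [hlam₀, inv_inv, hu₀, smul_smul, mul_inv_cancel₀ hnv.ne', one_smul]
          exact Metric.mem_ball_self hρ
      have e5 : ∀ᶠ q : E × E in 𝓝 (c t₀, u₀), c (τ q.1) ∈ U ∧ v (τ q.1) ≠ 0 ∧
          Φ (c (τ q.1), v (τ q.1)) = 1 ∧ l (v (τ q.1)) ≠ 0 := by
        have h5 : Tendsto (fun q : E × E => τ q.1) (𝓝 (c t₀, u₀)) (𝓝 t₀) := by
          have := hcc'.tendsto
          rwa [hτ₀] at this
        exact (h5.eventually (hgeo.and hlv_pos)).mono fun q hq =>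
          ⟨hq.1.1, hq.1.2.1, hq.1.2.2.2.2, hq.2.ne'⟩
      filter_upwards [e1, e2, e3, e4, e5] with q h1 h2 h3 h4 ⟨h5, h6, h7, h8⟩
      obtain ⟨x, y⟩ := q
      dsimp only at h1 h2 h3 h4 h5 h6 h7 h8 ⊢
      set lam := τ' x y with hlam
      -- Scaled to cross the slices at unit rate, y becomes v + w with w tangent to the slice. Then
      -- dS(y) is lam times the Taylor lower bound for Φ at (c, v) with increment (ζ, w), and
      -- homogeneity undoes the scaling.
      set w : E := lam⁻¹ • y - v (τ x) with hw
      have hlw0 : l w = 0 := by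
        have hly : lam * l (v (τ x)) = l y := by
          simp only [hlam, hτ', smul_apply, smul_eq_mul]
          field_simp
        rw [hw, map_sub, map_smul, ← hly, smul_eq_mul]
        field_simp
        ring
      have hxU : x ∈ U := (hball _ h4).1.1
      have hseg : ∀ s ∈ Icc (0 : ℝ) 1,
          (c (τ x), v (τ x)) + s • (ζ x, w) ∈ Metric.ball (c t₀, v t₀) ρ := by
        intro s hs
        have h9 := (convex_ball (c t₀, v t₀) ρ) h3 h4 (sub_nonneg.2 hs.2) hs.1 (by ring)
        convert! h9 using 1
        ext
        · simp only [hζ, Prod.fst_add, Prod.smul_fst]; module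
        · simp only [hw, Prod.snd_add, Prod.smul_snd]; module
      have hT := le_of_second_derivative_add_nonneg (f := Φ) (f' := fderiv ℝ Φ)
        (f'' := fderiv ℝ (fderiv ℝ Φ)) (p := (c (τ x), v (τ x))) (ζ := (ζ x, w))
        (m := K * N (ζ x) (ζ x) + 2 * K * (τ x - t₀) * N (ζ x) w)
        (fun s hs => hΦ.hasFDerivAt (hball _ (hseg s hs)).1.1 (hball _ (hseg s hs)).1.2)
        (fun s hs => hΦ.hasFDerivAt_fderiv (hball _ (hseg s hs)).1.1 (hball _ (hseg s hs)).1.2)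
        (fun s hs => hquad _ (hball _ (hseg s hs)).2 _ h2 _ _ hlw0)
      have e6 : (c (τ x), v (τ x)) + (ζ x, w) = (x, lam⁻¹ • y) := by
        ext
        · simp [hζ]
        · simp [hw]
      rw [e6, hΦ.homog x hxU y _ (inv_pos.2 h1), h7] at hT
      have e7 : y = lam • (v (τ x) + w) := by
        simp [hw, smul_smul, h1.ne']
      have e8 : ζ' x y = lam • w := by
        have : ζ' x y = y - lam • v (τ x) := by simp [hζ', hlam]
        rw [this]
        nth_rewrite 1 [e7]
        module
      have e9 : S' x y = lam * (1 + fderiv ℝ Φ (c (τ x), v (τ x)) (ζ x, w)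
          - (K * N (ζ x) (ζ x) + 2 * K * (τ x - t₀) * N (ζ x) w) / 2) := by
        have e10 : fderiv ℝ Φ (c (τ x), v (τ x)) (ζ x, w)
            = P' (τ x) (ζ x) + P (τ x) w := by
          simp only [hP, hP', ContinuousLinearMap.comp_apply, ContinuousLinearMap.inl_apply,
            ContinuousLinearMap.inr_apply]
          rw [← map_add]; simp
        rw [e10]
        simp only [hS', sub_apply, add_apply, smul_apply, ContinuousLinearMap.comp_apply, e8,
          map_smul, smul_eq_mul, ← hlam]
        ring
      rw [e9]
      calc _ ≤ lam * (lam⁻¹ * Φ (x, y)) := by gcongr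
        _ = Φ (x, y) := by field_simp
    -- the other directions
    have hfar : ∀ y ∈ Metric.sphere (0 : E) 1, ∀ᶠ q in 𝓝 (c t₀, y), S' q.1 q.2 ≤ Φ q := by
      intro y hy
      by_cases hyu : y = u₀
      · rw [hyu]; exact hnear
      have hy0 : y ≠ 0 := by rintro rfl; simp at hy
      have hpos := hΦ.pos _ hx₀ y hy0
      -- Here dS = l at the base point, so in directions other than that of the velocity the
      -- fundamental inequality is strict. It therefore persists nearby, and compactness of the
      -- sphere makes the neighbourhood uniform.
      have hlt : l y < Φ (c t₀, y) := by
        have h2 := hΦ.fderiv_lt_of_ne (y := (Φ (c t₀, y))⁻¹ • y) hx₀ h1₀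
          (by rw [hΦ.homog _ hx₀ _ _ (inv_pos.2 hpos)]; field_simp) (by
            intro h
            apply hyu
            have h3 : y = Φ (c t₀, y) • v t₀ := by rw [← h, smul_smul]; simp [hpos.ne']
            have h4 : ‖y‖ = 1 := by simpa using hy
            rw [h3, norm_smul, Real.norm_of_nonneg hpos.le] at h4
            exact h3.trans (by rw [eq_inv_of_mul_eq_one_left h4]))
        rw [← hlw, map_smul, smul_eq_mul] at h2
        rw [inv_mul_lt_iff₀ hpos] at h2
        linarith
      have c1 : ContinuousAt (fun q : E × E => S' q.1 q.2) (c t₀, y) :=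
        continuousAt_clm_apply_fst_snd hS'c
      have c2 : ContinuousAt Φ (c t₀, y) := (hΦ.contDiffAt hx₀ hy0).continuousAt
      have : S' (c t₀) y < Φ (c t₀, y) := by rwa [hS'₀]
      exact (c1.eventually_lt c2 this).mono fun q hq => hq.le
    have hall := (isCompact_sphere (0 : E) 1).eventually_forall_of_forall_eventually
      (P := fun x y => S' x y ≤ Φ (x, y)) hfar
    filter_upwards [hSd, hall, hΦ.isOpen.mem_nhds hx₀] with x h1 h2 hxU
    refine ⟨S' x, h1, fun y => ?_⟩
    rcases eq_or_ne y 0 with rfl | hy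
    · simp [hΦ.map_zero hxU]
    · have hny : 0 < ‖y‖ := norm_pos_iff.2 hy
      have h3 := h2 (‖y‖⁻¹ • y) (by simp [norm_smul, hny.ne'])
      rw [hΦ.homog x hxU y _ (inv_pos.2 hny), map_smul, smul_eq_mul] at h3
      exact le_of_mul_le_mul_left h3 (inv_pos.2 hny)
  · filter_upwards [e.open_source.mem_nhds hes] with t ht
    have : τ (c t) = t := e.left_inv ht
    simp [hS, hζ, this]

end IsLocalFinsler

open Filter Topology intervalIntegral

/-! ### Calculus on closed intervals -/

/-- Extension by the end values. Since every value of the extension is already a value of f on the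
interval, pointwise properties such as positivity survive. -/
theorem exists_continuous_eqOn_Icc {X : Type*} [TopologicalSpace X] {f : ℝ → X} {α β : ℝ}
    (hαβ : α ≤ β) (hf : ContinuousOn f (Icc α β)) :
    ∃ F : ℝ → X, Continuous F ∧ EqOn F f (Icc α β) ∧ ∀ t, ∃ s ∈ Icc α β, F t = f s := by
  refine ⟨IccExtend hαβ ((Icc α β).domRestrict f), hf.domRestrict.Icc_extend', fun t ht => ?_,
    fun t => ⟨projIcc α β hαβ t, (projIcc α β hαβ t).2, rfl⟩⟩
  rw [IccExtend_of_mem _ _ ht]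
  rfl

theorem contDiffOn_of_hasDerivWithinAt {X : Type*} [NormedAddCommGroup X] [NormedSpace ℝ X]
    {f f' : ℝ → X} {α β : ℝ} (hαβ : α < β) (hf' : ContDiffOn ℝ ∞ f' (Icc α β))
    (hf : ∀ t ∈ Icc α β, HasDerivWithinAt f (f' t) (Icc α β) t) : ContDiffOn ℝ ∞ f (Icc α β) := by
  rw [contDiffOn_infty_iff_derivWithin (uniqueDiffOn_Icc hαβ)]
  refine ⟨fun t ht => (hf t ht).differentiableWithinAt, hf'.congr fun t ht => ?_⟩
  exact (hf t ht).derivWithin (uniqueDiffOn_Icc hαβ t ht)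

theorem hasDerivAt_derivWithin_Icc {X : Type*} [NormedAddCommGroup X] [NormedSpace ℝ X]
    {f : ℝ → X} {α β t : ℝ} (hf : ContDiffOn ℝ ∞ f (Icc α β)) (ht : t ∈ Ioo α β) :
    HasDerivAt f (derivWithin f (Icc α β) t) t := by
  have h := (hf.differentiableOn (by simp) t (Ioo_subset_Icc_self ht)).hasDerivWithinAt
  exact h.hasDerivAt (Icc_mem_nhds ht.1 ht.2)

theorem eventually_add_smul_mem {X : Type*} [NormedAddCommGroup X] [NormedSpace ℝ X]
    {O : Set X} (hO : IsOpen O) {p q : ℝ → X} {α β : ℝ} (hαβ : α ≤ β)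
    (hp : ContinuousOn p (Icc α β)) (hq : ContinuousOn q (Icc α β))
    (hpO : ∀ t ∈ Icc α β, p t ∈ O) : ∀ᶠ s in 𝓝 (0 : ℝ), ∀ t ∈ Icc α β, p t + s • q t ∈ O := by
  obtain ⟨P, hPc, hP, -⟩ := exists_continuous_eqOn_Icc hαβ hp
  obtain ⟨Q, hQc, hQ, -⟩ := exists_continuous_eqOn_Icc hαβ hq
  have h : ∀ᶠ s in 𝓝 (0 : ℝ), ∀ t ∈ Icc α β, P t + s • Q t ∈ O := by
    refine isCompact_Icc.eventually_forall_of_forall_eventually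
      (P := fun s t => P t + s • Q t ∈ O) fun t ht => ?_
    have hc : Continuous fun z : ℝ × ℝ => P z.2 + z.1 • Q z.2 := by fun_prop
    refine hc.continuousAt.eventually (hO.mem_nhds ?_)
    simpa [hP ht] using hpO t ht
  filter_upwards [h] with s hs t ht
  rw [← hP ht, ← hQ ht]
  exact hs t ht

/-- Differentiation under the integral sign. For small s the varied curve stays in O by compactness,
and on the resulting compact rectangle the integrand's derivative has a constant bound. -/
theorem hasDerivAt_integral_variation {X : Type*} [NormedAddCommGroup X] [NormedSpace ℝ X]
    {O : Set X} (hO : IsOpen O) {f : X → ℝ} (hf : ContDiffOn ℝ ∞ f O) {p q : ℝ → X} {α β : ℝ}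
    (hαβ : α ≤ β) (hp : ContinuousOn p (Icc α β)) (hq : ContinuousOn q (Icc α β))
    (hpO : ∀ t ∈ Icc α β, p t ∈ O) :
    HasDerivAt (fun s : ℝ => ∫ t in α..β, f (p t + s • q t)) (∫ t in α..β, fderiv ℝ f (p t) (q t))
      0 := by
  have hev := eventually_add_smul_mem hO hαβ hp hq hpO
  obtain ⟨δ, hδ, hball⟩ := Metric.eventually_nhds_iff_ball.1 hev
  have hd : ∀ x ∈ O, HasFDerivAt f (fderiv ℝ f x) x := fun x hx =>
    ((hf.contDiffAt (hO.mem_nhds hx)).differentiableAt (by simp)).hasFDerivAt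
  have hd' : ContinuousOn (fderiv ℝ f) O :=
    hf.continuousOn_fderiv_of_isOpen hO (by simp)
  have hsub : Icc (-(δ / 2)) (δ / 2) ⊆ Metric.ball (0 : ℝ) δ := by
    intro s hs
    rw [Metric.mem_ball, Real.dist_eq, sub_zero, abs_lt]
    constructor <;> linarith [hs.1, hs.2]
  have hpq : ContinuousOn (fun z : ℝ × ℝ => p z.2 + z.1 • q z.2)
      (Icc (-(δ / 2)) (δ / 2) ×ˢ Icc α β) :=
    (hp.comp continuousOn_snd fun z hz => hz.2).add
      (continuousOn_fst.smul (hq.comp continuousOn_snd fun z hz => hz.2))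
  have hmaps : MapsTo (fun z : ℝ × ℝ => p z.2 + z.1 • q z.2)
      (Icc (-(δ / 2)) (δ / 2) ×ˢ Icc α β) O := fun z hz => hball _ (hsub hz.1) _ hz.2
  have hF' : ContinuousOn (fun z : ℝ × ℝ => fderiv ℝ f (p z.2 + z.1 • q z.2) (q z.2))
      (Icc (-(δ / 2)) (δ / 2) ×ˢ Icc α β) :=
    (hd'.comp hpq hmaps).clm_apply (hq.comp continuousOn_snd fun z hz => hz.2)
  obtain ⟨C, hC⟩ := (isCompact_Icc.prod isCompact_Icc).exists_bound_of_continuousOn hF'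
  have hsl : ∀ s ∈ Icc (-(δ / 2)) (δ / 2), ContinuousOn (fun t => f (p t + s • q t)) (Icc α β) :=
    fun s hs => hf.continuousOn.comp (hp.add (hq.const_smul s)) fun t ht => hball _ (hsub hs) _ ht
  have h0 : (0 : ℝ) ∈ Icc (-(δ / 2)) (δ / 2) := ⟨by linarith, by linarith⟩
  have hnb : Icc (-(δ / 2)) (δ / 2) ∈ 𝓝 (0 : ℝ) := Icc_mem_nhds (by linarith) (by linarith)
  have huI : uIoc α β ⊆ Icc α β := by rw [uIoc_of_le hαβ]; exact Ioc_subset_Icc_self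
  have hmeas : ∀ s ∈ Icc (-(δ / 2)) (δ / 2), MeasureTheory.AEStronglyMeasurable
      (fun t => f (p t + s • q t)) (MeasureTheory.volume.restrict (uIoc α β)) := fun s hs =>
    ((hsl s hs).mono huI).aestronglyMeasurable measurableSet_uIoc
  have hF'0 : ContinuousOn (fun t => fderiv ℝ f (p t + (0 : ℝ) • q t) (q t)) (Icc α β) :=
    hF'.comp (f := fun t => ((0 : ℝ), t)) (by fun_prop) fun t ht => ⟨h0, ht⟩
  have := (intervalIntegral.hasDerivAt_integral_of_dominated_loc_of_deriv_le
    (μ := MeasureTheory.volume) (a := α) (b := β)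
    (F := fun s t => f (p t + s • q t)) (F' := fun s t => fderiv ℝ f (p t + s • q t) (q t))
    (x₀ := 0) (bound := fun _ => C) hnb (Filter.mem_of_superset hnb hmeas)
    ((hsl 0 h0).intervalIntegrable_of_Icc hαβ)
    ((hF'0.mono huI).aestronglyMeasurable measurableSet_uIoc)
    (Filter.Eventually.of_forall fun t ht s hs => hC (s, t) ⟨hs, huI ht⟩)
    (by simp)
    (Filter.Eventually.of_forall fun t ht s hs =>
      hasDerivAt_comp_line (hd _ (hball _ (hsub hs) _ (huI ht))))).2
  simpa using this

theorem eq_zero_of_integral_sq_eq_zero {f : ℝ → ℝ} {α β : ℝ} (hαβ : α < β)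
    (hf : ContinuousOn f (Icc α β)) (h : ∫ t in α..β, f t ^ 2 ≤ 0) {t : ℝ} (ht : t ∈ Icc α β) :
    f t = 0 := by
  by_contra hne
  have := intervalIntegral.integral_pos hαβ (hf.pow 2) (fun x _ => sq_nonneg (f x))
    ⟨t, ht, sq_pos_of_ne_zero hne⟩
  simp only [Pi.pow_apply] at this
  linarith

/-- The lemma of du Bois-Reymond for a function with one break. -/
theorem duBoisReymond {α t₀ β : ℝ} (hα : α < t₀) (hβ : t₀ < β) {A B C D : ℝ → ℝ}
    (hA : ContDiffOn ℝ ∞ A (Icc α t₀)) (hB : ContDiffOn ℝ ∞ B (Icc α t₀))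
    (hC : ContDiffOn ℝ ∞ C (Icc t₀ β)) (hD : ContDiffOn ℝ ∞ D (Icc t₀ β))
    (H : ∀ φ φ' ψ ψ' : ℝ → ℝ, ContDiffOn ℝ ∞ φ (Icc α t₀) → ContDiffOn ℝ ∞ ψ (Icc t₀ β) →
      (∀ t ∈ Icc α t₀, HasDerivWithinAt φ (φ' t) (Icc α t₀) t) →
      (∀ t ∈ Icc t₀ β, HasDerivWithinAt ψ (ψ' t) (Icc t₀ β) t) →
      φ α = 0 → φ t₀ = ψ t₀ → ψ β = 0 →
      (∫ t in α..t₀, (B t * φ t + A t * φ' t)) + ∫ t in t₀..β, (D t * ψ t + C t * ψ' t) = 0) :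
    A t₀ = C t₀ ∧ (∀ t ∈ Ioo α t₀, HasDerivAt A (B t) t) ∧
      ∀ t ∈ Ioo t₀ β, HasDerivAt C (D t) t := by
  obtain ⟨A', cA, eA, -⟩ := exists_continuous_eqOn_Icc hα.le hA.continuousOn
  obtain ⟨B', cB, eB, -⟩ := exists_continuous_eqOn_Icc hα.le hB.continuousOn
  obtain ⟨C', cC, eC, -⟩ := exists_continuous_eqOn_Icc hβ.le hC.continuousOn
  obtain ⟨D', cD, eD, -⟩ := exists_continuous_eqOn_Icc hβ.le hD.continuousOn
  have prim : ∀ {f : ℝ → ℝ}, Continuous f → ∀ a t, HasDerivAt (fun t => ∫ s in a..t, f s) (f t) t :=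
    fun hf a t => (hf.integral_hasStrictDerivAt a t).hasDerivAt
  set b : ℝ → ℝ := fun t => ∫ s in α..t, B' s with hb
  -- The primitive b of B is continued through the break, so the claim becomes: A and C are this
  -- common primitive plus one constant m.
  set d : ℝ → ℝ := fun t => b t₀ + ∫ s in t₀..t, D' s with hd
  have hb' : ∀ t, HasDerivAt b (B' t) t := prim cB α
  have hd' : ∀ t, HasDerivAt d (D' t) t := fun t => (prim cD t₀ t).const_add _
  have cb : Continuous b := continuous_iff_continuousAt.2 fun t => (hb' t).continuousAt
  have cd : Continuous d := continuous_iff_continuousAt.2 fun t => (hd' t).continuousAt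
  have sb : ContDiffOn ℝ ∞ b (Icc α t₀) := contDiffOn_of_hasDerivWithinAt hα (hB.congr eB)
    fun t _ => (hb' t).hasDerivWithinAt
  have sd : ContDiffOn ℝ ∞ d (Icc t₀ β) := contDiffOn_of_hasDerivWithinAt hβ (hD.congr eD)
    fun t _ => (hd' t).hasDerivWithinAt
  -- The mean of A - b and C - d over the whole interval. With this constant the primitive of the
  -- deviations vanishes at β and is an admissible test function.
  set m : ℝ := ((∫ t in α..t₀, (A' t - b t)) + ∫ t in t₀..β, (C' t - d t)) / (β - α) with hm
  set q : ℝ → ℝ := fun t => A' t - b t - m with hq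
  set r : ℝ → ℝ := fun t => C' t - d t - m with hr
  have cq : Continuous q := (cA.sub cb).sub continuous_const
  have cr : Continuous r := (cC.sub cd).sub continuous_const
  set φ : ℝ → ℝ := fun t => ∫ s in α..t, q s with hφ
  set ψ : ℝ → ℝ := fun t => φ t₀ + ∫ s in t₀..t, r s with hψ
  have hφ' : ∀ t, HasDerivAt φ (q t) t := prim cq α
  have hψ' : ∀ t, HasDerivAt ψ (r t) t := fun t => (prim cr t₀ t).const_add _
  have cφ : Continuous φ := continuous_iff_continuousAt.2 fun t => (hφ' t).continuousAt
  have cψ : Continuous ψ := continuous_iff_continuousAt.2 fun t => (hψ' t).continuousAt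
  have sφ : ContDiffOn ℝ ∞ φ (Icc α t₀) := contDiffOn_of_hasDerivWithinAt hα
    (((hA.congr eA).sub sb).sub contDiffOn_const) fun t _ => (hφ' t).hasDerivWithinAt
  have sψ : ContDiffOn ℝ ∞ ψ (Icc t₀ β) := contDiffOn_of_hasDerivWithinAt hβ
    (((hC.congr eC).sub sd).sub contDiffOn_const) fun t _ => (hψ' t).hasDerivWithinAt
  have φα : φ α = 0 := by simp [hφ]
  have φt : φ t₀ = ψ t₀ := by simp [hψ]
  have ψβ : ψ β = 0 := by
    have h1 : φ t₀ = (∫ t in α..t₀, (A' t - b t)) - (t₀ - α) * m := by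
      simp only [hφ, hq]
      rw [intervalIntegral.integral_sub (f := fun t => A' t - b t) (g := fun _ => m)
        ((cA.sub cb).intervalIntegrable _ _) (by simp)]
      simp
    have h2 : ∫ s in t₀..β, r s = (∫ t in t₀..β, (C' t - d t)) - (β - t₀) * m := by
      simp only [hr]
      rw [intervalIntegral.integral_sub (f := fun t => C' t - d t) (g := fun _ => m)
        ((cC.sub cd).intervalIntegrable _ _) (by simp)]
      simp
    have h3 : (β - α) * m = (∫ t in α..t₀, (A' t - b t)) + ∫ t in t₀..β, (C' t - d t) := by
      rw [hm]; field_simp [show β - α ≠ 0 by linarith]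
    simp only [hψ]
    rw [h1, h2]
    linarith
  have key := H φ q ψ r sφ sψ (fun t _ => (hφ' t).hasDerivWithinAt)
    (fun t _ => (hψ' t).hasDerivWithinAt) φα φt ψβ
  -- Integration by parts against b + m leaves the integral of q² and a boundary term at the break.
  -- The same computation on the right gives the opposite boundary term, so the hypothesis says that
  -- the two integrals of squares add up to 0.
  have e1 : ∫ t in α..t₀, (B t * φ t + A t * q t)
      = (∫ t in α..t₀, q t ^ 2) + ((b t₀ + m) * φ t₀) := by
    have h1 : ∫ t in α..t₀, (B' t * φ t + (b t + m) * q t) = (b t₀ + m) * φ t₀ - (b α + m) * φ α :=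
      intervalIntegral.integral_eq_sub_of_hasDerivAt
        (fun t _ => ((hb' t).add_const m).mul (hφ' t))
        (Continuous.intervalIntegrable (by fun_prop) _ _)
    rw [φα, mul_zero, sub_zero] at h1
    rw [← h1, ← intervalIntegral.integral_add (f := fun t => q t ^ 2)
      (g := fun t => B' t * φ t + (b t + m) * q t) ((cq.pow 2).intervalIntegrable _ _)
      (Continuous.intervalIntegrable (by fun_prop) _ _)]
    refine intervalIntegral.integral_congr fun t ht => ?_
    rw [uIcc_of_le hα.le] at ht
    simp only [← eA ht, ← eB ht, hq]
    ring
  have e2 : ∫ t in t₀..β, (D t * ψ t + C t * r t)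
      = (∫ t in t₀..β, r t ^ 2) - ((b t₀ + m) * φ t₀) := by
    have h1 : ∫ t in t₀..β, (D' t * ψ t + (d t + m) * r t)
        = (d β + m) * ψ β - (d t₀ + m) * ψ t₀ :=
      intervalIntegral.integral_eq_sub_of_hasDerivAt
        (fun t _ => ((hd' t).add_const m).mul (hψ' t))
        (Continuous.intervalIntegrable (by fun_prop) _ _)
    have h2 : d t₀ = b t₀ := by simp [hd]
    rw [ψβ, mul_zero, zero_sub, h2, ← φt] at h1
    rw [sub_eq_add_neg, ← h1, ← intervalIntegral.integral_add (f := fun t => r t ^ 2)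
      (g := fun t => D' t * ψ t + (d t + m) * r t) ((cr.pow 2).intervalIntegrable _ _)
      (Continuous.intervalIntegrable (by fun_prop) _ _)]
    refine intervalIntegral.integral_congr fun t ht => ?_
    rw [uIcc_of_le hβ.le] at ht
    simp only [← eC ht, ← eD ht, hr]
    ring
  rw [e1, e2] at key
  have n1 : 0 ≤ ∫ t in α..t₀, q t ^ 2 :=
    intervalIntegral.integral_nonneg hα.le fun t _ => sq_nonneg _
  have n2 : 0 ≤ ∫ t in t₀..β, r t ^ 2 :=
    intervalIntegral.integral_nonneg hβ.le fun t _ => sq_nonneg _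
  have hq0 : ∀ t ∈ Icc α t₀, q t = 0 := fun t ht =>
    eq_zero_of_integral_sq_eq_zero hα cq.continuousOn (by linarith) ht
  have hr0 : ∀ t ∈ Icc t₀ β, r t = 0 := fun t ht =>
    eq_zero_of_integral_sq_eq_zero hβ cr.continuousOn (by linarith) ht
  have hAe : ∀ t ∈ Icc α t₀, A t = b t + m := fun t ht => by
    have := hq0 t ht; simp only [hq, eA ht] at this; linarith
  have hCe : ∀ t ∈ Icc t₀ β, C t = d t + m := fun t ht => by
    have := hr0 t ht; simp only [hr, eC ht] at this; linarith
  refine ⟨?_, fun t ht => ?_, fun t ht => ?_⟩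
  · rw [hAe t₀ (right_mem_Icc.2 hα.le), hCe t₀ (left_mem_Icc.2 hβ.le)]
    simp [hd]
  · rw [← eB (Ioo_subset_Icc_self ht)]
    refine ((hb' t).add_const m).congr_of_eventuallyEq ?_
    filter_upwards [Icc_mem_nhds ht.1 ht.2] with s hs using hAe s hs
  · rw [← eD (Ioo_subset_Icc_self ht)]
    refine ((hd' t).add_const m).congr_of_eventuallyEq ?_
    filter_upwards [Icc_mem_nhds ht.1 ht.2] with s hs using hCe s hs

theorem hasDerivAt_clm_apply_const {X G : Type*} [NormedAddCommGroup X] [NormedSpace ℝ X]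
    [NormedAddCommGroup G] [NormedSpace ℝ G] {A : ℝ → X →L[ℝ] G} {A' : X →L[ℝ] G} {t : ℝ}
    (h : HasDerivAt A A' t) (w : X) : HasDerivAt (fun t => A t w) (A' w) t := by
  simpa using h.clm_apply (hasDerivAt_const t w)

/-! ### First variation of length, absence of corners, arc length. -/

section LocalFinsler

variable {E : Type*} [NormedAddCommGroup E] [NormedSpace ℝ E]

/-- A smooth regular path in `U`, parametrized by the closed interval `[α, β]`. -/
structure IsRegularPath (U : Set E) (c : ℝ → E) (α β : ℝ) : Prop where
  contDiffOn : ContDiffOn ℝ ∞ c (Icc α β)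
  mem : ∀ t ∈ Icc α β, c t ∈ U
  ne_zero : ∀ t ∈ Icc α β, derivWithin c (Icc α β) t ≠ 0

/-- The `Φ`-length of a path. -/
def pathLen (Φ : E × E → ℝ) (c : ℝ → E) (α β : ℝ) : ℝ :=
  ∫ t in α..β, Φ (c t, derivWithin c (Icc α β) t)

theorem contDiffOn_derivWithin_Icc {c : ℝ → E} {α β : ℝ} (hαβ : α < β)
    (hc : ContDiffOn ℝ ∞ c (Icc α β)) : ContDiffOn ℝ ∞ (derivWithin c (Icc α β)) (Icc α β) :=
  ((contDiffOn_infty_iff_derivWithin (uniqueDiffOn_Icc hαβ)).1 hc).2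

theorem hasDerivWithinAt_Icc {c : ℝ → E} {α β t : ℝ} (hc : ContDiffOn ℝ ∞ c (Icc α β))
    (ht : t ∈ Icc α β) : HasDerivWithinAt c (derivWithin c (Icc α β) t) (Icc α β) t :=
  (hc.differentiableOn (by simp) t ht).hasDerivWithinAt

theorem IsRegularPath.contDiffOn_lift {U : Set E} {c : ℝ → E} {α β : ℝ} (hαβ : α < β)
    (hc : IsRegularPath U c α β) :
    ContDiffOn ℝ ∞ (fun t => (c t, derivWithin c (Icc α β) t)) (Icc α β) :=
  hc.contDiffOn.prodMk (contDiffOn_derivWithin_Icc hαβ hc.contDiffOn)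

namespace IsLocalFinsler

variable {U : Set E} {Φ : E × E → ℝ} (hΦ : IsLocalFinsler U Φ)
include hΦ

/-- First variation of length. Staying in U with nonzero velocity is an open condition on a compact
interval, so small variations are again admissible competitors. -/
theorem hasDerivAt_pathLen {c ψ ψ' : ℝ → E} {α β : ℝ} (hαβ : α < β) (hc : IsRegularPath U c α β)
    (hψ : ContDiffOn ℝ ∞ ψ (Icc α β))
    (hψ' : ∀ t ∈ Icc α β, HasDerivWithinAt ψ (ψ' t) (Icc α β) t) :
    (∀ᶠ s in 𝓝 (0 : ℝ), IsRegularPath U (fun t => c t + s • ψ t) α β) ∧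
    HasDerivAt (fun s : ℝ => pathLen Φ (fun t => c t + s • ψ t) α β)
      (∫ t in α..β, fderiv ℝ Φ (c t, derivWithin c (Icc α β) t) (ψ t, ψ' t)) 0 := by
  have hψe : EqOn ψ' (derivWithin ψ (Icc α β)) (Icc α β) := fun t ht =>
    ((hψ' t ht).derivWithin (uniqueDiffOn_Icc hαβ t ht)).symm
  have hdw : ∀ s : ℝ, ∀ t ∈ Icc α β, derivWithin (fun t => c t + s • ψ t) (Icc α β) t
      = derivWithin c (Icc α β) t + s • ψ' t := fun s t ht =>
    ((hasDerivWithinAt_Icc hc.contDiffOn ht).add ((hψ' t ht).const_smul s)).derivWithin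
      (uniqueDiffOn_Icc hαβ t ht)
  have hp := (hc.contDiffOn_lift hαβ).continuousOn
  have hq : ContinuousOn (fun t => (ψ t, ψ' t)) (Icc α β) :=
    hψ.continuousOn.prodMk
      ((contDiffOn_derivWithin_Icc hαβ hψ).continuousOn.congr hψe)
  have hO : ∀ t ∈ Icc α β, (c t, derivWithin c (Icc α β) t) ∈ U ×ˢ ({0}ᶜ : Set E) :=
    fun t ht => ⟨hc.mem t ht, hc.ne_zero t ht⟩
  constructor
  · filter_upwards [eventually_add_smul_mem hΦ.isOpen_domain hαβ.le hp hq hO] with s hs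
    refine ⟨hc.contDiffOn.add (contDiffOn_const.smul hψ), fun t ht => (hs t ht).1, fun t ht => ?_⟩
    rw [hdw s t ht]
    exact (hs t ht).2
  · have h := hasDerivAt_integral_variation hΦ.isOpen_domain hΦ.smooth hαβ.le hp hq hO
    refine h.congr_of_eventuallyEq (Filter.Eventually.of_forall fun s => ?_)
    refine intervalIntegral.integral_congr fun t ht => ?_
    rw [uIcc_of_le hαβ.le] at ht
    dsimp only
    rw [hdw s t ht]
    rfl

theorem contDiffOn_fderiv_apply {c : ℝ → E} {α β : ℝ} (hαβ : α < β) (hc : IsRegularPath U c α β)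
    (w : E × E) :
    ContDiffOn ℝ ∞ (fun t => fderiv ℝ Φ (c t, derivWithin c (Icc α β) t) w) (Icc α β) := by
  have h1 : ContDiffOn ℝ ∞ (fderiv ℝ Φ) (U ×ˢ ({0}ᶜ : Set E)) := fun p hp =>
    (hΦ.contDiffAt_fderiv hp.1 hp.2).contDiffWithinAt
  exact (h1.comp (hc.contDiffOn_lift hαβ)
    fun t ht => ⟨hc.mem t ht, hc.ne_zero t ht⟩).clm_apply contDiffOn_const

set_option maxHeartbeats 400000 in
set_option synthInstance.maxHeartbeats 200000 in
/-- A shortest path of unit speed with a possible break at `t₀` has no corner and satisfies the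
geodesic equation. -/
theorem geodesic_of_minimal [FiniteDimensional ℝ E] {α t₀ β : ℝ} (hα : α < t₀) (hβ : t₀ < β)
    {c : ℝ → E} (hL : IsRegularPath U c α t₀) (hR : IsRegularPath U c t₀ β)
    (h1L : ∀ t ∈ Icc α t₀, Φ (c t, derivWithin c (Icc α t₀) t) = 1)
    (h1R : ∀ t ∈ Icc t₀ β, Φ (c t, derivWithin c (Icc t₀ β) t) = 1)
    (hmin : ∀ dL dR : ℝ → E, IsRegularPath U dL α t₀ → IsRegularPath U dR t₀ β → dL α = c α →
      dL t₀ = dR t₀ → dR β = c β → β - α ≤ pathLen Φ dL α t₀ + pathLen Φ dR t₀ β) :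
    derivWithin c (Icc α t₀) t₀ = derivWithin c (Icc t₀ β) t₀ ∧
    (∀ t ∈ Ioo α t₀, HasDerivAt (derivWithin c (Icc α t₀))
      (accel Φ (c t, derivWithin c (Icc α t₀) t)) t) ∧
    ∀ t ∈ Ioo t₀ β, HasDerivAt (derivWithin c (Icc t₀ β))
      (accel Φ (c t, derivWithin c (Icc t₀ β) t)) t := by
  have hlenL : pathLen Φ c α t₀ = t₀ - α := by
    have : pathLen Φ c α t₀ = ∫ t in α..t₀, (1 : ℝ) :=
      intervalIntegral.integral_congr fun t ht => by
        rw [uIcc_of_le hα.le] at ht; exact h1L t ht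
    simpa using this
  have hlenR : pathLen Φ c t₀ β = β - t₀ := by
    have : pathLen Φ c t₀ β = ∫ t in t₀..β, (1 : ℝ) :=
      intervalIntegral.integral_congr fun t ht => by
        rw [uIcc_of_le hβ.le] at ht; exact h1R t ht
    simpa using this
  -- Variations along one fixed vector ξ reduce the vector equation to the scalar lemma. Its three
  -- conclusions are the corner condition and the Euler–Lagrange equation on each side, tested
  -- against ξ.
  have key : ∀ ξ : E, fderiv ℝ Φ (c t₀, derivWithin c (Icc α t₀) t₀) (0, ξ)
        = fderiv ℝ Φ (c t₀, derivWithin c (Icc t₀ β) t₀) (0, ξ) ∧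
      (∀ t ∈ Ioo α t₀, HasDerivAt (fun t => fderiv ℝ Φ (c t, derivWithin c (Icc α t₀) t) (0, ξ))
        (fderiv ℝ Φ (c t, derivWithin c (Icc α t₀) t) (ξ, 0)) t) ∧
      ∀ t ∈ Ioo t₀ β, HasDerivAt (fun t => fderiv ℝ Φ (c t, derivWithin c (Icc t₀ β) t) (0, ξ))
        (fderiv ℝ Φ (c t, derivWithin c (Icc t₀ β) t) (ξ, 0)) t := by
    intro ξ
    refine duBoisReymond hα hβ (hΦ.contDiffOn_fderiv_apply hα hL _)
      (hΦ.contDiffOn_fderiv_apply hα hL _) (hΦ.contDiffOn_fderiv_apply hβ hR _)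
      (hΦ.contDiffOn_fderiv_apply hβ hR _) ?_
    intro φ φ' ψ ψ' sφ sψ dφ dψ φα φt ψβ
    obtain ⟨evL, dL⟩ := hΦ.hasDerivAt_pathLen hα hL (ψ := fun t => φ t • ξ)
      (sφ.smul contDiffOn_const) (ψ' := fun t => φ' t • ξ) fun t ht => (dφ t ht).smul_const ξ
    obtain ⟨evR, dR⟩ := hΦ.hasDerivAt_pathLen hβ hR (ψ := fun t => ψ t • ξ)
      (sψ.smul contDiffOn_const) (ψ' := fun t => ψ' t • ξ) fun t ht => (dψ t ht).smul_const ξ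
    have hmin' : IsLocalMin (fun s : ℝ => pathLen Φ (fun t => c t + s • φ t • ξ) α t₀
        + pathLen Φ (fun t => c t + s • ψ t • ξ) t₀ β) 0 := by
      filter_upwards [evL, evR] with s hsL hsR
      simp only [zero_smul, add_zero]
      have h0 := hmin _ _ hsL hsR (by simp [φα]) (by simp [φt]) (by simp [ψβ])
      have h1 : pathLen Φ (fun t => c t) α t₀ = t₀ - α := hlenL
      have h2 : pathLen Φ (fun t => c t) t₀ β = β - t₀ := hlenR
      rw [h1, h2]
      linarith
    have h0 := hmin'.hasDerivAt_eq_zero (dL.add dR)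
    rw [← h0]
    congr 1
    · refine intervalIntegral.integral_congr fun t _ => ?_
      rw [show ((φ t • ξ, φ' t • ξ) : E × E) = φ t • (ξ, 0) + φ' t • (0, ξ) by simp, map_add,
        map_smul, map_smul, smul_eq_mul, smul_eq_mul]
      ring
    · refine intervalIntegral.integral_congr fun t _ => ?_
      rw [show ((ψ t • ξ, ψ' t • ξ) : E × E) = ψ t • (ξ, 0) + ψ' t • (0, ξ) by simp, map_add,
        map_smul, map_smul, smul_eq_mul, smul_eq_mul]
      ring
  have hgeo : ∀ {a b : ℝ}, a < b → IsRegularPath U c a b →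
      (∀ t ∈ Icc a b, Φ (c t, derivWithin c (Icc a b) t) = 1) →
      (∀ ξ : E, ∀ t ∈ Ioo a b, HasDerivAt
        (fun t => fderiv ℝ Φ (c t, derivWithin c (Icc a b) t) (0, ξ))
        (fderiv ℝ Φ (c t, derivWithin c (Icc a b) t) (ξ, 0)) t) →
      ∀ t ∈ Ioo a b, HasDerivAt (derivWithin c (Icc a b))
        (accel Φ (c t, derivWithin c (Icc a b) t)) t := by
    intro a b hab hc h1 hk t ht
    have ht' := Ioo_subset_Icc_self ht
    have hU := hc.mem t ht'
    have hv := hc.ne_zero t ht'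
    have hdc := hasDerivAt_derivWithin_Icc hc.contDiffOn ht
    have hdv := hasDerivAt_derivWithin_Icc (contDiffOn_derivWithin_Icc hab hc.contDiffOn) ht
    rw [← (hΦ.eulerLagrange_iff hU hv _).1 _]
    · exact hdv
    rw [hΦ.eulerLagrange_iff_of_eq_one hU hv (h1 t ht')]
    constructor
    · have h2 := (hΦ.hasFDerivAt hU hv).comp_hasDerivAt t (hdc.prodMk hdv)
      have h3 : HasDerivAt (Φ ∘ fun t => (c t, derivWithin c (Icc a b) t)) 0 t := by
        refine (hasDerivAt_const t (1 : ℝ)).congr_of_eventuallyEq ?_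
        filter_upwards [Icc_mem_nhds ht.1 ht.2] with s hs using h1 s hs
      exact h2.unique h3
    · intro w
      have h2 : HasDerivAt (fun t => fderiv ℝ Φ (c t, derivWithin c (Icc a b) t))
          (fderiv ℝ (fderiv ℝ Φ) (c t, derivWithin c (Icc a b) t) (derivWithin c (Icc a b) t,
            derivWithin (derivWithin c (Icc a b)) (Icc a b) t)) t :=
        (hΦ.hasFDerivAt_fderiv hU hv).comp_hasDerivAt t (hdc.prodMk hdv)
      exact (hasDerivAt_clm_apply_const h2 (0, w)).unique (hk w t ht)
  refine ⟨?_, hgeo hα hL h1L fun ξ => (key ξ).2.1, hgeo hβ hR h1R fun ξ => (key ξ).2.2⟩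
  -- Both one-sided velocities have unit length and the same momentum. Evaluating the first momentum
  -- on the second velocity gives 1 by Euler's identity, and less than 1 by the strict fundamental
  -- inequality if the velocities differ.
  by_contra hne
  have e1 := h1L t₀ (right_mem_Icc.2 hα.le)
  have e2 := h1R t₀ (left_mem_Icc.2 hβ.le)
  have hU := hL.mem t₀ (right_mem_Icc.2 hα.le)
  have h2 := hΦ.fderiv_lt_of_ne hU e1 e2 (Ne.symm hne)
  rw [(key _).1, hΦ.euler hU (hR.ne_zero t₀ (left_mem_Icc.2 hβ.le)), e2] at h2
  exact lt_irrefl _ h2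

theorem pathLen_pos {c : ℝ → E} {α β : ℝ} (hαβ : α < β) (hc : IsRegularPath U c α β) :
    0 < pathLen Φ c α β := by
  have hcont : ContinuousOn (fun t => Φ (c t, derivWithin c (Icc α β) t)) (Icc α β) :=
    (hΦ.smooth.comp (hc.contDiffOn_lift hαβ)
      fun t ht => ⟨hc.mem t ht, hc.ne_zero t ht⟩).continuousOn
  exact intervalIntegral.integral_pos hαβ hcont
    (fun t ht => (hΦ.pos _ (hc.mem t (Ioc_subset_Icc_self ht)) _
      (hc.ne_zero t (Ioc_subset_Icc_self ht))).le)
    ⟨α, left_mem_Icc.2 hαβ.le, hΦ.pos _ (hc.mem _ (left_mem_Icc.2 hαβ.le)) _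
      (hc.ne_zero _ (left_mem_Icc.2 hαβ.le))⟩

/-- Parametrization by arc length. -/
theorem exists_unit_speed {c : ℝ → E} {α β : ℝ} (hαβ : α < β) (hc : IsRegularPath U c α β) :
    ∃ d : ℝ → E, ContDiffOn ℝ ∞ d (Icc 0 (pathLen Φ c α β)) ∧ d 0 = c α ∧
      d (pathLen Φ c α β) = c β ∧ (∀ s ∈ Icc 0 (pathLen Φ c α β), d s ∈ U) ∧
      ∀ s ∈ Ioo 0 (pathLen Φ c α β), ∃ v, HasDerivAt d v s ∧ Φ (d s, v) = 1 := by
  set L := pathLen Φ c α β with hL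
  have hL0 : 0 < L := hΦ.pathLen_pos hαβ hc
  have hsm : ContDiffOn ℝ ∞ (fun t => Φ (c t, derivWithin c (Icc α β) t)) (Icc α β) :=
    hΦ.smooth.comp (hc.contDiffOn_lift hαβ) fun t ht => ⟨hc.mem t ht, hc.ne_zero t ht⟩
  obtain ⟨ρ, cρ, eρ, hρ⟩ := exists_continuous_eqOn_Icc hαβ.le hsm.continuousOn
  have ρpos : ∀ t, 0 < ρ t := fun t => by
    obtain ⟨s, hs, h⟩ := hρ t
    rw [h]
    exact hΦ.pos _ (hc.mem s hs) _ (hc.ne_zero s hs)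
  set l : ℝ → ℝ := fun t => ∫ s in α..t, ρ s with hl
  have hld : ∀ t, HasStrictDerivAt l (ρ t) t := fun t => cρ.integral_hasStrictDerivAt α t
  have hmono : StrictMono l :=
    strictMono_of_deriv_pos fun t => by rw [(hld t).hasDerivAt.deriv]; exact ρpos t
  have lα : l α = 0 := by simp [hl]
  have lβ : l β = L := intervalIntegral.integral_congr fun t ht => by
    rw [uIcc_of_le hαβ.le] at ht; exact eρ ht
  have lcont : Continuous l := continuous_iff_continuousAt.2 fun t => (hld t).hasDerivAt.continuousAt
  set g := Function.invFun l with hg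
  have hgl : ∀ t, g (l t) = t := Function.leftInverse_invFun hmono.injective
  have hsurj : ∀ s ∈ Icc 0 L, ∃ t ∈ Icc α β, l t = s := by
    intro s hs
    have := intermediate_value_Icc hαβ.le lcont.continuousOn
    rw [lα, lβ] at this
    exact this hs
  have hgd : ∀ s ∈ Icc 0 L, HasDerivAt g (ρ (g s))⁻¹ s := by
    intro s hs
    obtain ⟨t, -, rfl⟩ := hsurj s hs
    rw [hgl]
    exact ((hld t).to_local_left_inverse (ρpos t).ne'
      (Filter.Eventually.of_forall hgl)).hasDerivAt
  have hgm : MapsTo g (Icc 0 L) (Icc α β) := by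
    intro s hs
    obtain ⟨t, ht, rfl⟩ := hsurj s hs
    rwa [hgl]
  -- The inverse satisfies g' = 1/ρ(g) up to the end points, which raises its regularity one order
  -- at a time; ρ is smooth only on the closed interval, so derivatives within it are used.
  have hgs : ContDiffOn ℝ ∞ g (Icc 0 L) := by
    rw [contDiffOn_infty]
    intro k
    induction k with
    | zero => exact contDiffOn_zero.2 fun s hs => (hgd s hs).continuousAt.continuousWithinAt
    | succ k ih =>
      push_cast
      rw [contDiffOn_succ_iff_derivWithin (uniqueDiffOn_Icc hL0)]
      refine ⟨fun s hs => (hgd s hs).differentiableAt.differentiableWithinAt, by simp, ?_⟩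
      have h1 : ContDiffOn ℝ k (fun s => (ρ (g s))⁻¹) (Icc 0 L) :=
        (((hsm.congr eρ).of_le (by exact_mod_cast le_top)).comp ih hgm).inv
          fun s _ => (ρpos _).ne'
      exact h1.congr fun s hs => ((hgd s hs).hasDerivWithinAt).derivWithin
        (uniqueDiffOn_Icc hL0 s hs)
  have g0 : g 0 = α := by rw [← lα, hgl]
  have gL : g L = β := by rw [← lβ, hgl]
  refine ⟨fun s => c (g s), hc.contDiffOn.comp hgs hgm, by simp only [g0], by simp only [gL],
    fun s hs => hc.mem _ (hgm hs), fun s hs => ?_⟩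
  have hs' := Ioo_subset_Icc_self hs
  have hgs' : g s ∈ Ioo α β := by
    obtain ⟨t, ht, rfl⟩ := hsurj s hs'
    rw [hgl]
    rw [← lα, ← lβ] at hs
    exact ⟨hmono.lt_iff_lt.1 hs.1, hmono.lt_iff_lt.1 hs.2⟩
  have hgI := Ioo_subset_Icc_self hgs'
  refine ⟨(ρ (g s))⁻¹ • derivWithin c (Icc α β) (g s),
    (hasDerivAt_derivWithin_Icc hc.contDiffOn hgs').scomp s (hgd s hs'), ?_⟩
  rw [hΦ.homog _ (hc.mem _ hgI) _ _ (inv_pos.2 (ρpos _)),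
    show Φ (c (g s), derivWithin c (Icc α β) (g s)) = ρ (g s) from (eρ hgI).symm]
  exact inv_mul_cancel₀ (ρpos _).ne'

end IsLocalFinsler

end LocalFinsler

/-! ### Passage from the manifold to chart coordinates. -/

section Charts

variable {n : ℕ} {M : Type*} [TopologicalSpace M] [ChartedSpace (EuclideanSpace ℝ (Fin n)) M]
  [IsManifold (𝓡 n) ∞ M]

/-- The space of coordinates. -/
abbrev Coord (n : ℕ) : Type := EuclideanSpace ℝ (Fin n)

/-- The tangent vector with coordinates `z = (x, y)` in the chart at `x₀`. -/
def chartLift (x₀ : M) (z : Coord n × Coord n) : TangentBundle (𝓡 n) M :=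
  ⟨(extChartAt (𝓡 n) x₀).symm z.1,
    mfderiv 𝓘(ℝ, Coord n) (𝓡 n) (extChartAt (𝓡 n) x₀).symm z.1 z.2⟩

/-- The expression of a function on `TM` in the coordinates induced by the chart at `x₀`. -/
def localRep (F : TangentBundle (𝓡 n) M → ℝ) (x₀ : M) (z : Coord n × Coord n) : ℝ :=
  F (chartLift x₀ z)

theorem contMDiff_tangentBundle_mk :
    ContMDiff 𝓘(ℝ, Coord n × Coord n) (𝓡 n).tangent ∞
      (fun z : Coord n × Coord n => (⟨z.1, z.2⟩ : TangentBundle 𝓘(ℝ, Coord n) (Coord n))) := by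
  intro z
  rw [contMDiffAt_totalSpace]
  refine ⟨contDiff_fst.contMDiff.contMDiffAt, ?_⟩
  convert! (contDiff_snd (𝕜 := ℝ) (E := Coord n) (F := Coord n)).contMDiff.contMDiffAt with y
  simp
  rfl

theorem contMDiffOn_chartLift (x₀ : M) :
    ContMDiffOn 𝓘(ℝ, Coord n × Coord n) (𝓡 n).tangent ∞ (chartLift (n := n) x₀)
      ((extChartAt (𝓡 n) x₀).target ×ˢ univ) := by
  have h1 := (contMDiffOn_extChartAt_symm (I := 𝓡 n) (n := ∞) x₀).contMDiffOn_tangentMapWithin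
    (m := ∞) (by simp) (isOpen_extChartAt_target x₀).uniqueMDiffOn
  have h2 := h1.comp (contMDiff_tangentBundle_mk (n := n)).contMDiffOn
    (s := (extChartAt (𝓡 n) x₀).target ×ˢ univ) fun z hz => hz.1
  refine h2.congr fun z hz => ?_
  simp only [chartLift, Function.comp_apply, tangentMapWithin]
  rw [mfderivWithin_of_isOpen (isOpen_extChartAt_target x₀) hz.1]

theorem mfderiv_extChartAt_symm_isInvertible (x₀ : M) {x : Coord n}
    (hx : x ∈ (extChartAt (𝓡 n) x₀).target) :
    (mfderiv 𝓘(ℝ, Coord n) (𝓡 n) (extChartAt (𝓡 n) x₀).symm x).IsInvertible := by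
  have h := isInvertible_mfderivWithin_extChartAt_symm (I := 𝓡 n) hx
  rwa [modelWithCornersSelf_coe, range_id, mfderivWithin_univ] at h

theorem chartLift_snd_ne_zero (x₀ : M) {z : Coord n × Coord n}
    (hx : z.1 ∈ (extChartAt (𝓡 n) x₀).target) (hz : z.2 ≠ 0) : (chartLift x₀ z).2 ≠ 0 := by
  intro h
  exact hz ((mfderiv_extChartAt_symm_isInvertible x₀ hx).injective (h.trans (map_zero _).symm))

/-- Translates strong convexity, which is stated with second derivatives along lines, into the
Hessian used in coordinates. -/
theorem iteratedDeriv_two_comp_line {X : Type*} [NormedAddCommGroup X] [NormedSpace ℝ X]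
    {f : X → ℝ} {p w : X} (hf : ContDiffAt ℝ ∞ f p) :
    iteratedDeriv 2 (fun t : ℝ => f (p + t • w)) 0 = fderiv ℝ (fderiv ℝ f) p w w := by
  have h1 : ∀ᶠ x in 𝓝 p, HasFDerivAt f (fderiv ℝ f x) x := by
    filter_upwards [(hf.of_le (m := 1) (by simp)).eventually (by simp)] with x hx
    exact (hx.differentiableAt (by simp)).hasFDerivAt
  have h2 : HasFDerivAt (fderiv ℝ f) (fderiv ℝ (fderiv ℝ f) p) (p + (0 : ℝ) • w) := by
    simpa using ((hf.fderiv_right (m := ∞) (by simp)).differentiableAt (by simp)).hasFDerivAt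
  have h3 : deriv (fun t : ℝ => f (p + t • w)) =ᶠ[𝓝 0] fun t => fderiv ℝ f (p + t • w) w := by
    have hc : ContinuousAt (fun t : ℝ => p + t • w) 0 := by fun_prop
    have : Tendsto (fun t : ℝ => p + t • w) (𝓝 0) (𝓝 p) := by simpa [ContinuousAt] using hc
    filter_upwards [this.eventually h1] with t ht
    exact (hasDerivAt_comp_line ht).deriv
  rw [iteratedDeriv_succ, iteratedDeriv_one, h3.deriv_eq]
  exact (hasDerivAt_comp_line_apply h2).deriv

/-- If F vanished at y ≠ 0, homogeneity would make F² vanish along the line y + ty near t = 0,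
against strong convexity in the direction y itself. -/
theorem IsFinslerMetric.pos {F : TangentBundle (𝓡 n) M → ℝ} (hF : IsFinslerMetric F) {x : M}
    {y : TangentSpace (𝓡 n) x} (hy : y ≠ 0) : 0 < F ⟨x, y⟩ := by
  refine lt_of_le_of_ne (hF.nonneg _) fun h0 => ?_
  have h := hF.strongly_convex x y y hy hy
  have h1 : (fun t : ℝ => F ⟨x, y + t • y⟩ ^ 2) =ᶠ[𝓝 0] fun _ => 0 := by
    filter_upwards [lt_mem_nhds (show (-1 : ℝ) < 0 by norm_num)] with t ht
    have : y + t • y = (1 + t) • y := by rw [add_smul, one_smul]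
    rw [this, hF.homogeneous x y _ (by linarith), ← h0]
    simp
  rw [h1.iteratedDeriv_eq, iteratedDeriv_const] at h
  simp at h

theorem IsFinslerMetric.map_zero {F : TangentBundle (𝓡 n) M → ℝ} (hF : IsFinslerMetric F) (x : M) :
    F ⟨x, 0⟩ = 0 := by
  have h := hF.homogeneous x 0 2 (by norm_num)
  rw [smul_zero] at h
  linarith

theorem IsFinslerMetric.continuousOn_localRep {F : TangentBundle (𝓡 n) M → ℝ}
    (hF : IsFinslerMetric F) (x₀ : M) :
    ContinuousOn (localRep F x₀) ((extChartAt (𝓡 n) x₀).target ×ˢ univ) :=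
  hF.continuous.comp_continuousOn (contMDiffOn_chartLift x₀).continuousOn

theorem IsFinslerMetric.isLocalFinsler {F : TangentBundle (𝓡 n) M → ℝ} (hF : IsFinslerMetric F)
    (x₀ : M) : IsLocalFinsler (extChartAt (𝓡 n) x₀).target (localRep F x₀) := by
  have hsm : ContDiffOn ℝ ∞ (localRep F x₀) ((extChartAt (𝓡 n) x₀).target ×ˢ {0}ᶜ) := by
    refine ContMDiffOn.contDiffOn ?_
    refine hF.smooth.comp ((contMDiffOn_chartLift x₀).mono fun z hz => ⟨hz.1, mem_univ _⟩)
      fun z hz => ?_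
    exact chartLift_snd_ne_zero x₀ hz.1 hz.2
  refine ⟨isOpen_extChartAt_target x₀, hsm, fun x hx y hy => ?_, fun x hx y c hc => ?_,
    fun x hx y w hy hw => ?_⟩
  · exact hF.pos (chartLift_snd_ne_zero x₀ (z := (x, y)) hx hy)
  · have e : chartLift x₀ (x, c • y) = ⟨(extChartAt (𝓡 n) x₀).symm x, c •
        mfderiv 𝓘(ℝ, Coord n) (𝓡 n) (extChartAt (𝓡 n) x₀).symm x y⟩ :=
      congrArg (fun u => (⟨_, u⟩ : TangentBundle (𝓡 n) M)) (ContinuousLinearMap.map_smul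
        (mfderiv 𝓘(ℝ, Coord n) (𝓡 n) (extChartAt (𝓡 n) x₀).symm x) c y)
    change F (chartLift x₀ (x, c • y)) = _
    rw [e]
    exact hF.homogeneous _ _ c hc
  · have hxy : (x, y) ∈ (extChartAt (𝓡 n) x₀).target ×ˢ ({0}ᶜ : Set (Coord n)) := ⟨hx, hy⟩
    have hca : ContDiffAt ℝ ∞ (fun p => localRep F x₀ p ^ 2) (x, y) :=
      (hsm.contDiffAt (((isOpen_extChartAt_target x₀).prod isOpen_compl_singleton).mem_nhds
        hxy)).pow 2
    rw [← iteratedDeriv_two_comp_line hca]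
    let L := mfderiv 𝓘(ℝ, Coord n) (𝓡 n) (extChartAt (𝓡 n) x₀).symm x
    have h := hF.strongly_convex _ (L y) (L w) (chartLift_snd_ne_zero x₀ (z := (x, y)) hx hy)
      (chartLift_snd_ne_zero x₀ (z := (x, w)) hx hw)
    have h2 : (fun t : ℝ => localRep F x₀ ((x, y) + t • ((0, w) : Coord n × Coord n)) ^ 2)
        = fun t : ℝ => F ⟨(extChartAt (𝓡 n) x₀).symm x, L y + t • L w⟩ ^ 2 := by
      funext t
      have e1 : (x, y) + t • ((0, w) : Coord n × Coord n) = (x, y + t • w) := by simp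
      have e2 : L (y + t • w) = L y + t • L w :=
        (ContinuousLinearMap.map_add L y (t • w)).trans
          (congrArg (L y + ·) (ContinuousLinearMap.map_smul L t w))
      rw [e1]
      change F ⟨_, L (y + t • w)⟩ ^ 2 = _
      rw [e2]
    rw [h2]
    linarith

/-- A curve with a derivative in the chart has the corresponding velocity. -/
theorem apply_velocity_eq_localRep (F : TangentBundle (𝓡 n) M → ℝ) (x₀ : M) {γ : ℝ → M} {t : ℝ}
    {v : Coord n} (hγ : ContinuousAt γ t) (hs : γ t ∈ (extChartAt (𝓡 n) x₀).source)
    (hv : HasDerivAt (fun s => extChartAt (𝓡 n) x₀ (γ s)) v t) :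
    F ⟨γ t, velocity γ t⟩ = localRep F x₀ (extChartAt (𝓡 n) x₀ (γ t), v) := by
  set c : ℝ → Coord n := fun s => extChartAt (𝓡 n) x₀ (γ s) with hc
  have hx : c t ∈ (extChartAt (𝓡 n) x₀).target := (extChartAt (𝓡 n) x₀).map_source hs
  have heq : γ =ᶠ[𝓝 t] (extChartAt (𝓡 n) x₀).symm ∘ c := by
    filter_upwards [hγ.eventually ((isOpen_extChartAt_source x₀).mem_nhds hs)] with s hs'
    exact ((extChartAt (𝓡 n) x₀).left_inv hs').symm
  have hd : MDifferentiableAt 𝓘(ℝ, Coord n) (𝓡 n) (extChartAt (𝓡 n) x₀).symm (c t) :=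
    ((contMDiffOn_extChartAt_symm (n := ∞) x₀).contMDiffAt
      ((isOpen_extChartAt_target x₀).mem_nhds hx)).mdifferentiableAt (by simp)
  have h1 : HasMFDerivAt 𝓘(ℝ, ℝ) (𝓡 n) ((extChartAt (𝓡 n) x₀).symm ∘ c) t
      ((mfderiv 𝓘(ℝ, Coord n) (𝓡 n) (extChartAt (𝓡 n) x₀).symm (c t)).comp
        (ContinuousLinearMap.toSpanSingleton ℝ v)) :=
    hd.hasMFDerivAt.comp t hv.hasFDerivAt.hasMFDerivAt
  have h2 := (h1.congr_of_eventuallyEq heq).mfderiv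
  have h3 : ((extChartAt (𝓡 n) x₀).symm ∘ c) t = γ t := heq.self_of_nhds.symm
  simp only [localRep, chartLift]
  congr 1
  refine Bundle.TotalSpace.ext h3.symm ?_
  refine heq_of_eq ?_
  change velocity γ t = _
  unfold velocity
  rw [h2]
  change mfderiv 𝓘(ℝ, Coord n) (𝓡 n) (extChartAt (𝓡 n) x₀).symm (c t) ((1 : ℝ) • v) = _
  rw [one_smul]

end Charts

/-! ### Unit-speed paths: restriction, concatenation, shortest paths. -/

section Paths

variable {n : ℕ} {M : Type*} [TopologicalSpace M] [ChartedSpace (EuclideanSpace ℝ (Fin n)) M]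
  [IsManifold (𝓡 n) ∞ M]

/-- `γ` restricted to `[a, b]` is a smooth curve of unit `F`-speed. -/
structure IsUnitPiece (F : TangentBundle (𝓡 n) M → ℝ) (γ : ℝ → M) (a b : ℝ) : Prop where
  smooth : ContMDiffOn 𝓘(ℝ, ℝ) (𝓡 n) ∞ γ (Icc a b)
  speed : ∀ t ∈ Ioo a b, F ⟨γ t, velocity γ t⟩ = 1

/-- `γ` restricted to `[a, b]` is a piecewise smooth curve of unit `F`-speed. -/
def IsUnitPath (F : TangentBundle (𝓡 n) M → ℝ) (γ : ℝ → M) (a b : ℝ) : Prop :=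
  ∃ P : Finset ℝ, ∀ c d : ℝ, a ≤ c → c < d → d ≤ b → (∀ t ∈ P, t ∉ Ioo c d) → IsUnitPiece F γ c d

/-- The unit speed path `γ` on `[a, b]` is a shortest one between its end points. -/
def IsShortestOn (F : TangentBundle (𝓡 n) M → ℝ) (γ : ℝ → M) (a b : ℝ) : Prop :=
  IsUnitPath F γ a b ∧ ∀ (σ : ℝ → M) (c d : ℝ), c ≤ d → IsUnitPath F σ c d →
    σ c = γ a → σ d = γ b → b - a ≤ d - c

/-- The short pieces of the unit speed path `γ` on `[a, b]` are shortest paths. -/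
def IsLocallyShortestOn (F : TangentBundle (𝓡 n) M → ℝ) (γ : ℝ → M) (a b : ℝ) : Prop :=
  IsUnitPath F γ a b ∧ ∀ t ∈ Icc a b, ∃ ε > 0, ∀ c ∈ Icc a b, ∀ d ∈ Icc a b,
    |c - t| < ε → |d - t| < ε → c < d → IsShortestOn F γ c d

variable {F : TangentBundle (𝓡 n) M → ℝ}

/-- The two velocities have formally different types, being in the fibres over γ t and σ t;
comparing the values of F avoids transport between them. -/
theorem apply_velocity_congr (F : TangentBundle (𝓡 n) M → ℝ) {γ σ : ℝ → M} {t : ℝ}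
    (h : γ =ᶠ[𝓝 t] σ) : F ⟨γ t, velocity γ t⟩ = F ⟨σ t, velocity σ t⟩ := by
  congr 1
  refine Bundle.TotalSpace.ext h.self_of_nhds (heq_of_eq ?_)
  change velocity γ t = _
  unfold velocity
  rw [h.mfderiv_eq]
  rfl

theorem apply_velocity_shift (F : TangentBundle (𝓡 n) M → ℝ) {γ : ℝ → M} {t k : ℝ}
    (h : MDifferentiableAt 𝓘(ℝ, ℝ) (𝓡 n) γ (t + k)) :
    F ⟨γ (t + k), velocity (fun s => γ (s + k)) t⟩ = F ⟨γ (t + k), velocity γ (t + k)⟩ := by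
  congr 2
  have h1 : HasMFDerivAt 𝓘(ℝ, ℝ) 𝓘(ℝ, ℝ) (fun s : ℝ => s + k) t
      (ContinuousLinearMap.id ℝ ℝ) := ((hasFDerivAt_id t).add_const k).hasMFDerivAt
  have h2 := (h.hasMFDerivAt.comp t h1).mfderiv
  unfold velocity
  change mfderiv 𝓘(ℝ, ℝ) (𝓡 n) (γ ∘ fun s => s + k) t (1 : ℝ) = _
  rw [h2]
  rfl

namespace IsUnitPiece

theorem congr {γ σ : ℝ → M} {a b : ℝ} (h : IsUnitPiece F γ a b) (e : EqOn σ γ (Icc a b)) :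
    IsUnitPiece F σ a b := by
  refine ⟨h.smooth.congr e, fun t ht => ?_⟩
  rw [← h.speed t ht]
  refine apply_velocity_congr F ?_
  filter_upwards [Icc_mem_nhds ht.1 ht.2] with s hs using e hs

theorem mono {γ : ℝ → M} {a b c d : ℝ} (h : IsUnitPiece F γ a b) (hc : a ≤ c) (hd : d ≤ b) :
    IsUnitPiece F γ c d :=
  ⟨h.smooth.mono (Icc_subset_Icc hc hd), fun t ht => h.speed t (Ioo_subset_Ioo hc hd ht)⟩

theorem shift {γ : ℝ → M} {a b : ℝ} (k : ℝ) (h : IsUnitPiece F γ (a + k) (b + k)) :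
    IsUnitPiece F (fun t => γ (t + k)) a b := by
  have hm : MapsTo (fun s : ℝ => s + k) (Icc a b) (Icc (a + k) (b + k)) := fun s hs =>
    ⟨by linarith [hs.1], by linarith [hs.2]⟩
  refine ⟨h.smooth.comp (t := Icc (a + k) (b + k))
    ((contDiff_id.add contDiff_const).contMDiff.contMDiffOn) hm, fun t ht => ?_⟩
  have ht' : t + k ∈ Ioo (a + k) (b + k) := ⟨by linarith [ht.1], by linarith [ht.2]⟩
  rw [← h.speed _ ht']
  exact apply_velocity_shift F
    ((h.smooth.contMDiffAt (Icc_mem_nhds ht'.1 ht'.2)).mdifferentiableAt (by simp))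

theorem isUnitPath {γ : ℝ → M} {a b : ℝ} (h : IsUnitPiece F γ a b) : IsUnitPath F γ a b :=
  ⟨∅, fun _ _ hc _ hd _ => h.mono hc hd⟩

end IsUnitPiece

namespace IsUnitPath

theorem congr {γ σ : ℝ → M} {a b : ℝ} (h : IsUnitPath F γ a b) (e : EqOn σ γ (Icc a b)) :
    IsUnitPath F σ a b := by
  obtain ⟨P, hP⟩ := h
  exact ⟨P, fun c d hc hcd hd ht => (hP c d hc hcd hd ht).congr
    (e.mono (Icc_subset_Icc hc hd))⟩

theorem mono {γ : ℝ → M} {a b c d : ℝ} (h : IsUnitPath F γ a b) (hc : a ≤ c) (hd : d ≤ b) :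
    IsUnitPath F γ c d := by
  obtain ⟨P, hP⟩ := h
  exact ⟨P, fun c' d' hc' hcd hd' ht => hP c' d' (hc.trans hc') hcd (hd'.trans hd) ht⟩

theorem shift {γ : ℝ → M} {a b : ℝ} (k : ℝ) (h : IsUnitPath F γ (a + k) (b + k)) :
    IsUnitPath F (fun t => γ (t + k)) a b := by
  obtain ⟨P, hP⟩ := h
  refine ⟨P.image (· - k), fun c d hc hcd hd ht => (hP (c + k) (d + k) (by linarith)
    (by linarith) (by linarith) fun t htP htI => ?_).shift k⟩
  exact ht (t - k) (Finset.mem_image_of_mem _ htP) ⟨by linarith [htI.1], by linarith [htI.2]⟩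

theorem append {γ : ℝ → M} {a b c : ℝ} (h₁ : IsUnitPath F γ a b) (h₂ : IsUnitPath F γ b c) :
    IsUnitPath F γ a c := by
  obtain ⟨P, hP⟩ := h₁
  obtain ⟨Q, hQ⟩ := h₂
  refine ⟨insert b (P ∪ Q), fun c d hc hcd hd ht => ?_⟩
  have hb := ht b (by simp)
  rcases le_or_gt b c with h | h
  · exact hQ c d h hcd hd fun t htQ => ht t (by simp [htQ])
  · refine hP c d hc hcd ?_ fun t htP => ht t (by simp [htP])
    by_contra hbd
    exact hb ⟨h, by linarith⟩

theorem trans {σ τ : ℝ → M} {a b c d : ℝ} (hab : a ≤ b) (hcd : c ≤ d) (h₁ : IsUnitPath F σ a b)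
    (h₂ : IsUnitPath F τ c d) (e : σ b = τ c) :
    ∃ γ : ℝ → M, IsUnitPath F γ a (b + (d - c)) ∧ γ a = σ a ∧ γ (b + (d - c)) = τ d := by
  set γ : ℝ → M := fun t => if t ≤ b then σ t else τ (t + (c - b)) with hγ
  have e₁ : EqOn γ σ (Icc a b) := fun t ht => if_pos ht.2
  have e₂ : EqOn γ (fun t => τ (t + (c - b))) (Icc b (b + (d - c))) := by
    intro t ht
    rcases ht.1.eq_or_lt with rfl | hlt
    · simp [hγ, e]
    · exact if_neg (not_le.2 hlt)
  refine ⟨γ, (h₁.congr e₁).append (IsUnitPath.congr ?_ e₂), e₁ (left_mem_Icc.2 hab), ?_⟩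
  · refine IsUnitPath.shift (c - b) ?_
    convert h₂ using 1 <;> ring
  · rw [e₂ (right_mem_Icc.2 (by linarith))]
    simp only
    congr 1
    ring

end IsUnitPath

/-- A faster competitor for a piece, spliced between the two remaining pieces of γ, would be a
faster competitor for the whole path. Breaks at the junctions are allowed. -/
theorem IsShortestOn.mono {γ : ℝ → M} {a b c d : ℝ} (h : IsShortestOn F γ a b) (hc : a ≤ c)
    (hcd : c ≤ d) (hd : d ≤ b) : IsShortestOn F γ c d := by
  refine ⟨h.1.mono hc hd, fun σ e f hef hσ h1 h2 => ?_⟩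
  obtain ⟨τ, hτ, τ1, τ2⟩ := (h.1.mono le_rfl (hcd.trans hd)).trans hc hef hσ h1.symm
  obtain ⟨ρ, hρ, ρ1, ρ2⟩ := hτ.trans (by linarith) hd (h.1.mono (hc.trans hcd) le_rfl)
    (τ2.trans h2)
  have := h.2 ρ _ _ (by linarith) hρ (ρ1.trans τ1) ρ2
  linarith

theorem IsShortestOn.isLocallyShortestOn {γ : ℝ → M} {a b : ℝ} (h : IsShortestOn F γ a b) :
    IsLocallyShortestOn F γ a b :=
  ⟨h.1, fun _ _ => ⟨1, one_pos, fun _ hc _ hd _ _ hcd => h.mono hc.1 hcd.le hd.2⟩⟩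

/-- A unit speed curve in a chart gives one on the manifold. -/
theorem isUnitPiece_of_chart {x₀ : M} {d : ℝ → Coord n} {α β : ℝ}
    (hd : ContDiffOn ℝ ∞ d (Icc α β)) (hm : ∀ s ∈ Icc α β, d s ∈ (extChartAt (𝓡 n) x₀).target)
    (h1 : ∀ s ∈ Ioo α β, ∃ v, HasDerivAt d v s ∧ localRep F x₀ (d s, v) = 1) :
    IsUnitPiece F (fun s => (extChartAt (𝓡 n) x₀).symm (d s)) α β := by
  have hs : ContMDiffOn 𝓘(ℝ, ℝ) (𝓡 n) ∞ (fun s => (extChartAt (𝓡 n) x₀).symm (d s)) (Icc α β) :=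
    (contMDiffOn_extChartAt_symm (n := ∞) x₀).comp hd.contMDiffOn hm
  refine ⟨hs, fun t ht => ?_⟩
  obtain ⟨v, hv, hv1⟩ := h1 t ht
  have hn := Icc_mem_nhds ht.1 ht.2
  have e : (fun s => extChartAt (𝓡 n) x₀ ((extChartAt (𝓡 n) x₀).symm (d s))) =ᶠ[𝓝 t] d := by
    filter_upwards [hn] with s hs using (extChartAt (𝓡 n) x₀).right_inv (hm s hs)
  rw [apply_velocity_eq_localRep F x₀ (hs.continuousOn.continuousAt hn)
    ((extChartAt (𝓡 n) x₀).map_target (hm t (Ioo_subset_Icc_self ht)))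
    (hv.congr_of_eventuallyEq e)]
  have e0 : extChartAt (𝓡 n) x₀ ((extChartAt (𝓡 n) x₀).symm (d t)) = d t := e.self_of_nhds
  rw [e0, hv1]

/-- A smooth unit speed curve inside a chart, in coordinates. -/
theorem IsUnitPiece.chart (hF : IsFinslerMetric F) {γ : ℝ → M} {x₀ : M} {α β : ℝ} (hαβ : α < β)
    (h : IsUnitPiece F γ α β) (hs : ∀ t ∈ Icc α β, γ t ∈ (extChartAt (𝓡 n) x₀).source) :
    IsRegularPath (extChartAt (𝓡 n) x₀).target (fun t => extChartAt (𝓡 n) x₀ (γ t)) α β ∧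
    ∀ t ∈ Icc α β, localRep F x₀ (extChartAt (𝓡 n) x₀ (γ t),
      derivWithin (fun t => extChartAt (𝓡 n) x₀ (γ t)) (Icc α β) t) = 1 := by
  set c : ℝ → Coord n := fun t => extChartAt (𝓡 n) x₀ (γ t) with hc
  have hm : ∀ t ∈ Icc α β, c t ∈ (extChartAt (𝓡 n) x₀).target := fun t ht =>
    (extChartAt (𝓡 n) x₀).map_source (hs t ht)
  have hsm : ContDiffOn ℝ ∞ c (Icc α β) :=
    ((contMDiffOn_extChartAt (n := ∞) (x := x₀)).comp h.smooth fun t ht => by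
      rw [← extChartAt_source (𝓡 n)]; exact hs t ht).contDiffOn
  have h1 : ∀ t ∈ Ioo α β, localRep F x₀ (c t, derivWithin c (Icc α β) t) = 1 := by
    intro t ht
    rw [← apply_velocity_eq_localRep F x₀
      (h.smooth.continuousOn.continuousAt (Icc_mem_nhds ht.1 ht.2))
      (hs t (Ioo_subset_Icc_self ht)) (hasDerivAt_derivWithin_Icc hsm ht)]
    exact h.speed t ht
  have hcont : ContinuousOn (fun t => localRep F x₀ (c t, derivWithin c (Icc α β) t)) (Icc α β) :=
    (hF.continuousOn_localRep x₀).comp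
      (hsm.continuousOn.prodMk (contDiffOn_derivWithin_Icc hαβ hsm).continuousOn)
      fun t ht => ⟨hm t ht, mem_univ _⟩
  -- Unit speed is assumed only at interior times. Continuity of F carries it to the end points,
  -- where it also shows that the one-sided velocities are nonzero.
  have h2 : ∀ t ∈ Icc α β, localRep F x₀ (c t, derivWithin c (Icc α β) t) = 1 := by
    have e : EqOn (fun t => localRep F x₀ (c t, derivWithin c (Icc α β) t)) (fun _ => 1)
        (Ioo α β) := h1
    exact e.of_subset_closure hcont continuousOn_const Ioo_subset_Icc_self
      (closure_Ioo hαβ.ne).ge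
  refine ⟨⟨hsm, hm, fun t ht h0 => ?_⟩, h2⟩
  have := h2 t ht
  rw [h0, (hF.isLocalFinsler x₀).map_zero (hm t ht)] at this
  exact zero_ne_one this

end Paths

theorem IsLocalFinsler.vertHess_symm {E : Type*} [NormedAddCommGroup E] [NormedSpace ℝ E]
    {U : Set E} {Φ : E × E → ℝ} (hΦ : IsLocalFinsler U Φ) {x v : E} (hx : x ∈ U) (hv : v ≠ 0)
    (w w' : E) : vertHess Φ (x, v) w w' = vertHess Φ (x, v) w' w := by
  rw [vertHess_apply, vertHess_apply]
  exact ((hΦ.contDiffAt_sq hx hv).isSymmSndFDerivAt (by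
    simp only [minSmoothness_of_isRCLikeNormedField]; exact WithTop.coe_le_coe.2 (le_top (a := (2 : ℕ∞))))).eq _ _

/-! ### The spray coefficients are minus half the acceleration. -/

section SprayCoordinates

variable {n : ℕ} {M : Type*} [TopologicalSpace M] [ChartedSpace (EuclideanSpace ℝ (Fin n)) M]
  [IsManifold (𝓡 n) ∞ M] {F : TangentBundle (𝓡 n) M → ℝ}

theorem sum_smul_coordVec (y : Coord n) : ∑ i, y i • coordVec i = y := by
  simpa using (EuclideanSpace.basisFun (Fin n) ℝ).sum_repr y

theorem lineDeriv_snd {Q : Coord n × Coord n → ℝ} {x y : Coord n} {Q' : Coord n × Coord n →L[ℝ] ℝ}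
    (h : HasFDerivAt Q Q' (x, y)) (w : Coord n) : lineDeriv ℝ (fun y' => Q (x, y')) y w = Q' (0, w) := by
  have h1 : HasDerivAt (fun t : ℝ => Q ((x, y) + t • ((0 : Coord n), w))) (Q' (0, w)) 0 :=
    hasDerivAt_comp_line (by simpa using h)
  rw [lineDeriv, ← h1.deriv]
  simp

theorem lineDeriv_fst {Q : Coord n × Coord n → ℝ} {x y : Coord n} {Q' : Coord n × Coord n →L[ℝ] ℝ}
    (h : HasFDerivAt Q Q' (x, y)) (w : Coord n) : lineDeriv ℝ (fun x' => Q (x', y)) x w = Q' (w, 0) := by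
  have h1 : HasDerivAt (fun t : ℝ => Q ((x, y) + t • (w, (0 : Coord n)))) (Q' (w, 0)) 0 :=
    hasDerivAt_comp_line (by simpa using h)
  rw [lineDeriv, ← h1.deriv]
  simp

variable {x₀ : M} {x v : Coord n}

theorem IsFinslerMetric.lineDeriv_lineDeriv_snd (hF : IsFinslerMetric F)
    (hx : x ∈ (extChartAt (𝓡 n) x₀).target) (hv : v ≠ 0) (w w' : Coord n) :
    lineDeriv ℝ (fun y' => lineDeriv ℝ (fun y'' => localSq F x₀ x y'') y' w') v w =
      fderiv ℝ (fderiv ℝ (fun p => localRep F x₀ p ^ 2)) (x, v) (0, w) (0, w') := by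
  have hΦ := hF.isLocalFinsler x₀
  have h1 : ∀ᶠ t in 𝓝 (0 : ℝ), lineDeriv ℝ (fun y'' => localSq F x₀ x y'') (v + t • w) w' =
      fderiv ℝ (fun p => localRep F x₀ p ^ 2) ((x, v) + t • ((0 : Coord n), w)) (0, w') := by
    have hc : ContinuousAt (fun t : ℝ => v + t • w) 0 := by fun_prop
    have h0 : ∀ᶠ t in 𝓝 (0 : ℝ), v + t • w ≠ 0 :=
      hc.eventually (isOpen_ne.mem_nhds (by simpa using hv))
    filter_upwards [h0] with t ht
    have := lineDeriv_snd (hΦ.hasFDerivAt_sq hx ht) w'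
    simpa [localSq, localRep, chartLift] using this
  have h2 := hasDerivAt_comp_line_apply (f := fderiv ℝ (fun p => localRep F x₀ p ^ 2))
    (p := (x, v)) (s := 0) (w := ((0 : Coord n), w)) (z := ((0 : Coord n), w'))
    (by simpa using hΦ.hasFDerivAt_fderiv_sq hx hv)
  exact (h2.congr_of_eventuallyEq h1).deriv

theorem IsFinslerMetric.lineDeriv_lineDeriv_fst (hF : IsFinslerMetric F)
    (hx : x ∈ (extChartAt (𝓡 n) x₀).target) (hv : v ≠ 0) (w w' : Coord n) :
    lineDeriv ℝ (fun x' => lineDeriv ℝ (fun y' => localSq F x₀ x' y') v w') x w =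
      fderiv ℝ (fderiv ℝ (fun p => localRep F x₀ p ^ 2)) (x, v) (w, 0) (0, w') := by
  have hΦ := hF.isLocalFinsler x₀
  have h1 : ∀ᶠ t in 𝓝 (0 : ℝ), lineDeriv ℝ (fun y' => localSq F x₀ (x + t • w) y') v w' =
      fderiv ℝ (fun p => localRep F x₀ p ^ 2) ((x, v) + t • (w, (0 : Coord n))) (0, w') := by
    have hc : ContinuousAt (fun t : ℝ => x + t • w) 0 := by fun_prop
    have h0 : ∀ᶠ t in 𝓝 (0 : ℝ), x + t • w ∈ (extChartAt (𝓡 n) x₀).target :=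
      hc.eventually ((isOpen_extChartAt_target x₀).mem_nhds (by simpa using hx))
    filter_upwards [h0] with t ht
    have := lineDeriv_snd (hΦ.hasFDerivAt_sq ht hv) w'
    simpa [localSq, localRep, chartLift] using this
  have h2 := hasDerivAt_comp_line_apply (f := fderiv ℝ (fun p => localRep F x₀ p ^ 2))
    (p := (x, v)) (s := 0) (w := (w, (0 : Coord n))) (z := ((0 : Coord n), w'))
    (by simpa using hΦ.hasFDerivAt_fderiv_sq hx hv)
  exact (h2.congr_of_eventuallyEq h1).deriv

theorem IsFinslerMetric.fundTensor_eq (hF : IsFinslerMetric F)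
    (hx : x ∈ (extChartAt (𝓡 n) x₀).target) (hv : v ≠ 0) (i j : Fin n) :
    fundTensor F x₀ x v i j =
      1 / 2 * vertHess (localRep F x₀) (x, v) (coordVec i) (coordVec j) := by
  rw [fundTensor, Matrix.of_apply, hF.lineDeriv_lineDeriv_snd hx hv, vertHess_apply]

theorem IsFinslerMetric.isUnit_fundTensor (hF : IsFinslerMetric F)
    (hx : x ∈ (extChartAt (𝓡 n) x₀).target) (hv : v ≠ 0) : IsUnit (fundTensor F x₀ x v) := by
  rw [← Matrix.mulVec_injective_iff_isUnit]
  refine (injective_iff_map_eq_zero (Matrix.mulVecLin (fundTensor F x₀ x v))).2 fun w hw => ?_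
  by_contra hne
  have hw' : (WithLp.toLp 2 w : Coord n) ≠ 0 := by
    intro h
    apply hne
    funext i
    exact congrArg (fun z : Coord n => z i) h
  have hpos := (hF.isLocalFinsler x₀).convex x hx v _ hv hw'
  rw [← vertHess_apply] at hpos
  have h2 : ∀ i, vertHess (localRep F x₀) (x, v) (coordVec i) (WithLp.toLp 2 w) = 0 := by
    intro i
    have h3 := congrFun hw i
    simp only [Matrix.mulVecLin_apply, Matrix.mulVec, dotProduct, Pi.zero_apply,
      hF.fundTensor_eq hx hv] at h3
    rw [← sum_smul_coordVec (WithLp.toLp 2 w : Coord n), map_sum]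
    simp only [map_smul, smul_eq_mul]
    have h4 : ∑ j, w j * vertHess (localRep F x₀) (x, v) (coordVec i) (coordVec j) =
        2 * ∑ j, 1 / 2 * vertHess (localRep F x₀) (x, v) (coordVec i) (coordVec j) * w j := by
      rw [Finset.mul_sum]
      exact Finset.sum_congr rfl fun j _ => by ring
    rw [h4, h3, mul_zero]
  have h5 : vertHess (localRep F x₀) (x, v)
      (∑ i, (WithLp.toLp 2 w : Coord n) i • coordVec i) (WithLp.toLp 2 w) = 0 := by
    rw [map_sum, sum_apply]
    refine Finset.sum_eq_zero fun i _ => ?_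
    rw [map_smul, smul_apply, h2 i, smul_zero]
  rw [sum_smul_coordVec] at h5
  exact hpos.ne' h5

/-- The bracket in the spray is minus the force term of the Euler–Lagrange equation, and the force
is the vertical Hessian applied to the acceleration a, that is twice the fundamental tensor applied
to a. The inverse fundamental tensor cancels, and ¼·(-2) leaves -a/2. -/
theorem IsFinslerMetric.two_mul_spray (hF : IsFinslerMetric F)
    (hx : x ∈ (extChartAt (𝓡 n) x₀).target) (hv : v ≠ 0) (i : Fin n) :
    2 * spray F x₀ x v i = -accel (localRep F x₀) (x, v) i := by
  have hΦ := hF.isLocalFinsler x₀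
  set a := accel (localRep F x₀) (x, v) with ha
  have hEL := (eulerLagrange_iff_vertHess _ _ _ _).1 ((hΦ.eulerLagrange_iff hx hv a).2 ha)
  have h1 : ∀ l, (∑ k : Fin n, lineDeriv ℝ (fun x' => lineDeriv ℝ (fun y' => localSq F x₀ x' y') v
      (coordVec l)) x (coordVec k) * v k) - lineDeriv ℝ (fun x' => localSq F x₀ x' v) x (coordVec l)
      = -vertForce (localRep F x₀) (x, v) (coordVec l) := by
    intro l
    have e1 : lineDeriv ℝ (fun x' => localSq F x₀ x' v) x (coordVec l) =
        fderiv ℝ (fun p => localRep F x₀ p ^ 2) (x, v) (coordVec l, 0) :=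
      lineDeriv_fst (hΦ.hasFDerivAt_sq hx hv) _
    have e2 : ∑ k : Fin n, lineDeriv ℝ (fun x' => lineDeriv ℝ (fun y' => localSq F x₀ x' y') v
        (coordVec l)) x (coordVec k) * v k =
        fderiv ℝ (fderiv ℝ (fun p => localRep F x₀ p ^ 2)) (x, v) (v, 0) (0, coordVec l) := by
      have e3 : ((v, 0) : Coord n × Coord n) =
          ∑ k, v k • ((coordVec k, 0) : Coord n × Coord n) := by
        have := congrArg (LinearMap.inl ℝ (Coord n) (Coord n)) (sum_smul_coordVec v)
        rw [map_sum] at this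
        simpa using this.symm
      rw [e3, map_sum, sum_apply]
      refine Finset.sum_congr rfl fun k _ => ?_
      rw [hF.lineDeriv_lineDeriv_fst hx hv, map_smul, smul_apply, smul_eq_mul, mul_comm]
    rw [e1, e2]
    simp [vertForce]
  have h2 : ∀ l, vertForce (localRep F x₀) (x, v) (coordVec l) =
      2 * (fundTensor F x₀ x v).mulVec (fun i => a i) l := by
    intro l
    rw [← hEL, hΦ.vertHess_symm hx hv]
    conv_lhs => rw [← sum_smul_coordVec a]
    rw [map_sum, Matrix.mulVec, dotProduct, Finset.mul_sum]
    refine Finset.sum_congr rfl fun k _ => ?_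
    rw [map_smul, smul_eq_mul, hF.fundTensor_eq hx hv]
    ring
  have h3 : spray F x₀ x v i = 1 / 4 * -(2 * ((fundTensor F x₀ x v)⁻¹.mulVec
      ((fundTensor F x₀ x v).mulVec fun i => a i)) i) := by
    rw [spray]
    congr 1
    rw [Matrix.mulVec, dotProduct, Finset.mul_sum, ← Finset.sum_neg_distrib]
    refine Finset.sum_congr rfl fun l _ => ?_
    rw [h1, h2]
    ring
  rw [h3, Matrix.mulVec_mulVec, Matrix.nonsing_inv_mul _
    ((Matrix.isUnit_iff_isUnit_det _).1 (hF.isUnit_fundTensor hx hv)), Matrix.one_mulVec]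
  ring

end SprayCoordinates

/-! ### Locally shortest paths are geodesics. -/

section ShortestIsGeodesic

variable {n : ℕ} {M : Type*} [TopologicalSpace M] [ChartedSpace (EuclideanSpace ℝ (Fin n)) M]
  [IsManifold (𝓡 n) ∞ M] {F : TangentBundle (𝓡 n) M → ℝ}

theorem exists_forall_notMem_Ioo (P : Finset ℝ) (t₀ : ℝ) :
    ∃ δ > 0, ∀ t ∈ P, t ∉ Ioo (t₀ - δ) t₀ ∧ t ∉ Ioo t₀ (t₀ + δ) := by
  have h : ((P.erase t₀ : Finset ℝ) : Set ℝ)ᶜ ∈ 𝓝 t₀ :=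
    (P.erase t₀).finite_toSet.isClosed.isOpen_compl.mem_nhds (by simp)
  obtain ⟨δ, hδ, hb⟩ := Metric.mem_nhds_iff.1 h
  refine ⟨δ, hδ, fun t ht => ⟨fun h => ?_, fun h => ?_⟩⟩
  · refine hb (?_ : t ∈ Metric.ball t₀ δ) (by simp [ht, h.2.ne])
    rw [Metric.mem_ball, Real.dist_eq, abs_lt]
    exact ⟨by linarith [h.1], by linarith [h.2]⟩
  · refine hb (?_ : t ∈ Metric.ball t₀ δ) (by simp [ht, h.1.ne'])
    rw [Metric.mem_ball, Real.dist_eq, abs_lt]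
    exact ⟨by linarith [h.1], by linarith [h.2]⟩

/-- Around an interior time a unit speed path consists of two smooth pieces. -/
theorem IsUnitPath.exists_pieces {γ : ℝ → M} {a b t₀ : ℝ} (h : IsUnitPath F γ a b)
    (ht : t₀ ∈ Ioo a b) : ∃ δ > 0, a ≤ t₀ - δ ∧ t₀ + δ ≤ b ∧ IsUnitPiece F γ (t₀ - δ) t₀ ∧
      IsUnitPiece F γ t₀ (t₀ + δ) := by
  obtain ⟨P, hP⟩ := h
  obtain ⟨δ, hδ, hδP⟩ := exists_forall_notMem_Ioo P t₀
  have h1 := ht.1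
  have h2 := ht.2
  have m1 := min_le_left δ (min (t₀ - a) (b - t₀))
  have m2 := (min_le_right δ (min (t₀ - a) (b - t₀))).trans (min_le_left _ _)
  have m3 := (min_le_right δ (min (t₀ - a) (b - t₀))).trans (min_le_right _ _)
  have m0 : 0 < min δ (min (t₀ - a) (b - t₀)) :=
    lt_min hδ (lt_min (by linarith) (by linarith))
  refine ⟨_, m0, by linarith, by linarith,
    hP _ _ (by linarith) (by linarith) h2.le fun t htP hI => (hδP t htP).1 ⟨?_, hI.2⟩,
    hP _ _ h1.le (by linarith) (by linarith) fun t htP hI => (hδP t htP).2 ⟨hI.1, ?_⟩⟩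
  · linarith [hI.1]
  · linarith [hI.2]

theorem IsUnitPath.exists_piece_left {γ : ℝ → M} {a b : ℝ} (h : IsUnitPath F γ a b) (hab : a < b) :
    ∃ d ∈ Ioc a b, IsUnitPiece F γ a d := by
  obtain ⟨P, hP⟩ := h
  obtain ⟨δ, hδ, hδP⟩ := exists_forall_notMem_Ioo P a
  refine ⟨min (a + δ) b, ⟨lt_min (by linarith) hab, min_le_right _ _⟩,
    hP _ _ le_rfl (lt_min (by linarith) hab) (min_le_right _ _) fun t ht hI =>
      (hδP t ht).2 ⟨hI.1, hI.2.trans_le (min_le_left _ _)⟩⟩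

theorem IsUnitPath.exists_piece_right {γ : ℝ → M} {a b : ℝ} (h : IsUnitPath F γ a b)
    (hab : a < b) : ∃ c ∈ Ico a b, IsUnitPiece F γ c b := by
  obtain ⟨P, hP⟩ := h
  obtain ⟨δ, hδ, hδP⟩ := exists_forall_notMem_Ioo P b
  refine ⟨max (b - δ) a, ⟨le_max_right _ _, max_lt (by linarith) hab⟩,
    hP _ _ (le_max_right _ _) (max_lt (by linarith) hab) le_rfl fun t ht hI =>
      (hδP t ht).1 ⟨(le_max_left _ _).trans_lt hI.1, hI.2⟩⟩

theorem continuousAt_of_continuousOn_Icc {X : Type*} [TopologicalSpace X] {f : ℝ → X}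
    {α t₀ β : ℝ} (hα : α < t₀) (hβ : t₀ < β) (h1 : ContinuousOn f (Icc α t₀))
    (h2 : ContinuousOn f (Icc t₀ β)) : ContinuousAt f t₀ := by
  rw [continuousAt_iff_continuous_left_right]
  exact ⟨(h1 t₀ (right_mem_Icc.2 hα.le)).mono_of_mem_nhdsWithin (Icc_mem_nhdsLE hα),
    (h2 t₀ (left_mem_Icc.2 hβ.le)).mono_of_mem_nhdsWithin (Icc_mem_nhdsGE hβ)⟩

/-- A geodesic of unit speed near the time `t₀`, in the chart at `x₀`. -/
def IsChartGeodesicAt (F : TangentBundle (𝓡 n) M → ℝ) (x₀ : M) (c v : ℝ → Coord n) (t₀ : ℝ) :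
    Prop :=
  ∀ᶠ t in 𝓝 t₀, c t ∈ (extChartAt (𝓡 n) x₀).target ∧ v t ≠ 0 ∧ HasDerivAt c (v t) t ∧
    HasDerivAt v (accel (localRep F x₀) (c t, v t)) t ∧ localRep F x₀ (c t, v t) = 1

/-- Near an interior time there are only two smooth pieces. Minimality makes each a solution of the
geodesic equation with matching velocities, and such halves form one solution; in particular the
break was only apparent. -/
theorem IsLocallyShortestOn.isChartGeodesicAt (hF : IsFinslerMetric F) {γ : ℝ → M} {a b : ℝ}
    (h : IsLocallyShortestOn F γ a b) {t₀ : ℝ} (ht₀ : t₀ ∈ Ioo a b) {x₀ : M}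
    (hx₀ : γ t₀ ∈ (extChartAt (𝓡 n) x₀).source) :
    ContinuousAt γ t₀ ∧ ∃ v, IsChartGeodesicAt F x₀ (fun t => extChartAt (𝓡 n) x₀ (γ t)) v t₀ := by
  have hΦ := hF.isLocalFinsler x₀
  obtain ⟨δ₁, hδ₁, ha₁, hb₁, hL, hR⟩ := h.1.exists_pieces ht₀
  obtain ⟨ε, hε, hsh⟩ := h.2 t₀ (Ioo_subset_Icc_self ht₀)
  have hγc : ContinuousAt γ t₀ := continuousAt_of_continuousOn_Icc (by linarith) (by linarith)
    hL.smooth.continuousOn hR.smooth.continuousOn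
  refine ⟨hγc, ?_⟩
  obtain ⟨δ₂, hδ₂, hsrc⟩ := Metric.mem_nhds_iff.1
    (hγc.preimage_mem_nhds ((isOpen_extChartAt_source x₀).mem_nhds hx₀))
  obtain ⟨δ, hδ, hd₁, hd₂, hd₃⟩ : ∃ δ > 0, δ ≤ δ₁ ∧ δ < δ₂ ∧ δ < ε := by
    refine ⟨min δ₁ (min (δ₂ / 2) (ε / 2)), by positivity, min_le_left _ _, ?_, ?_⟩
    · have := (min_le_right δ₁ (min (δ₂ / 2) (ε / 2))).trans (min_le_left _ _)
      linarith
    · have := (min_le_right δ₁ (min (δ₂ / 2) (ε / 2))).trans (min_le_right _ _)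
      linarith
  set α := t₀ - δ with hα
  set β := t₀ + δ with hβ
  have hαt : α < t₀ := by linarith
  have hβt : t₀ < β := by linarith
  have hin : ∀ t ∈ Icc α β, γ t ∈ (extChartAt (𝓡 n) x₀).source := fun t ht =>
    hsrc (by
      rw [Metric.mem_ball, Real.dist_eq, abs_lt]
      exact ⟨by linarith [ht.1], by linarith [ht.2]⟩)
  set c : ℝ → Coord n := fun t => extChartAt (𝓡 n) x₀ (γ t) with hc
  obtain ⟨rL, uL⟩ := (hL.mono (c := α) (by linarith) le_rfl).chart hF hαt
    fun t ht => hin t ⟨ht.1, ht.2.trans hβt.le⟩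
  obtain ⟨rR, uR⟩ := (hR.mono (d := β) le_rfl (by linarith)).chart hF hβt
    fun t ht => hin t ⟨hαt.le.trans ht.1, ht.2⟩
  have hshort : IsShortestOn F γ α β := hsh α ⟨by linarith, by linarith⟩ β
    ⟨by linarith, by linarith⟩ (by rw [abs_lt]; constructor <;> linarith)
    (by rw [abs_lt]; constructor <;> linarith) (by linarith)
  -- A competitor in the chart is parametrized by arc length and carried to the manifold. It becomes
  -- a unit-speed path whose duration is its length, so minimal time implies minimal length.
  obtain ⟨e₀, eL, eR⟩ := hΦ.geodesic_of_minimal hαt hβt rL rR uL uR (by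
    intro dL dR hdL hdR eα et eβ
    obtain ⟨pL, sL, pL0, pL1, pLm, pLu⟩ := hΦ.exists_unit_speed hαt hdL
    obtain ⟨pR, sR, pR0, pR1, pRm, pRu⟩ := hΦ.exists_unit_speed hβt hdR
    obtain ⟨σ, hσ, σ0, σ1⟩ := (isUnitPiece_of_chart sL pLm pLu).isUnitPath.trans
      (hΦ.pathLen_pos hαt hdL).le (hΦ.pathLen_pos hβt hdR).le
      (isUnitPiece_of_chart sR pRm pRu).isUnitPath (by rw [pL1, pR0, et])
    have := hshort.2 σ _ _ (by
        linarith [hΦ.pathLen_pos hαt hdL, hΦ.pathLen_pos hβt hdR]) hσ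
      (by rw [σ0, pL0, eα]; exact (extChartAt (𝓡 n) x₀).left_inv (hin α ⟨le_rfl, by linarith⟩))
      (by rw [σ1, pR1, eβ]; exact (extChartAt (𝓡 n) x₀).left_inv (hin β ⟨by linarith, le_rfl⟩))
    linarith)
  set vL := derivWithin c (Icc α t₀) with hvL
  set vR := derivWithin c (Icc t₀ β) with hvR
  set v : ℝ → Coord n := fun t => if t ≤ t₀ then vL t else vR t with hv
  have vl : ∀ t, t ≤ t₀ → v t = vL t := fun t ht => if_pos ht
  have vr : ∀ t, t₀ ≤ t → v t = vR t := by
    intro t ht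
    rcases ht.eq_or_lt with rfl | hlt
    · rw [vl _ le_rfl, e₀]
    · exact if_neg (not_le.2 hlt)
  have hl : ∀ t ∈ Ioo α t₀, v =ᶠ[𝓝 t] vL := fun t ht => by
    filter_upwards [Iio_mem_nhds ht.2] with s hs using vl s (le_of_lt hs)
  have hr : ∀ t ∈ Ioo t₀ β, v =ᶠ[𝓝 t] vR := fun t ht => by
    filter_upwards [Ioi_mem_nhds ht.1] with s hs using vr s (le_of_lt hs)
  have hcv : ContinuousAt v t₀ := continuousAt_of_continuousOn_Icc hαt hβt
    ((contDiffOn_derivWithin_Icc hαt rL.contDiffOn).continuousOn.congr fun t ht => vl t ht.2)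
    ((contDiffOn_derivWithin_Icc hβt rR.contDiffOn).continuousOn.congr fun t ht => vr t ht.1)
  have hcc : ContinuousAt c t₀ := continuousAt_of_continuousOn_Icc hαt hβt
    rL.contDiffOn.continuousOn rR.contDiffOn.continuousOn
  have hstat : ∀ t ∈ Ioo α β, c t ∈ (extChartAt (𝓡 n) x₀).target ∧ v t ≠ 0 ∧
      localRep F x₀ (c t, v t) = 1 := by
    intro t ht
    rcases le_total t t₀ with h | h
    · rw [vl t h]
      exact ⟨rL.mem t ⟨ht.1.le, h⟩, rL.ne_zero t ⟨ht.1.le, h⟩, uL t ⟨ht.1.le, h⟩⟩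
    · rw [vr t h]
      exact ⟨rR.mem t ⟨h, ht.2.le⟩, rR.ne_zero t ⟨h, ht.2.le⟩, uR t ⟨h, ht.2.le⟩⟩
  have hode : ∀ t ∈ Ioo α β, t ≠ t₀ → HasDerivAt c (v t) t ∧
      HasDerivAt v (accel (localRep F x₀) (c t, v t)) t := by
    intro t ht hne
    rcases lt_or_gt_of_ne hne with h | h
    · refine ⟨?_, HasDerivAt.congr_of_eventuallyEq ?_ (hl t ⟨ht.1, h⟩)⟩
      · rw [vl t h.le]; exact hasDerivAt_derivWithin_Icc rL.contDiffOn ⟨ht.1, h⟩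
      · rw [vl t h.le]; exact eL t ⟨ht.1, h⟩
    · refine ⟨?_, HasDerivAt.congr_of_eventuallyEq ?_ (hr t ⟨h, ht.2⟩)⟩
      · rw [vr t h.le]; exact hasDerivAt_derivWithin_Icc rR.contDiffOn ⟨h, ht.2⟩
      · rw [vr t h.le]; exact eR t ⟨h, ht.2⟩
  have ht₀' : t₀ ∈ Ioo α β := ⟨hαt, hβt⟩
  have hev : ∀ᶠ t in 𝓝[≠] t₀, t ∈ Ioo α β ∧ t ≠ t₀ :=
    (eventually_nhdsWithin_of_eventually_nhds (Ioo_mem_nhds hαt hβt)).and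
      eventually_mem_nhdsWithin
  obtain ⟨g1, g2⟩ := hΦ.hasDerivAt_accel_of_ne (hstat t₀ ht₀').1 (hstat t₀ ht₀').2.1 hcc hcv
    (hev.mono fun t ht => (hode t ht.1 ht.2).1) (hev.mono fun t ht => (hode t ht.1 ht.2).2)
  refine ⟨v, ?_⟩
  filter_upwards [Ioo_mem_nhds hαt hβt] with t ht
  obtain ⟨s1, s2, s3⟩ := hstat t ht
  by_cases hne : t = t₀
  · subst hne
    exact ⟨s1, s2, g1, g2, s3⟩
  · exact ⟨s1, s2, (hode t ht hne).1, (hode t ht hne).2, s3⟩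

theorem IsChartGeodesicAt.contDiffAt (hF : IsFinslerMetric F) {x₀ : M} {c v : ℝ → Coord n}
    {t₀ : ℝ} (h : IsChartGeodesicAt F x₀ c v t₀) : ContDiffAt ℝ ∞ (fun t => (c t, v t)) t₀ := by
  obtain ⟨I, hI, hIo, ht⟩ := eventually_nhds_iff.1 h
  exact (contDiffOn_of_hasDerivAt_snd (hF.isLocalFinsler x₀).contDiffOn_accel hIo
    (fun t ht => (hI t ht).2.2.1) (fun t ht => (hI t ht).2.2.2.1)
    fun t ht => ⟨(hI t ht).1, (hI t ht).2.1⟩).contDiffAt (hIo.mem_nhds ht)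

theorem contMDiffAt_of_chart {x₀ : M} {γ : ℝ → M} {t : ℝ} (hγ : ContinuousAt γ t)
    (hs : γ t ∈ (extChartAt (𝓡 n) x₀).source)
    (h : ContDiffAt ℝ ∞ (fun s => extChartAt (𝓡 n) x₀ (γ s)) t) :
    ContMDiffAt 𝓘(ℝ, ℝ) (𝓡 n) ∞ γ t := by
  have e : γ =ᶠ[𝓝 t] (extChartAt (𝓡 n) x₀).symm ∘ fun s => extChartAt (𝓡 n) x₀ (γ s) := by
    filter_upwards [hγ.eventually ((isOpen_extChartAt_source x₀).mem_nhds hs)] with s hs'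
    exact ((extChartAt (𝓡 n) x₀).left_inv hs').symm
  refine ContMDiffAt.congr_of_eventuallyEq ?_ e
  refine ContMDiffAt.comp t ?_ h.contMDiffAt
  exact (contMDiffOn_extChartAt_symm (n := ∞) x₀).contMDiffAt
    ((isOpen_extChartAt_target x₀).mem_nhds ((extChartAt (𝓡 n) x₀).map_source hs))

theorem IsLocallyShortestOn.isGeodesicOn (hF : IsFinslerMetric F) {γ : ℝ → M} {a b : ℝ}
    (hab : a < b) (h : IsLocallyShortestOn F γ a b) :
    IsGeodesicOn F γ a b ∧ ∀ t ∈ Ioo a b, F ⟨γ t, velocity γ t⟩ = 1 := by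
  have hsm : ∀ t ∈ Ioo a b, ContMDiffAt 𝓘(ℝ, ℝ) (𝓡 n) ∞ γ t := by
    intro t ht
    obtain ⟨hc, v, hv⟩ := h.isChartGeodesicAt hF ht (mem_extChartAt_source (I := 𝓡 n) (γ t))
    exact contMDiffAt_of_chart hc (mem_extChartAt_source (I := 𝓡 n) (γ t))
      (contDiffAt_fst.comp t (hv.contDiffAt hF))
  have hone : ∀ t ∈ Ioo a b, F ⟨γ t, velocity γ t⟩ = 1 := by
    intro t ht
    have hs := mem_extChartAt_source (I := 𝓡 n) (γ t)
    obtain ⟨hc, v, hv⟩ := h.isChartGeodesicAt hF ht hs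
    have hv0 := hv.self_of_nhds
    rw [apply_velocity_eq_localRep F (γ t) hc hs hv0.2.2.1]
    exact hv0.2.2.2.2
  refine ⟨⟨fun t ht => ?_, fun t ht h0 => ?_, fun x₀ t ht hs i => ?_⟩, hone⟩
  -- At an end point of the interval smoothness is that of the adjacent smooth piece; at interior
  -- times it comes from the geodesic equation.
  · rcases ht.1.eq_or_lt with rfl | hat
    · obtain ⟨d, hd, hp⟩ := h.1.exists_piece_left hab
      exact (hp.smooth a (left_mem_Icc.2 hd.1.le)).mono_of_mem_nhdsWithin
        (mem_of_superset (Icc_mem_nhdsGE hd.1) le_rfl |> nhdsWithin_mono a Icc_subset_Ici_self)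
    · rcases ht.2.eq_or_lt with rfl | htb
      · obtain ⟨d, hd, hp⟩ := h.1.exists_piece_right hab
        exact (hp.smooth t (right_mem_Icc.2 hd.2.le)).mono_of_mem_nhdsWithin
          (nhdsWithin_mono t Icc_subset_Iic_self (Icc_mem_nhdsLE hd.2))
      · exact (hsm t ⟨hat, htb⟩).contMDiffWithinAt
  · have := hone t ht
    rw [h0, hF.map_zero] at this
    exact zero_ne_one this
  · obtain ⟨hc, v, hv⟩ := h.isChartGeodesicAt hF ht hs
    have hd : deriv (fun s => extChartAt (𝓡 n) x₀ (γ s)) =ᶠ[𝓝 t] v := by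
      filter_upwards [hv] with s hs using hs.2.2.1.deriv
    obtain ⟨k1, k2, k3, k4, k5⟩ := hv.self_of_nhds
    rw [hd.deriv_eq, k4.deriv, hd.self_of_nhds, hF.two_mul_spray k1 k2]
    ring

end ShortestIsGeodesic

/-! ### Geodesics are locally shortest. -/

section GeodesicIsLocallyShortest

variable {n : ℕ} {M : Type*} [TopologicalSpace M] [ChartedSpace (EuclideanSpace ℝ (Fin n)) M]
  [IsManifold (𝓡 n) ∞ M] {F : TangentBundle (𝓡 n) M → ℝ}

/-- Estimates that are additive over adjacent intervals need to be proved only between breaks. The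
induction removes one break at a time by splitting the interval there. -/
theorem rel_of_rel_off_finset {R : ℝ → ℝ → Prop} (hrefl : ∀ a, R a a)
    (htrans : ∀ a b c, R a b → R b c → R a c) (P : Finset ℝ) {a b : ℝ} (hab : a ≤ b)
    (h : ∀ c d, a ≤ c → c < d → d ≤ b → (∀ t ∈ P, t ∉ Ioo c d) → R c d) : R a b := by
  induction P using Finset.induction_on generalizing a b with
  | empty =>
    rcases hab.eq_or_lt with rfl | hlt
    · exact hrefl a
    · exact h a b le_rfl hlt le_rfl (by simp)
  | insert x P _ ih =>
    by_cases hx : x ∈ Ioo a b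
    · refine htrans a x b (ih hx.1.le fun c d hc hcd hd ht => ?_)
        (ih hx.2.le fun c d hc hcd hd ht => ?_)
      · refine h c d hc hcd (hd.trans hx.2.le) fun t htP => ?_
        rcases Finset.mem_insert.1 htP with rfl | htP
        · exact fun hI => absurd hI.2 (not_lt.2 hd)
        · exact ht t htP
      · refine h c d (hx.1.le.trans hc) hcd hd fun t htP => ?_
        rcases Finset.mem_insert.1 htP with rfl | htP
        · exact fun hI => absurd hI.1 (not_lt.2 hc)
        · exact ht t htP
    · refine ih hab fun c d hc hcd hd ht => h c d hc hcd hd fun t htP => ?_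
      rcases Finset.mem_insert.1 htP with rfl | htP
      · exact fun hI => hx ⟨hc.trans_lt hI.1, hI.2.trans_le hd⟩
      · exact ht t htP

theorem IsUnitPath.continuousOn {γ : ℝ → M} {a b : ℝ} (h : IsUnitPath F γ a b) :
    ContinuousOn γ (Icc a b) := by
  intro t ht
  rcases ht.1.eq_or_lt with rfl | hat
  · rcases ht.2.eq_or_lt with rfl | hab
    · rw [Icc_self]; exact continuousWithinAt_singleton
    · obtain ⟨d, hd, hp⟩ := h.exists_piece_left hab
      exact (hp.smooth.continuousOn a (left_mem_Icc.2 hd.1.le)).mono_of_mem_nhdsWithin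
        (nhdsWithin_mono a Icc_subset_Ici_self (Icc_mem_nhdsGE hd.1))
  · rcases ht.2.eq_or_lt with rfl | htb
    · obtain ⟨d, hd, hp⟩ := h.exists_piece_right hat
      exact (hp.smooth.continuousOn t (right_mem_Icc.2 hd.2.le)).mono_of_mem_nhdsWithin
        (nhdsWithin_mono t Icc_subset_Iic_self (Icc_mem_nhdsLE hd.2))
    · obtain ⟨δ, hδ, -, -, hL, hR⟩ := h.exists_pieces ⟨hat, htb⟩
      exact (continuousAt_of_continuousOn_Icc (by linarith) (by linarith) hL.smooth.continuousOn
        hR.smooth.continuousOn).continuousWithinAt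

/-- Along a unit speed path inside a chart, a function whose derivative is controlled by the unit
balls of the metric grows at most like the time. -/
theorem IsUnitPath.norm_sub_le (hF : IsFinslerMetric F) {σ : ℝ → M} {e f : ℝ} (hef : e ≤ f)
    (hσ : IsUnitPath F σ e f) {x₀ : M} (hs : ∀ t ∈ Icc e f, σ t ∈ (extChartAt (𝓡 n) x₀).source)
    {m : ℝ} (hm : ∀ t ∈ Icc e f, ∀ y, m * ‖y‖ ≤ localRep F x₀ (extChartAt (𝓡 n) x₀ (σ t), y)) :
    m * ‖extChartAt (𝓡 n) x₀ (σ f) - extChartAt (𝓡 n) x₀ (σ e)‖ ≤ f - e := by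
  rcases le_or_gt m 0 with hm0 | hm0
  · exact (mul_nonpos_of_nonpos_of_nonneg hm0 (norm_nonneg _)).trans (by linarith)
  obtain ⟨P, hP⟩ := hσ
  set c : ℝ → Coord n := fun t => extChartAt (𝓡 n) x₀ (σ t) with hc
  refine rel_of_rel_off_finset (R := fun e f => m * ‖c f - c e‖ ≤ f - e) (by simp) ?_ P hef ?_
  · intro r s t h1 h2
    have h3 : ‖c t - c r‖ ≤ ‖c t - c s‖ + ‖c s - c r‖ := norm_sub_le_norm_sub_add_norm_sub _ _ _
    nlinarith
  · intro r s hr hrs hs' ht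
    obtain ⟨hreg, h1⟩ := (hP r s hr hrs hs' ht).chart hF hrs
      fun t ht => hs t ⟨hr.trans ht.1, ht.2.trans hs'⟩
    have h2 := norm_image_sub_le_of_norm_deriv_le_segment' (C := m⁻¹)
      (fun t ht => hasDerivWithinAt_Icc hreg.contDiffOn ht) (fun t ht => by
        have h3 := hm t ⟨hr.trans ht.1, ht.2.le.trans hs'⟩ (derivWithin c (Icc r s) t)
        rw [h1 t (Ico_subset_Icc_self ht)] at h3
        rw [← one_div, le_div_iff₀ hm0, mul_comm]
        exact h3) s (right_mem_Icc.2 hrs.le)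
    calc m * ‖c s - c r‖ ≤ m * (m⁻¹ * (s - r)) := by gcongr
      _ = s - r := by field_simp

/-- The calibration inequality: along a unit-speed path the derivative of S is dS(σ') ≤ F(σ') = 1.
-/
theorem IsUnitPath.sub_le (hF : IsFinslerMetric F) {σ : ℝ → M} {e f : ℝ} (hef : e ≤ f)
    (hσ : IsUnitPath F σ e f) {x₀ : M} (hs : ∀ t ∈ Icc e f, σ t ∈ (extChartAt (𝓡 n) x₀).source)
    {S : Coord n → ℝ} (hS : ∀ t ∈ Icc e f, ∃ S' : Coord n →L[ℝ] ℝ,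
      HasFDerivAt S S' (extChartAt (𝓡 n) x₀ (σ t)) ∧
      ∀ y, S' y ≤ localRep F x₀ (extChartAt (𝓡 n) x₀ (σ t), y)) :
    S (extChartAt (𝓡 n) x₀ (σ f)) - S (extChartAt (𝓡 n) x₀ (σ e)) ≤ f - e := by
  obtain ⟨P, hP⟩ := hσ
  set c : ℝ → Coord n := fun t => extChartAt (𝓡 n) x₀ (σ t) with hc
  refine rel_of_rel_off_finset (R := fun e f => S (c f) - S (c e) ≤ f - e) (by simp)
    (fun _ _ _ _ _ => by linarith) P hef ?_
  intro r s hr hrs hs' ht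
  have hI : Icc r s ⊆ Icc e f := Icc_subset_Icc hr hs'
  obtain ⟨hreg, h1⟩ := (hP r s hr hrs hs' ht).chart hF hrs fun t ht => hs t (hI ht)
  have hcont : ContinuousOn (fun t => S (c t)) (Icc r s) := fun t ht => by
    obtain ⟨S', hS', -⟩ := hS t (hI ht)
    have hc' : ContinuousWithinAt c (Icc r s) t := hreg.contDiffOn.continuousOn t ht
    exact ContinuousAt.comp_continuousWithinAt (f := c) hS'.continuousAt hc'
  have hder : ∀ t ∈ Ioo r s, ∃ q ≤ (1 : ℝ), HasDerivAt (fun t => S (c t)) q t := fun t ht => by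
    have ht' := Ioo_subset_Icc_self ht
    obtain ⟨S', hS', hle⟩ := hS t (hI ht')
    exact ⟨_, (hle _).trans (h1 t ht').le,
      hS'.comp_hasDerivAt t (hasDerivAt_derivWithin_Icc hreg.contDiffOn ht)⟩
  have := (convex_Icc r s).image_sub_le_mul_sub_of_deriv_le hcont (C := 1)
    (fun t ht => by
      rw [interior_Icc] at ht
      obtain ⟨q, -, hq⟩ := hder t ht
      exact hq.differentiableAt.differentiableWithinAt)
    (fun t ht => by
      rw [interior_Icc] at ht
      obtain ⟨q, hq1, hq⟩ := hder t ht
      rw [hq.deriv]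
      exact hq1) r (left_mem_Icc.2 hrs.le) s (right_mem_Icc.2 hrs.le) hrs.le
  linarith

/-- Two halves of a geodesic fit together. -/
theorem IsFinslerMetric.isChartGeodesicAt_of_halves (hF : IsFinslerMetric F) {x₀ : M}
    {c₁ v₁ c₂ v₂ : ℝ → Coord n} {t₀ : ℝ}
    (hc : c₁ t₀ = c₂ t₀) (hv : v₁ t₀ = v₂ t₀)
    (hx : c₁ t₀ ∈ (extChartAt (𝓡 n) x₀).target) (hv0 : v₁ t₀ ≠ 0)
    (hone : localRep F x₀ (c₁ t₀, v₁ t₀) = 1)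
    (k₁ : ContinuousWithinAt (fun t => (c₁ t, v₁ t)) (Iic t₀) t₀)
    (k₂ : ContinuousWithinAt (fun t => (c₂ t, v₂ t)) (Ici t₀) t₀)
    (h₁ : ∀ᶠ t in 𝓝[<] t₀, HasDerivAt c₁ (v₁ t) t ∧
      HasDerivAt v₁ (accel (localRep F x₀) (c₁ t, v₁ t)) t)
    (h₂ : ∀ᶠ t in 𝓝[>] t₀, HasDerivAt c₂ (v₂ t) t ∧
      HasDerivAt v₂ (accel (localRep F x₀) (c₂ t, v₂ t)) t) :
    IsChartGeodesicAt F x₀ (fun t => if t ≤ t₀ then c₁ t else c₂ t)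
      (fun t => if t ≤ t₀ then v₁ t else v₂ t) t₀ := by
  have hΦ := hF.isLocalFinsler x₀
  set c : ℝ → Coord n := fun t => if t ≤ t₀ then c₁ t else c₂ t with hcdef
  set v : ℝ → Coord n := fun t => if t ≤ t₀ then v₁ t else v₂ t with hvdef
  have cl : ∀ t, t ≤ t₀ → c t = c₁ t := fun t ht => if_pos ht
  have vl : ∀ t, t ≤ t₀ → v t = v₁ t := fun t ht => if_pos ht
  have cr : ∀ t, t₀ ≤ t → c t = c₂ t := by
    intro t ht
    rcases ht.eq_or_lt with rfl | hlt
    · rw [cl _ le_rfl, hc]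
    · exact if_neg (not_le.2 hlt)
  have vr : ∀ t, t₀ ≤ t → v t = v₂ t := by
    intro t ht
    rcases ht.eq_or_lt with rfl | hlt
    · rw [vl _ le_rfl, hv]
    · exact if_neg (not_le.2 hlt)
  have hcont : ContinuousAt (fun t => (c t, v t)) t₀ := by
    rw [continuousAt_iff_continuous_left_right]
    exact ⟨k₁.congr (fun t ht => by rw [cl t ht, vl t ht]) (by rw [cl _ le_rfl, vl _ le_rfl]),
      k₂.congr (fun t ht => by rw [cr t ht, vr t ht]) (by rw [cr _ le_rfl, vr _ le_rfl])⟩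
  have hcc : ContinuousAt c t₀ := continuousAt_fst.comp hcont
  have hcv : ContinuousAt v t₀ := continuousAt_snd.comp hcont
  have hode : ∀ᶠ t in 𝓝[≠] t₀, HasDerivAt c (v t) t ∧
      HasDerivAt v (accel (localRep F x₀) (c t, v t)) t := by
    rw [← Iio_union_Ioi, nhdsWithin_union, eventually_sup]
    constructor
    · filter_upwards [h₁, eventually_mem_nhdsWithin] with t ht hlt
      rw [cl t (le_of_lt hlt), vl t (le_of_lt hlt)]
      exact ⟨ht.1.congr_of_eventuallyEq (by
          filter_upwards [Iio_mem_nhds hlt] with s hs using cl s (le_of_lt hs)),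
        ht.2.congr_of_eventuallyEq (by
          filter_upwards [Iio_mem_nhds hlt] with s hs using vl s (le_of_lt hs))⟩
    · filter_upwards [h₂, eventually_mem_nhdsWithin] with t ht hlt
      rw [cr t (le_of_lt hlt), vr t (le_of_lt hlt)]
      exact ⟨ht.1.congr_of_eventuallyEq (by
          filter_upwards [Ioi_mem_nhds hlt] with s hs using cr s (le_of_lt hs)),
        ht.2.congr_of_eventuallyEq (by
          filter_upwards [Ioi_mem_nhds hlt] with s hs using vr s (le_of_lt hs))⟩
  have hx' : c t₀ ∈ (extChartAt (𝓡 n) x₀).target := by rwa [cl _ le_rfl]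
  have hv' : v t₀ ≠ 0 := by rwa [vl _ le_rfl]
  have hg := hΦ.hasDerivAt_accel_of_ne hx' hv' hcc hcv (hode.mono fun t ht => ht.1)
    (hode.mono fun t ht => ht.2)
  have hall : ∀ᶠ t in 𝓝 t₀, HasDerivAt c (v t) t ∧
      HasDerivAt v (accel (localRep F x₀) (c t, v t)) t := by
    rw [eventually_nhdsWithin_iff] at hode
    filter_upwards [hode] with t ht
    by_cases hne : t = t₀
    · rw [hne]; exact hg
    · exact ht hne
  have hall2 : ∀ᶠ t in 𝓝 t₀, (HasDerivAt c (v t) t ∧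
      HasDerivAt v (accel (localRep F x₀) (c t, v t)) t) ∧
      c t ∈ (extChartAt (𝓡 n) x₀).target ∧ v t ≠ 0 :=
    hall.and ((hcc.eventually ((isOpen_extChartAt_target x₀).mem_nhds hx')).and
      (hcv.eventually (isOpen_ne.mem_nhds hv')))
  obtain ⟨δ, hδ, hball⟩ := Metric.eventually_nhds_iff_ball.1 hall2
  -- Unit speed is known only at the time of gluing; conservation of energy spreads it to the
  -- neighbourhood.
  have hen : ∀ t ∈ Metric.ball t₀ δ, HasDerivAt (fun s => localRep F x₀ (c s, v s) ^ 2) 0 t :=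
    fun t ht => by
      obtain ⟨⟨d1, d2⟩, hxt, hvt⟩ := hball t ht
      exact hΦ.energy_deriv hxt hvt d1 d2 ((hΦ.eulerLagrange_iff hxt hvt _).2 rfl)
  filter_upwards [Metric.ball_mem_nhds t₀ hδ] with t ht
  obtain ⟨⟨d1, d2⟩, hxt, hvt⟩ := hball t ht
  refine ⟨hxt, hvt, d1, d2, ?_⟩
  have h1 := Metric.isOpen_ball.is_const_of_deriv_eq_zero (convex_ball t₀ δ).isPreconnected
    (fun s hs => (hen s hs).differentiableAt.differentiableWithinAt)
    (fun s hs => (hen s hs).deriv) ht (Metric.mem_ball_self hδ)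
  have h2 : localRep F x₀ (c t₀, v t₀) = 1 := by rw [cl _ le_rfl, vl _ le_rfl, hone]
  simp only [h2, one_pow] at h1
  have h3 := hΦ.pos _ hxt _ hvt
  nlinarith

theorem IsFinslerMetric.exists_geodesic (hF : IsFinslerMetric F) {x₀ : M} {x v : Coord n}
    (hx : x ∈ (extChartAt (𝓡 n) x₀).target) (hv : v ≠ 0) (t₀ : ℝ) :
    ∃ c w : ℝ → Coord n, c t₀ = x ∧ w t₀ = v ∧ ∀ᶠ t in 𝓝 t₀, HasDerivAt c (w t) t ∧
      HasDerivAt w (accel (localRep F x₀) (c t, w t)) t := by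
  have hΦ := hF.isLocalFinsler x₀
  have hV : ContDiffAt ℝ 1 (fun z : Coord n × Coord n => (z.2, accel (localRep F x₀) z)) (x, v) :=
    contDiffAt_snd.prodMk ((hΦ.contDiffOn_accel.contDiffAt (hΦ.mem_nhds hx hv)).of_le (by simp))
  obtain ⟨p, hp0, ε, hε, hp⟩ :=
    hV.exists_forall_mem_closedBall_exists_eq_forall_mem_Ioo_hasDerivAt₀ t₀
  refine ⟨fun t => (p t).1, fun t => (p t).2, congrArg Prod.fst hp0, congrArg Prod.snd hp0, ?_⟩
  filter_upwards [Ioo_mem_nhds (by linarith : t₀ - ε < t₀) (by linarith : t₀ < t₀ + ε)] with t ht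
  exact ⟨(hasFDerivAt_fst (p := p t)).comp_hasDerivAt t (hp t ht),
    (hasFDerivAt_snd (p := p t)).comp_hasDerivAt t (hp t ht)⟩

/-- A geodesic solves the geodesic equation in a chart, up to the end points. -/
theorem IsGeodesicOn.chart (hF : IsFinslerMetric F) {γ : ℝ → M} {a b : ℝ}
    (h : IsGeodesicOn F γ a b) (h1 : ∀ t ∈ Ioo a b, F ⟨γ t, velocity γ t⟩ = 1) {x₀ : M}
    {α β : ℝ} (ha : a ≤ α) (hαβ : α < β) (hb : β ≤ b)
    (hs : ∀ t ∈ Icc α β, γ t ∈ (extChartAt (𝓡 n) x₀).source) :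
    ∃ v : ℝ → Coord n,
      ContinuousOn (fun t => (extChartAt (𝓡 n) x₀ (γ t), v t)) (Icc α β) ∧
      (∀ t ∈ Icc α β, v t ≠ 0 ∧ localRep F x₀ (extChartAt (𝓡 n) x₀ (γ t), v t) = 1) ∧
      ∀ t ∈ Ioo α β, HasDerivAt (fun t => extChartAt (𝓡 n) x₀ (γ t)) (v t) t ∧
        HasDerivAt v (accel (localRep F x₀) (extChartAt (𝓡 n) x₀ (γ t), v t)) t := by
  have hp : IsUnitPiece F γ a b := ⟨h.smooth, h1⟩
  obtain ⟨hreg, hu⟩ := (hp.mono ha hb).chart hF hαβ hs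
  set c : ℝ → Coord n := fun t => extChartAt (𝓡 n) x₀ (γ t) with hc
  refine ⟨derivWithin c (Icc α β), (hreg.contDiffOn_lift hαβ).continuousOn,
    fun t ht => ⟨hreg.ne_zero t ht, hu t ht⟩, fun t ht => ?_⟩
  have ht' := Ioo_subset_Icc_self ht
  have hd : deriv c =ᶠ[𝓝 t] derivWithin c (Icc α β) := by
    filter_upwards [Ioo_mem_nhds ht.1 ht.2] with s hs
    exact (hasDerivAt_derivWithin_Icc hreg.contDiffOn hs).deriv
  refine ⟨hasDerivAt_derivWithin_Icc hreg.contDiffOn ht, ?_⟩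
  have h2 := hasDerivAt_derivWithin_Icc (contDiffOn_derivWithin_Icc hαβ hreg.contDiffOn) ht
  have h3 : deriv (deriv c) t = accel (localRep F x₀) (c t, derivWithin c (Icc α β) t) := by
    ext i
    have h4 := h.ode x₀ t ⟨ha.trans_lt ht.1, ht.2.trans_le hb⟩ (hs t ht') i
    rw [show deriv (fun s => extChartAt (𝓡 n) x₀ (γ s)) = deriv c from rfl, hd.self_of_nhds,
      hF.two_mul_spray (hreg.mem t ht') (hreg.ne_zero t ht')] at h4
    linarith
  rw [← h3, hd.deriv_eq, h2.deriv]
  exact h2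

/-- The calibration needs a geodesic on both sides of the base time. At an end point of [a, b] the
missing half is supplied by the solution of the geodesic equation with the same position and
one-sided velocity. -/
theorem IsGeodesicOn.exists_isChartGeodesicAt (hF : IsFinslerMetric F) {γ : ℝ → M} {a b : ℝ}
    (hab : a < b) (h : IsGeodesicOn F γ a b) (h1 : ∀ t ∈ Ioo a b, F ⟨γ t, velocity γ t⟩ = 1)
    {t₀ : ℝ} (ht₀ : t₀ ∈ Icc a b) : ∃ c v : ℝ → Coord n, IsChartGeodesicAt F (γ t₀) c v t₀ ∧
      ∀ᶠ t in 𝓝 t₀, t ∈ Icc a b → c t = extChartAt (𝓡 n) (γ t₀) (γ t) := by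
  have hΦ := hF.isLocalFinsler (γ t₀)
  set x₀ := γ t₀ with hx₀
  have hsrc : ∀ᶠ t in 𝓝[Icc a b] t₀, γ t ∈ (extChartAt (𝓡 n) x₀).source :=
    (h.smooth.continuousOn t₀ ht₀).eventually
      ((isOpen_extChartAt_source x₀).mem_nhds (mem_extChartAt_source (I := 𝓡 n) x₀))
  obtain ⟨δ, hδ, hball⟩ := Metric.eventually_nhds_iff_ball.1 (eventually_nhdsWithin_iff.1 hsrc)
  set φγ : ℝ → Coord n := fun t => extChartAt (𝓡 n) x₀ (γ t) with hφγ
  obtain ⟨α, β, hα, hβ, hαβ, htα, htβ, hsub, hαδ, hβδ⟩ : ∃ α β, a ≤ α ∧ β ≤ b ∧ α < β ∧ α ≤ t₀ ∧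
      t₀ ≤ β ∧ (∀ t ∈ Icc α β, γ t ∈ (extChartAt (𝓡 n) x₀).source) ∧
      (a < t₀ → α < t₀) ∧ (t₀ < b → t₀ < β) := by
    refine ⟨max a (t₀ - δ / 2), min b (t₀ + δ / 2), le_max_left _ _, min_le_left _ _, ?_,
      max_le ht₀.1 (by linarith), le_min ht₀.2 (by linarith), fun t ht => ?_, fun hlt => ?_,
      fun hlt => ?_⟩
    · rw [max_lt_iff, lt_min_iff, lt_min_iff]
      exact ⟨⟨hab, by linarith [ht₀.1]⟩, by linarith [ht₀.2], by linarith⟩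
    · have h2 := (le_max_left _ _).trans ht.1
      have h3 := (le_max_right _ _).trans ht.1
      have h4 := ht.2.trans (min_le_left _ _)
      have h5 := ht.2.trans (min_le_right _ _)
      refine hball t ?_ ⟨h2, h4⟩
      rw [Metric.mem_ball, Real.dist_eq, abs_lt]
      constructor <;> linarith
    · exact max_lt hlt (by linarith)
    · exact lt_min hlt (by linarith)
  obtain ⟨v, hcont, hv, hode⟩ := h.chart hF h1 hα hαβ hβ hsub
  have htαβ : t₀ ∈ Icc α β := ⟨htα, htβ⟩
  have hx : φγ t₀ ∈ (extChartAt (𝓡 n) x₀).target :=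
    (extChartAt (𝓡 n) x₀).map_source (hsub t₀ htαβ)
  obtain ⟨q, w, q0, w0, hq⟩ := hF.exists_geodesic hx (hv t₀ htαβ).1 t₀
  have hqc : ContinuousAt (fun t => (q t, w t)) t₀ :=
    hq.self_of_nhds.1.continuousAt.prodMk hq.self_of_nhds.2.continuousAt
  have left : ∃ c₁ v₁ : ℝ → Coord n, c₁ t₀ = φγ t₀ ∧ v₁ t₀ = v t₀ ∧
      ContinuousWithinAt (fun t => (c₁ t, v₁ t)) (Iic t₀) t₀ ∧
      (∀ᶠ t in 𝓝[<] t₀, HasDerivAt c₁ (v₁ t) t ∧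
        HasDerivAt v₁ (accel (localRep F x₀) (c₁ t, v₁ t)) t) ∧
      ∀ t ∈ Icc a b, t ≤ t₀ → c₁ t = φγ t := by
    by_cases hat : a < t₀
    · have hα' := hαδ hat
      refine ⟨φγ, v, rfl, rfl, ((hcont t₀ htαβ).mono (Icc_subset_Icc_right htβ)
        ).mono_of_mem_nhdsWithin (Icc_mem_nhdsLE hα'), ?_, fun _ _ _ => rfl⟩
      filter_upwards [Ioo_mem_nhdsLT hα'] with t ht using hode t ⟨ht.1, ht.2.trans_le htβ⟩
    · refine ⟨q, w, q0, w0, hqc.continuousWithinAt, eventually_nhdsWithin_of_eventually_nhds hq,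
        fun t ht hle => ?_⟩
      have : t = t₀ := le_antisymm hle ((not_lt.1 hat).trans ht.1)
      rw [this, q0]
  have right : ∃ c₂ v₂ : ℝ → Coord n, c₂ t₀ = φγ t₀ ∧ v₂ t₀ = v t₀ ∧
      ContinuousWithinAt (fun t => (c₂ t, v₂ t)) (Ici t₀) t₀ ∧
      (∀ᶠ t in 𝓝[>] t₀, HasDerivAt c₂ (v₂ t) t ∧
        HasDerivAt v₂ (accel (localRep F x₀) (c₂ t, v₂ t)) t) ∧
      ∀ t ∈ Icc a b, t₀ ≤ t → c₂ t = φγ t := by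
    by_cases htb : t₀ < b
    · have hβ' := hβδ htb
      refine ⟨φγ, v, rfl, rfl, ((hcont t₀ htαβ).mono (Icc_subset_Icc_left htα)
        ).mono_of_mem_nhdsWithin (Icc_mem_nhdsGE hβ'), ?_, fun _ _ _ => rfl⟩
      filter_upwards [Ioo_mem_nhdsGT hβ'] with t ht using hode t ⟨htα.trans_lt ht.1, ht.2⟩
    · refine ⟨q, w, q0, w0, hqc.continuousWithinAt, eventually_nhdsWithin_of_eventually_nhds hq,
        fun t ht hle => ?_⟩
      have : t = t₀ := le_antisymm (ht.2.trans (not_lt.1 htb)) hle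
      rw [this, q0]
  obtain ⟨c₁, v₁, e1, e2, e3, e4, e5⟩ := left
  obtain ⟨c₂, v₂, f1, f2, f3, f4, f5⟩ := right
  refine ⟨_, _, hF.isChartGeodesicAt_of_halves (e1.trans f1.symm) (e2.trans f2.symm)
    (by rwa [e1]) (by rw [e2]; exact (hv t₀ htαβ).1) (by rw [e1, e2]; exact (hv t₀ htαβ).2)
    e3 f3 e4 f4, Eventually.of_forall fun t ht => ?_⟩
  by_cases hle : t ≤ t₀
  · simp only [if_pos hle]; exact e5 t ht hle
  · simp only [if_neg hle]; exact f5 t ht (le_of_lt (not_le.1 hle))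

/-- A path that leaves a coordinate ball reaches its boundary sphere. -/
theorem exists_exit [T2Space M] {σ : ℝ → M} {e f : ℝ} (hσ : ContinuousOn σ (Icc e f)) {x₀ : M}
    {x : Coord n} {r : ℝ} (hr : Metric.closedBall x r ⊆ (extChartAt (𝓡 n) x₀).target)
    (he : ∃ z ∈ Metric.ball x r, σ e = (extChartAt (𝓡 n) x₀).symm z) :
    (∀ t ∈ Icc e f, ∃ z ∈ Metric.closedBall x r, σ t = (extChartAt (𝓡 n) x₀).symm z) ∨
    ∃ s ∈ Icc e f, (∀ t ∈ Icc e s, ∃ z ∈ Metric.closedBall x r,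
      σ t = (extChartAt (𝓡 n) x₀).symm z) ∧ ∃ z, dist z x = r ∧
        σ s = (extChartAt (𝓡 n) x₀).symm z := by
  set φ := extChartAt (𝓡 n) x₀ with hφ
  set O : Set M := φ.symm '' Metric.ball x r with hO
  set K : Set M := φ.symm '' Metric.closedBall x r with hK
  have hKc : IsClosed K := ((isCompact_closedBall x r).image_of_continuousOn
    ((continuousOn_extChartAt_symm (I := 𝓡 n) x₀).mono hr)).isClosed
  have hOo : IsOpen O := by
    have h1 : O = φ.source ∩ φ ⁻¹' Metric.ball x r :=
      φ.symm_image_eq_source_inter_preimage (Metric.ball_subset_closedBall.trans hr)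
    rw [h1]
    exact (continuousOn_extChartAt (I := 𝓡 n) x₀).isOpen_inter_preimage
      (isOpen_extChartAt_source x₀) Metric.isOpen_ball
  have hOK : O ⊆ K := image_mono Metric.ball_subset_closedBall
  have mem_K : ∀ {t}, σ t ∈ K → ∃ z ∈ Metric.closedBall x r, σ t = φ.symm z := by
    rintro t ⟨z, hz, h⟩
    exact ⟨z, hz, h.symm⟩
  by_cases hall : ∀ t ∈ Icc e f, σ t ∈ O
  · exact Or.inl fun t ht => mem_K (hOK (hall t ht))
  right
  push Not at hall
  -- The first exit time is the infimum of B. There σ is outside the image of the open ball, yet a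
  -- limit of points in the image K of the closed ball. K is closed because it is compact and M is
  -- Hausdorff, so σ is on the bounding sphere.
  set B : Set ℝ := Icc e f ∩ σ ⁻¹' Oᶜ with hB
  have hBne : B.Nonempty := hall.imp fun t ht => ⟨ht.1, ht.2⟩
  have hBc : IsClosed B := hσ.preimage_isClosed_of_isClosed isClosed_Icc hOo.isClosed_compl
  have hBb : BddBelow B := ⟨e, fun t ht => ht.1.1⟩
  have hsB : sInf B ∈ B := hBc.csInf_mem hBne hBb
  set s := sInf B with hs
  have hlt : ∀ t ∈ Ico e s, σ t ∈ O := fun t ht => by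
    by_contra hn
    exact absurd (csInf_le hBb (show t ∈ B from ⟨⟨ht.1, ht.2.le.trans hsB.1.2⟩, hn⟩))
      (not_le.2 ht.2)
  have hes : e < s := by
    refine lt_of_le_of_ne hsB.1.1 fun h => hsB.2 ?_
    rw [← h]
    obtain ⟨z, hz, h⟩ := he
    exact ⟨z, hz, h.symm⟩
  have hsK : σ s ∈ K := by
    have h1 : s ∈ closure (Ico e s) := by
      rw [closure_Ico hes.ne]; exact right_mem_Icc.2 hes.le
    have h2 : ContinuousWithinAt σ (Ico e s) s :=
      (hσ s hsB.1).mono fun t ht => ⟨ht.1, ht.2.le.trans hsB.1.2⟩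
    refine hKc.closure_subset_iff.2 ?_ (h2.mem_closure_image h1)
    rintro _ ⟨t, ht, rfl⟩
    exact hOK (hlt t ht)
  refine ⟨s, hsB.1, fun t ht => ?_, ?_⟩
  · rcases ht.2.eq_or_lt with rfl | h
    · exact mem_K hsK
    · exact mem_K (hOK (hlt t ⟨ht.1, h⟩))
  · obtain ⟨z, hz, h⟩ := hsK
    refine ⟨z, le_antisymm hz (not_lt.1 fun hzr => hsB.2 ⟨z, hzr, h⟩), h.symm⟩

/-- A competitor staying in a coordinate ball around the base point is compared through the
calibration S. One that reaches the boundary of the ball is slow, because F dominates a multiple of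
the coordinate norm there. -/
theorem IsGeodesicOn.isLocallyShortestOn [T2Space M] (hF : IsFinslerMetric F) {γ : ℝ → M} {a b : ℝ}
    (hab : a < b) (h : IsGeodesicOn F γ a b) (h1 : ∀ t ∈ Ioo a b, F ⟨γ t, velocity γ t⟩ = 1) :
    IsLocallyShortestOn F γ a b := by
  have hpath : IsUnitPath F γ a b := IsUnitPiece.isUnitPath ⟨h.smooth, h1⟩
  refine ⟨hpath, fun t₀ ht₀ => ?_⟩
  obtain ⟨c, v, hcv, hcγ⟩ := h.exists_isChartGeodesicAt hF hab h1 ht₀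
  set x₀ := γ t₀ with hx₀
  have hΦ := hF.isLocalFinsler x₀
  obtain ⟨S, hS, hSt⟩ := hΦ.exists_calibration (N := innerSL ℝ) (fun z w => real_inner_comm w z)
    (fun z => (real_inner_self_eq_norm_sq z).ge) hcv
  have hc0 := hcv.self_of_nhds
  obtain ⟨r, hr, hball⟩ := Metric.nhds_basis_closedBall.mem_iff.1
    (hS.and ((isOpen_extChartAt_target x₀).mem_nhds hc0.1))
  obtain ⟨m, hm, hmb⟩ : ∃ m > 0, ∀ x ∈ Metric.closedBall (c t₀) r, ∀ y,
      m * ‖y‖ ≤ localRep F x₀ (x, y) := by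
    obtain ⟨m, hm, hmb⟩ := ((isCompact_closedBall (c t₀) r).prod
      (isCompact_sphere (0 : Coord n) 1)).exists_forall_le' (f := localRep F x₀)
      ((hF.continuousOn_localRep x₀).mono fun z hz => ⟨(hball hz.1).2, mem_univ _⟩) (a := 0)
      fun z hz => hΦ.pos z.1 (hball hz.1).2 z.2
        (norm_ne_zero_iff.1 (by rw [mem_sphere_zero_iff_norm.1 hz.2]; exact one_ne_zero))
    refine ⟨m, hm, fun x hx y => ?_⟩
    by_cases hy : y = 0
    · rw [hy, norm_zero, mul_zero, hΦ.map_zero (hball hx).2]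
    · have hn : 0 < ‖y‖ := norm_pos_iff.2 hy
      have h2 := hmb (x, ‖y‖⁻¹ • y) ⟨hx, by
        rw [mem_sphere_zero_iff_norm, norm_smul, norm_inv, norm_norm, inv_mul_cancel₀ hn.ne']⟩
      rw [hΦ.homog _ (hball hx).2 _ _ (inv_pos.2 hn), ← div_eq_inv_mul, le_div_iff₀ hn] at h2
      exact h2
  have hcball : ∀ᶠ t in 𝓝 t₀, c t ∈ Metric.ball (c t₀) (r / 2) :=
    hc0.2.2.1.continuousAt.eventually (Metric.ball_mem_nhds _ (by linarith))
  have hsrc : ∀ᶠ t in 𝓝 t₀, t ∈ Icc a b → γ t ∈ (extChartAt (𝓡 n) x₀).source :=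
    eventually_nhdsWithin_iff.1 ((h.smooth.continuousOn t₀ ht₀).eventually
      ((isOpen_extChartAt_source x₀).mem_nhds (mem_extChartAt_source (I := 𝓡 n) x₀)))
  obtain ⟨δ, hδ, hall⟩ := Metric.eventually_nhds_iff_ball.1
    (hcγ.and (hSt.and (hcball.and hsrc)))
  have hmr : 0 < m * r := mul_pos hm hr
  -- From within r/2 of the centre a path needs time at least mr/2 to reach the sphere of radius r,
  -- while d' - c' is smaller than 2·mr/4.
  refine ⟨min δ (m * r / 4), lt_min hδ (by linarith), fun c' hc' d' hd' hcε hdε hcd =>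
    ⟨hpath.mono hc'.1 hd'.2, fun σ e f hef hσ he hf => ?_⟩⟩
  obtain ⟨γc, Sc, bc, sc⟩ := hall c' (hcε.trans_le (min_le_left _ _))
  obtain ⟨γd, Sd, bd, sd⟩ := hall d' (hdε.trans_le (min_le_left _ _))
  have hce : extChartAt (𝓡 n) x₀ (σ e) = c c' := by rw [he, γc hc']
  have hcf : extChartAt (𝓡 n) x₀ (σ f) = c d' := by rw [hf, γd hd']
  have hsub : Metric.closedBall (c t₀) r ⊆ (extChartAt (𝓡 n) x₀).target := fun z hz => (hball hz).2
  rcases exists_exit hσ.continuousOn hsub ⟨c c', Metric.ball_subset_ball (by linarith) bc, by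
      rw [γc hc', (extChartAt (𝓡 n) x₀).left_inv (sc hc'), he]⟩ with hin | ⟨s, hs, hin, z, hz, hσs⟩
  · have hφ : ∀ t ∈ Icc e f, σ t ∈ (extChartAt (𝓡 n) x₀).source ∧
        extChartAt (𝓡 n) x₀ (σ t) ∈ Metric.closedBall (c t₀) r := fun t ht => by
      obtain ⟨z, hz, hzt⟩ := hin t ht
      rw [hzt, (extChartAt (𝓡 n) x₀).right_inv (hsub hz)]
      exact ⟨(extChartAt (𝓡 n) x₀).map_target (hsub hz), hz⟩
    have h2 := hσ.sub_le hF hef (fun t ht => (hφ t ht).1) (S := S)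
      fun t ht => (hball (hφ t ht).2).1
    rw [hce, hcf, Sc, Sd] at h2
    exact h2
  · have hφ : ∀ t ∈ Icc e s, σ t ∈ (extChartAt (𝓡 n) x₀).source ∧
        extChartAt (𝓡 n) x₀ (σ t) ∈ Metric.closedBall (c t₀) r := fun t ht => by
      obtain ⟨z, hz, hzt⟩ := hin t ht
      rw [hzt, (extChartAt (𝓡 n) x₀).right_inv (hsub hz)]
      exact ⟨(extChartAt (𝓡 n) x₀).map_target (hsub hz), hz⟩
    have h2 := (hσ.mono le_rfl hs.2).norm_sub_le hF hs.1 (fun t ht => (hφ t ht).1)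
      fun t ht => hmb _ (hφ t ht).2
    rw [hσs, (extChartAt (𝓡 n) x₀).right_inv (hsub (by rw [Metric.mem_closedBall, hz])), hce] at h2
    have h3 : r / 2 ≤ ‖z - c c'‖ := by
      have h4 := dist_triangle z (c c') (c t₀)
      have h5 : dist (c c') (c t₀) < r / 2 := bc
      rw [hz, dist_eq_norm] at h4
      linarith
    have h6 := abs_lt.1 (hcε.trans_le (min_le_right _ _))
    have h7 := abs_lt.1 (hdε.trans_le (min_le_right _ _))
    nlinarith [hs.2]

theorem isLocallyShortestOn_iff [T2Space M] (hF : IsFinslerMetric F) {γ : ℝ → M} {a b : ℝ}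
    (hab : a < b) : IsLocallyShortestOn F γ a b ↔
      IsGeodesicOn F γ a b ∧ ∀ t ∈ Ioo a b, F ⟨γ t, velocity γ t⟩ = 1 :=
  ⟨fun h => h.isGeodesicOn hF hab, fun h => h.1.isLocallyShortestOn hF hab h.2⟩

end GeodesicIsLocallyShortest

/-! ### The scalar equation of the slope metric: existence and uniqueness of its root. -/

section SlopeRoot

/-- The squared length of `y - k z G` in terms of `A = |y|²`, `b = ⟨y, G⟩` and `N = |G|²`. -/
def windSq (k A b N z : ℝ) : ℝ := A - 2 * k * z * b + k ^ 2 * z ^ 2 * N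

/-- The equation for the value `z` of the slope metric at `y`, in terms of `A = |y|²`,
`b = ⟨y, G⟩` and `N = |G|²`. -/
structure IsSlopeRoot (c k A b N z : ℝ) : Prop where
  pos : 0 < z
  sq_pos : 0 < windSq k A b N z
  eq : windSq k A b N z = z * (√(windSq k A b N z) + c * (b - k * z * N))

/-- The pointwise form of the wind condition. -/
structure IsMildWind (c k γ : ℝ) : Prop where
  nonneg : 0 ≤ k
  norm_nonneg : 0 ≤ γ
  slide : 2 * |c| * γ < 1
  total : (c + k) * γ < 1

variable {c k γ : ℝ}

/-- With a = ‖Y‖ and β = ⟨Y, G⟩ this keeps the denominator a + cβ of the norm above a/2. -/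
theorem IsMildWind.abs_mul_le (h : IsMildWind c k γ) {a β : ℝ} (ha : 0 ≤ a) (hβ : |β| ≤ γ * a) :
    |c * β| ≤ a / 2 := by
  rw [abs_mul]
  have h1 : |c| * |β| ≤ |c| * (γ * a) := by gcongr
  nlinarith [h.slide]

theorem IsMildWind.lt_one (h : IsMildWind c k γ) : c * γ < 1 / 2 := by
  have := mul_le_mul_of_nonneg_right (le_abs_self c) h.norm_nonneg
  nlinarith [h.slide]

theorem IsMildWind.neg_lt (h : IsMildWind c k γ) : -(1 / 2) < c * γ := by
  have := mul_le_mul_of_nonneg_right (neg_abs_le c) h.norm_nonneg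
  nlinarith [h.slide]

/-- The function s²/(s + e) is increasing where s + 2e ≥ 0. The strength of the bound 2|c|γ < 1
enters here. -/
theorem sq_div_le_sq_div {a s e : ℝ} (ha : 0 ≤ a) (has : a ≤ s) (he : |e| ≤ a / 2) :
    a ^ 2 / (a + e) ≤ s ^ 2 / (s + e) := by
  have he1 := (abs_le.1 he).1
  rcases ha.eq_or_lt with rfl | ha
  · simp only [ne_eq, OfNat.ofNat_ne_zero, not_false_eq_true, zero_pow, zero_div]
    exact div_nonneg (sq_nonneg _) (by linarith)
  · rw [div_le_div_iff₀ (by linarith) (by linarith)]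
    have h1 : 0 ≤ a * s + e * (s + a) := by nlinarith
    nlinarith [mul_nonneg (sub_nonneg.2 has) h1]

/-- The function a²/D is jointly convex and homogeneous, hence lies above its tangent planes. These
are the ones of slope parameter μ, and D = 0 is covered by the convention 0/0 = 0. -/
theorem two_mul_sub_le_sq_div {a D : ℝ} (μ : ℝ) (hD : 0 ≤ D) (h0 : D = 0 → a = 0) :
    2 * μ * a - μ ^ 2 * D ≤ a ^ 2 / D := by
  rcases hD.eq_or_lt with h | h
  · rw [← h, h0 h.symm]; simp
  · rw [le_div_iff₀ h]
    nlinarith [sq_nonneg (a - μ * D)]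

/-- Subadditivity of the fibre norm in the direction of the wind. -/
theorem IsMildWind.sq_div_le (h : IsMildWind c k γ) {a₁ a₂ d β₁ β₂ : ℝ} (h₁ : 0 ≤ a₁)
    (h₂ : 0 ≤ a₂) (hd : 0 ≤ d) (h₁₂ : a₂ ≤ a₁ + d) (hβ₁ : |β₁| ≤ γ * a₁) (hβ₂ : |β₂| ≤ γ * a₂)
    (hβ : β₂ = β₁ - d * γ) :
    a₂ ^ 2 / (a₂ + c * β₂) ≤ a₁ ^ 2 / (a₁ + c * β₁) + d / (1 - c * γ) := by
  have e₁ := abs_le.1 (h.abs_mul_le h₁ hβ₁)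
  have hc := h.lt_one
  have hc' : 0 < 1 - c * γ := by linarith
  refine (sq_div_le_sq_div h₂ h₁₂ (h.abs_mul_le h₂ hβ₂)).trans ?_
  set S := a₁ + d + c * β₂ with hS
  have hSe : S = (a₁ + c * β₁) + d * (1 - c * γ) := by rw [hS, hβ]; ring
  -- The two fractions are bounded below by tangents with the common parameter μ = (a₁ + d)/S, for
  -- which the tangents add up to (a₁ + d)²/S exactly.
  have t₁ := two_mul_sub_le_sq_div (a := a₁) (D := a₁ + c * β₁) ((a₁ + d) / S) (by linarith)
    fun h0 => by linarith
  have t₂ : 2 * ((a₁ + d) / S) * d - ((a₁ + d) / S) ^ 2 * (d * (1 - c * γ)) ≤ d / (1 - c * γ) := by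
    rw [le_div_iff₀ hc']
    nlinarith [mul_nonneg hd (sq_nonneg (1 - (a₁ + d) / S * (1 - c * γ)))]
  rcases (show 0 ≤ S by rw [hSe]; have := mul_nonneg hd hc'.le; linarith).eq_or_lt with h0 | h0
  · rw [← h0, div_zero]
    exact add_nonneg (div_nonneg (sq_nonneg _) (by linarith)) (div_nonneg hd hc'.le)
  · have t₃ : (a₁ + d) ^ 2 / S = 2 * ((a₁ + d) / S) * (a₁ + d) - ((a₁ + d) / S) ^ 2 * S := by
      field_simp; ring
    rw [t₃]
    have : ((a₁ + d) / S) ^ 2 * S = ((a₁ + d) / S) ^ 2 * (a₁ + c * β₁)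
        + ((a₁ + d) / S) ^ 2 * (d * (1 - c * γ)) := by rw [hSe]; ring
    linarith

variable {A b : ℝ}

/-- Cauchy–Schwarz for y - kzG and G in scalar form. The difference of the two sides is the Gram
determinant Aγ² - b², which the shift along G does not change. -/
theorem sq_sub_le (hb : b ^ 2 ≤ A * γ ^ 2) (z : ℝ) :
    (b - k * z * γ ^ 2) ^ 2 ≤ windSq k A b (γ ^ 2) z * γ ^ 2 := by
  unfold windSq; nlinarith

theorem windSq_nonneg (hA : 0 ≤ A) (hb : b ^ 2 ≤ A * γ ^ 2) (z : ℝ) :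
    0 ≤ windSq k A b (γ ^ 2) z := by
  rcases eq_or_ne γ 0 with rfl | hγ
  · have : b = 0 := by nlinarith
    subst this
    simpa [windSq] using hA
  · have h1 := sq_sub_le (k := k) hb z
    have h2 : 0 < γ ^ 2 := by positivity
    exact nonneg_of_mul_nonneg_left ((sq_nonneg _).trans h1) h2

theorem IsMildWind.abs_sub_le (h : IsMildWind c k γ) (hA : 0 ≤ A) (hb : b ^ 2 ≤ A * γ ^ 2) (z : ℝ) :
    |b - k * z * γ ^ 2| ≤ γ * √(windSq k A b (γ ^ 2) z) := by
  rw [← abs_of_nonneg (mul_nonneg h.norm_nonneg (Real.sqrt_nonneg _))]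
  refine sq_le_sq.1 ?_
  rw [mul_pow, Real.sq_sqrt (windSq_nonneg hA hb z)]
  linarith [sq_sub_le (k := k) hb z]

theorem IsMildWind.sqrt_windSq_le (h : IsMildWind c k γ) (hA : 0 ≤ A) (hb : b ^ 2 ≤ A * γ ^ 2)
    {z₁ z₂ : ℝ} (hz : z₁ ≤ z₂) :
    √(windSq k A b (γ ^ 2) z₂) ≤ √(windSq k A b (γ ^ 2) z₁) + k * (z₂ - z₁) * γ := by
  have h1 := (abs_le.1 (h.abs_sub_le hA hb z₁)).1
  have h2 := Real.sq_sqrt (windSq_nonneg (k := k) hA hb z₁)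
  have h3 := Real.sqrt_nonneg (windSq k A b (γ ^ 2) z₁)
  have hd : 0 ≤ k * (z₂ - z₁) := mul_nonneg h.nonneg (by linarith)
  rw [Real.sqrt_le_iff]
  refine ⟨add_nonneg h3 (mul_nonneg hd h.norm_nonneg), ?_⟩
  have h4 : windSq k A b (γ ^ 2) z₂ = windSq k A b (γ ^ 2) z₁
      - 2 * (k * (z₂ - z₁)) * (b - k * z₁ * γ ^ 2) + (k * (z₂ - z₁) * γ) ^ 2 := by
    unfold windSq; ring
  rw [h4, add_sq, h2]
  nlinarith [mul_le_mul_of_nonneg_left h1 hd]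

/-- The fibre norm of `y - k z G`. -/
def windNorm (c k A b γ z : ℝ) : ℝ :=
  √(windSq k A b (γ ^ 2) z) ^ 2 / (√(windSq k A b (γ ^ 2) z) + c * (b - k * z * γ ^ 2))

/-- One-sided Lipschitz bound: increasing z moves the argument along -G, and the norm of -kG is
kγ/(1 - cγ). This ratio is less than one by the total wind bound. -/
theorem IsMildWind.windNorm_le (h : IsMildWind c k γ) (hA : 0 ≤ A) (hb : b ^ 2 ≤ A * γ ^ 2)
    {z₁ z₂ : ℝ} (hz : z₁ ≤ z₂) :
    windNorm c k A b γ z₂ ≤ windNorm c k A b γ z₁ + k * (z₂ - z₁) * γ / (1 - c * γ) :=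
  h.sq_div_le (Real.sqrt_nonneg _) (Real.sqrt_nonneg _)
    (mul_nonneg (mul_nonneg h.nonneg (by linarith)) h.norm_nonneg) (h.sqrt_windSq_le hA hb hz)
    (h.abs_sub_le hA hb _) (h.abs_sub_le hA hb _) (by ring)

theorem IsMildWind.denom_ge (h : IsMildWind c k γ) (hA : 0 ≤ A) (hb : b ^ 2 ≤ A * γ ^ 2) (z : ℝ) :
    √(windSq k A b (γ ^ 2) z) / 2 ≤ √(windSq k A b (γ ^ 2) z) + c * (b - k * z * γ ^ 2) := by
  have := (abs_le.1 (h.abs_mul_le (Real.sqrt_nonneg _) (h.abs_sub_le hA hb z))).1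
  linarith

theorem IsMildWind.windNorm_le_two_mul (h : IsMildWind c k γ) (hA : 0 ≤ A) (hb : b ^ 2 ≤ A * γ ^ 2)
    (z : ℝ) : windNorm c k A b γ z ≤ 2 * √(windSq k A b (γ ^ 2) z) := by
  have h1 := h.denom_ge hA hb z
  have h2 := Real.sqrt_nonneg (windSq k A b (γ ^ 2) z)
  exact div_le_of_le_mul₀ (by linarith) (by linarith) (by nlinarith)

theorem IsMildWind.windNorm_nonneg (h : IsMildWind c k γ) (hA : 0 ≤ A) (hb : b ^ 2 ≤ A * γ ^ 2)
    (z : ℝ) : 0 ≤ windNorm c k A b γ z :=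
  div_nonneg (sq_nonneg _) (by
    linarith [h.denom_ge hA hb z, Real.sqrt_nonneg (windSq k A b (γ ^ 2) z)])

theorem IsMildWind.isSlopeRoot_iff (h : IsMildWind c k γ) (hA : 0 ≤ A) (hb : b ^ 2 ≤ A * γ ^ 2)
    {z : ℝ} : IsSlopeRoot c k A b (γ ^ 2) z ↔ 0 < z ∧ windNorm c k A b γ z = z := by
  have h1 := h.denom_ge hA hb z
  have h2 := Real.sqrt_nonneg (windSq k A b (γ ^ 2) z)
  have h3 := Real.sq_sqrt (windSq_nonneg (k := k) hA hb z)
  constructor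
  · rintro ⟨hz, hq, he⟩
    have h4 := Real.sqrt_pos.2 hq
    refine ⟨hz, ?_⟩
    rw [windNorm, div_eq_iff (by linarith), h3, ← he]
  · rintro ⟨hz, he⟩
    have h4 : 0 < √(windSq k A b (γ ^ 2) z) := by
      refine lt_of_le_of_ne h2 fun h0 => ?_
      rw [windNorm, ← h0] at he
      simp at he
      linarith
    refine ⟨hz, Real.sqrt_pos.1 h4, ?_⟩
    rw [windNorm, div_eq_iff (by linarith), h3] at he
    exact he

theorem IsMildWind.ratio_lt (h : IsMildWind c k γ) : k * γ / (1 - c * γ) < 1 := by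
  rw [div_lt_one (by linarith [h.lt_one])]
  nlinarith [h.total]

/-- A function growing with slope less than one meets the identity at most once. -/
theorem IsMildWind.isSlopeRoot_unique (h : IsMildWind c k γ) (hA : 0 ≤ A) (hb : b ^ 2 ≤ A * γ ^ 2)
    {z₁ z₂ : ℝ} (h₁ : IsSlopeRoot c k A b (γ ^ 2) z₁) (h₂ : IsSlopeRoot c k A b (γ ^ 2) z₂) :
    z₁ = z₂ := by
  have key : ∀ {z₁ z₂ : ℝ}, IsSlopeRoot c k A b (γ ^ 2) z₁ → IsSlopeRoot c k A b (γ ^ 2) z₂ →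
      ¬z₁ < z₂ := by
    intro z₁ z₂ h₁ h₂ hlt
    have h3 := h.windNorm_le hA hb hlt.le
    rw [((h.isSlopeRoot_iff hA hb).1 h₁).2, ((h.isSlopeRoot_iff hA hb).1 h₂).2,
      show k * (z₂ - z₁) * γ / (1 - c * γ) = k * γ / (1 - c * γ) * (z₂ - z₁) by ring] at h3
    nlinarith [h.ratio_lt]
  exact le_antisymm (not_lt.1 (key h₂ h₁)) (not_lt.1 (key h₁ h₂))

theorem continuous_windSq {N : ℝ} : Continuous (windSq k A b N) := by
  unfold windSq; fun_prop

theorem IsMildWind.continuous_windNorm (h : IsMildWind c k γ) (hA : 0 ≤ A)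
    (hb : b ^ 2 ≤ A * γ ^ 2) : Continuous (windNorm c k A b γ) := by
  have h1 : Continuous fun z => √(windSq k A b (γ ^ 2) z) := continuous_windSq.sqrt
  rw [continuous_iff_continuousAt]
  intro z
  rcases (Real.sqrt_nonneg (windSq k A b (γ ^ 2) z)).eq_or_lt with h0 | h0
  -- At the parameter where y - kzG has length 0 the quotient is 0/0, read as 0. Continuity there
  -- comes from the bound by twice the length.
  · have h2 : windNorm c k A b γ z = 0 := by simp [windNorm, ← h0]
    rw [ContinuousAt, h2]
    refine squeeze_zero (fun z => h.windNorm_nonneg hA hb z)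
      (fun z => h.windNorm_le_two_mul hA hb z) ?_
    have := (h1.const_mul 2).tendsto z
    rwa [← h0, mul_zero] at this
  · refine ContinuousAt.div (h1.pow 2).continuousAt
      (h1.add (by fun_prop)).continuousAt ?_
    linarith [h.denom_ge hA hb z]

theorem IsMildWind.exists_isSlopeRoot (h : IsMildWind c k γ) (hA : 0 < A) (hb : b ^ 2 ≤ A * γ ^ 2) :
    ∃ z, IsSlopeRoot c k A b (γ ^ 2) z := by
  set ρ := k * γ / (1 - c * γ) with hρ
  have hρ1 : ρ < 1 := h.ratio_lt
  have h0 : 0 < windNorm c k A b γ 0 := by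
    have h1 : 0 < √(windSq k A b (γ ^ 2) 0) := Real.sqrt_pos.2 (by simpa [windSq] using hA)
    exact div_pos (by positivity) (by linarith [h.denom_ge hA.le hb 0])
  -- The point where the line of slope ρ through the value at 0 meets the diagonal. The Lipschitz
  -- bound puts the graph below the diagonal there, and it starts above it at 0.
  set Z := windNorm c k A b γ 0 / (1 - ρ) with hZ
  have hZ0 : 0 < Z := div_pos h0 (by linarith)
  have hZ1 : windNorm c k A b γ Z ≤ Z := by
    have h2 := h.windNorm_le hA.le hb hZ0.le
    rw [sub_zero, show k * Z * γ / (1 - c * γ) = ρ * Z by rw [hρ]; ring] at h2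
    have h3 : windNorm c k A b γ 0 = (1 - ρ) * Z := by
      rw [hZ]; field_simp [(by linarith : 1 - ρ ≠ 0)]
    linarith
  have hc : ContinuousOn (fun z => windNorm c k A b γ z - z) (Icc 0 Z) :=
    ((h.continuous_windNorm hA.le hb).sub continuous_id).continuousOn
  obtain ⟨z, hz, hz0⟩ := intermediate_value_Icc' hZ0.le hc
    (show (0 : ℝ) ∈ Icc (windNorm c k A b γ Z - Z) (windNorm c k A b γ 0 - 0) from
      ⟨by linarith, by linarith⟩)
  have hz1 : windNorm c k A b γ z = z := by simpa [sub_eq_zero] using hz0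
  refine ⟨z, (h.isSlopeRoot_iff hA.le hb).2 ⟨lt_of_le_of_ne hz.1 fun h4 => ?_, hz1⟩⟩
  rw [← h4] at hz1
  linarith

/-- A bound proportional to ‖y‖, with a constant depending continuously on the wind. It yields
continuity of the metric at the zero section, where smoothness fails. -/
theorem IsMildWind.isSlopeRoot_le (h : IsMildWind c k γ) (hA : 0 ≤ A) (hb : b ^ 2 ≤ A * γ ^ 2)
    {z : ℝ} (hz : IsSlopeRoot c k A b (γ ^ 2) z) : z ≤ 3 * √A / (1 - (c + k) * γ) := by
  obtain ⟨hz0, hz1⟩ := (h.isSlopeRoot_iff hA hb).1 hz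
  have h1 := h.windNorm_le hA hb hz0.le
  have h2 := h.windNorm_le_two_mul hA hb 0
  have h3 := h.lt_one
  have h4 := h.neg_lt
  rw [show windSq k A b (γ ^ 2) 0 = A by simp [windSq]] at h2
  rw [hz1, sub_zero] at h1
  have h5 : z * (1 - c * γ) ≤ 2 * √A * (1 - c * γ) + k * z * γ := by
    have h6 := h1.trans (add_le_add_left h2 _)
    have h7 : k * z * γ / (1 - c * γ) * (1 - c * γ) = k * z * γ :=
      div_mul_cancel₀ _ (by linarith)
    nlinarith
  rw [le_div_iff₀ (by linarith [h.total])]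
  nlinarith [Real.sqrt_nonneg A]

/-- The transversality inequality behind the implicit function theorem. -/
theorem IsMildWind.key_pos (h : IsMildWind c k γ) {s : ℝ} (hs : |s| ≤ γ) :
    0 < (1 + c * s) ^ 2 + k * ((1 + 2 * c * s) * s - c * γ ^ 2) := by
  have hs' := abs_le.1 hs
  rcases h.norm_nonneg.eq_or_lt with h0 | hγ
  · have : s = 0 := by rw [← h0] at hs; exact abs_nonpos_iff.1 hs
    rw [this, ← h0]; norm_num
  -- Normalization: |σ| ≤ 1 and e = cγ with |e| < 1/2. The expression is affine in kγ, which is less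
  -- than 1 - e. If its coefficient lowers the value, kγ may be replaced by 1 - e, where the
  -- expression factors with 1 - σ.
  obtain ⟨σ, hσ⟩ : ∃ σ, s = -(γ * σ) := ⟨-(s / γ), by field_simp⟩
  have hσ1 : σ ≤ 1 := by nlinarith [hs'.1]
  have hσ2 : -1 ≤ σ := by nlinarith [hs'.2]
  obtain ⟨e, he⟩ : ∃ e, e = c * γ := ⟨_, rfl⟩
  have he1 : e < 1 / 2 := he ▸ h.lt_one
  have he2 : -(1 / 2) < e := he ▸ h.neg_lt
  have hk : 0 ≤ k * γ := mul_nonneg h.nonneg h.norm_nonneg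
  have hk1 : k * γ < 1 - e := by rw [he]; nlinarith [h.total]
  have e1 : (1 + c * s) ^ 2 + k * ((1 + 2 * c * s) * s - c * γ ^ 2)
      = (1 - e * σ) ^ 2 - k * γ * (σ - 2 * e * σ ^ 2 + e) := by rw [hσ, he]; ring
  rw [e1]
  have h1 : 0 < 1 - e * σ := by nlinarith
  rcases le_or_gt (σ - 2 * e * σ ^ 2 + e) 0 with h2 | h2
  · nlinarith [sq_pos_of_pos h1, mul_nonneg hk (neg_nonneg.2 h2)]
  · have h3 : k * γ * (σ - 2 * e * σ ^ 2 + e) < (1 - e) * (σ - 2 * e * σ ^ 2 + e) := by gcongr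
    -- The factor is affine in σ, with the values (1 - e)(1 - 2e) at σ = 1 and 1 + e at σ = -1, both
    -- positive for |e| < 1/2.
    have h4 : 0 ≤ 1 - e * (1 + 2 * σ) + e ^ 2 * (1 + σ) := by
      have : 1 - e * (1 + 2 * σ) + e ^ 2 * (1 + σ) = (1 + σ) / 2 * ((1 - e) * (1 - 2 * e))
        + (1 - σ) / 2 * (1 + e) := by ring
      rw [this]
      have := mul_nonneg (by linarith : 0 ≤ (1 + σ) / 2) (mul_nonneg (by linarith : 0 ≤ 1 - e)
        (by linarith : 0 ≤ 1 - 2 * e))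
      have := mul_nonneg (by linarith : 0 ≤ (1 - σ) / 2) (by linarith : 0 ≤ 1 + e)
      linarith
    have h5 := mul_nonneg (by linarith : 0 ≤ 1 - σ) h4
    have h6 : (1 - e * σ) ^ 2 - (1 - e) * (σ - 2 * e * σ ^ 2 + e)
        = (1 - σ) * (1 - e * (1 + 2 * σ) + e ^ 2 * (1 + σ)) := by ring
    linarith

/-- The derivative of the defining equation with respect to the value of the metric. -/
theorem IsMildWind.transversal (h : IsMildWind c k γ) {a β z : ℝ} (ha : 0 < a)
    (hβ : |β| ≤ γ * a) (hz : a ^ 2 = z * (a + c * β)) :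
    0 < (a + c * β) + (2 * a - z) * k * β / a - z * k * c * γ ^ 2 := by
  have h1 := abs_le.1 (h.abs_mul_le ha.le hβ)
  have hs : |β / a| ≤ γ := by rwa [abs_div, abs_of_pos ha, div_le_iff₀ ha]
  have hk := h.key_pos hs
  have hD : 0 < a + c * β := by linarith
  have hz' : z = a ^ 2 / (a + c * β) := by rw [eq_div_iff hD.ne', hz]
  have e : (a + c * β) + (2 * a - z) * k * β / a - z * k * c * γ ^ 2
      = a ^ 2 / (a + c * β) * ((1 + c * (β / a)) ^ 2
        + k * ((1 + 2 * c * (β / a)) * (β / a) - c * γ ^ 2)) := by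
    rw [hz']
    field_simp
    ring
  rw [e]
  positivity

end SlopeRoot

/-! ### Smooth dependence of the root. -/

section SlopeRootSmooth

variable {c k γ A b : ℝ}

theorem isInvertible_of_apply_one_ne_zero {L : ℝ →L[ℝ] ℝ} (hL : L 1 ≠ 0) : L.IsInvertible :=
  ⟨ContinuousLinearEquiv.unitsEquivAut ℝ (Units.mk0 (L 1) hL), by ext; simp⟩

/-- The root depends smoothly on `(A, b, N)`. -/
theorem IsMildWind.exists_contDiffAt_root (h : IsMildWind c k γ) (hA : 0 ≤ A)
    (hb : b ^ 2 ≤ A * γ ^ 2) {z : ℝ} (hz : IsSlopeRoot c k A b (γ ^ 2) z) :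
    ∃ ψ : ℝ × ℝ × ℝ → ℝ, ContDiffAt ℝ ∞ ψ (A, b, γ ^ 2) ∧
      ∀ᶠ q in 𝓝 (A, b, γ ^ 2), IsSlopeRoot c k q.1 q.2.1 q.2.2 (ψ q) := by
  set u : (ℝ × ℝ × ℝ) × ℝ := ((A, b, γ ^ 2), z) with hu
  set f : (ℝ × ℝ × ℝ) × ℝ → ℝ := fun w => windSq k w.1.1 w.1.2.1 w.1.2.2 w.2
    - w.2 * (√(windSq k w.1.1 w.1.2.1 w.1.2.2 w.2) + c * (w.1.2.1 - k * w.2 * w.1.2.2)) with hf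
  have hq : ContDiff ℝ ∞ fun w : (ℝ × ℝ × ℝ) × ℝ => windSq k w.1.1 w.1.2.1 w.1.2.2 w.2 := by
    unfold windSq; fun_prop
  have hcd : ContDiffAt ℝ ∞ f u :=
    hq.contDiffAt.sub (contDiffAt_snd.mul ((hq.contDiffAt.sqrt hz.sq_pos.ne').add (by fun_prop)))
  have hfu : f u = 0 := sub_eq_zero.2 hz.eq
  set a := √(windSq k A b (γ ^ 2) z) with ha
  have ha0 : 0 < a := Real.sqrt_pos.2 hz.sq_pos
  have hβ := h.abs_sub_le hA hb z
  have htr := h.transversal ha0 hβ (by rw [ha, Real.sq_sqrt hz.sq_pos.le]; exact hz.eq)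
  have hder : HasDerivAt (fun t => f ((A, b, γ ^ 2), t))
      (-((a + c * (b - k * z * γ ^ 2)) + (2 * a - z) * k * (b - k * z * γ ^ 2) / a
        - z * k * c * γ ^ 2)) z := by
    have d1 : HasDerivAt (fun t => windSq k A b (γ ^ 2) t) (-2 * k * (b - k * z * γ ^ 2)) z := by
      unfold windSq
      have := ((((hasDerivAt_id z).const_mul (2 * k)).mul_const b).const_sub A).add
        ((((hasDerivAt_id z).pow 2).const_mul (k ^ 2)).mul_const (γ ^ 2))
      refine this.congr_deriv ?_
      simp
      ring
    have d2 := d1.sqrt hz.sq_pos.ne'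
    have d3 : HasDerivAt (fun t => c * (b - k * t * γ ^ 2)) (-(c * k * γ ^ 2)) z := by
      refine (((((hasDerivAt_id z).const_mul k).mul_const (γ ^ 2)).const_sub b).const_mul c
        ).congr_deriv ?_
      ring
    refine (d1.sub ((hasDerivAt_id z).mul (d2.add d3))).congr_deriv ?_
    simp only [Pi.add_apply, ← ha, id]
    field_simp
    ring
  have hinv : (fderiv ℝ f u ∘L .inr ℝ (ℝ × ℝ × ℝ) ℝ).IsInvertible := by
    refine isInvertible_of_apply_one_ne_zero ?_
    have h1 : HasDerivAt (fun t => f ((A, b, γ ^ 2), t)) (fderiv ℝ f u (0, 1)) z :=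
      (hcd.differentiableAt (by simp)).hasFDerivAt.comp_hasDerivAt z
        ((hasDerivAt_const z (A, b, γ ^ 2)).prodMk (hasDerivAt_id z))
    have h2 : fderiv ℝ f u (0, 1) ≠ 0 := by
      rw [h1.unique hder]
      exact (neg_lt_zero.2 htr).ne
    simpa using h2
  set ψ := hcd.implicitFunction (by simp) hinv with hψ
  have h0 : ψ (A, b, γ ^ 2) = z := hcd.implicitFunction_apply_self (by simp) hinv
  have hsm : ContDiffAt ℝ ∞ ψ (A, b, γ ^ 2) := hcd.contDiffAt_implicitFunction (by simp) hinv
  refine ⟨ψ, hsm, ?_⟩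
  have e1 : ∀ᶠ q in 𝓝 (A, b, γ ^ 2), 0 < ψ q :=
    hsm.continuousAt.eventually (lt_mem_nhds (by rw [h0]; exact hz.pos))
  have e2 : ∀ᶠ q in 𝓝 (A, b, γ ^ 2), 0 < windSq k q.1 q.2.1 q.2.2 (ψ q) := by
    have hc : ContinuousAt (fun q : ℝ × ℝ × ℝ => windSq k q.1 q.2.1 q.2.2 (ψ q)) (A, b, γ ^ 2) :=
      ContinuousAt.comp (g := fun w : (ℝ × ℝ × ℝ) × ℝ => windSq k w.1.1 w.1.2.1 w.1.2.2 w.2)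
        (f := fun q => (q, ψ q)) hq.continuous.continuousAt
        (continuousAt_id.prodMk hsm.continuousAt)
    exact hc.eventually (lt_mem_nhds (by simp only [h0]; exact hz.sq_pos))
  filter_upwards [e1, e2, hcd.eventually_apply_implicitFunction (by simp) hinv] with q q1 q2 q3
  refine ⟨q1, q2, ?_⟩
  rw [hfu] at q3
  exact sub_eq_zero.1 q3

theorem IsSlopeRoot.smul {N z t : ℝ} (h : IsSlopeRoot c k A b N z) (ht : 0 < t) :
    IsSlopeRoot c k (t ^ 2 * A) (t * b) N (t * z) := by
  have e : windSq k (t ^ 2 * A) (t * b) N (t * z) = t ^ 2 * windSq k A b N z := by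
    unfold windSq; ring
  refine ⟨mul_pos ht h.pos, by rw [e]; exact mul_pos (by positivity) h.sq_pos, ?_⟩
  rw [e, Real.sqrt_mul (by positivity), Real.sqrt_sq ht.le]
  linear_combination t ^ 2 * h.eq

open Classical in
/-- The value of the slope metric. -/
def slopeVal (c k A b N : ℝ) : ℝ :=
  if h : ∃ z, IsSlopeRoot c k A b N z then h.choose else 0

theorem slopeVal_nonneg {N : ℝ} : 0 ≤ slopeVal c k A b N := by
  unfold slopeVal
  split_ifs with h
  · exact h.choose_spec.pos.le
  · exact le_rfl

theorem isSlopeRoot_slopeVal {N : ℝ} (h : ∃ z, IsSlopeRoot c k A b N z) :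
    IsSlopeRoot c k A b N (slopeVal c k A b N) := by
  rw [slopeVal, dif_pos h]
  exact h.choose_spec

theorem IsMildWind.not_isSlopeRoot_zero (h : IsMildWind c k γ) {b z : ℝ} (hb : b ^ 2 ≤ 0 * γ ^ 2) :
    ¬IsSlopeRoot c k 0 b (γ ^ 2) z := fun hz => by
  have := h.isSlopeRoot_le le_rfl hb hz
  simp only [Real.sqrt_zero, mul_zero, zero_div] at this
  exact absurd hz.pos (not_lt.2 this)

end SlopeRootSmooth

/-! ### Resultant velocities and roots; existence of the slope metric in each fibre. -/

section SlopePointwise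

variable {n : ℕ} {M : Type*} [TopologicalSpace M] [ChartedSpace (EuclideanSpace ℝ (Fin n)) M]
  [IsManifold (𝓡 n) ∞ M] (h : RiemMetric n M)

theorem riem_self_nonneg (x : M) (u : TangentSpace (𝓡 n) x) : 0 ≤ h.inner x u u := by
  by_cases hu : u = 0
  · rw [hu]; simp
  · exact (h.pos x u hu).le

theorem riem_cauchy_schwarz (x : M) (u w : TangentSpace (𝓡 n) x) :
    h.inner x u w ^ 2 ≤ h.inner x u u * h.inner x w w := by
  by_cases hw : w = 0
  · rw [hw]; simp
  · have hp := h.pos x w hw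
    have h1 := riem_self_nonneg h x (h.inner x w w • u - h.inner x u w • w)
    simp only [map_sub, map_smul, sub_apply, smul_apply, smul_eq_mul] at h1
    rw [h.symm x w u] at h1
    have h2 : 0 ≤ h.inner x w w * (h.inner x u u * h.inner x w w - h.inner x u w ^ 2) := by
      linarith
    linarith [nonneg_of_mul_nonneg_right h2 hp]

theorem hnorm_sq (x : M) (u : TangentSpace (𝓡 n) x) : hnorm h x u ^ 2 = h.inner x u u :=
  Real.sq_sqrt (riem_self_nonneg h x u)

theorem hnorm_nonneg (x : M) (u : TangentSpace (𝓡 n) x) : 0 ≤ hnorm h x u := Real.sqrt_nonneg _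

theorem sq_inner_le (x : M) (u w : TangentSpace (𝓡 n) x) :
    h.inner x u w ^ 2 ≤ h.inner x u u * hnorm h x w ^ 2 := by
  rw [hnorm_sq]; exact riem_cauchy_schwarz h x u w

theorem inner_sub_smul (x : M) (y G : TangentSpace (𝓡 n) x) (k z : ℝ) :
    h.inner x (y - (k * z) • G) (y - (k * z) • G) =
      windSq k (h.inner x y y) (h.inner x y G) (h.inner x G G) z := by
  simp only [map_sub, map_smul, sub_apply, smul_apply, smul_eq_mul, windSq]
  rw [h.symm x G y]
  ring

variable (p : M → ℝ) (g η η' : ℝ)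

/-- The value `z` of the slope metric at `y` is a root of its defining equation. -/
def IsSlopeRootAt (x : M) (y : TangentSpace (𝓡 n) x) (z : ℝ) : Prop :=
  IsSlopeRoot (η - η') (1 - η) (h.inner x y y) (h.inner x y (gravWind h p g x))
    (hnorm h x (gravWind h p g x) ^ 2) z

variable {h p g η η'}

/-- The vector Y = v - kG is a multiple of the self-velocity u, so u can only be Y/‖Y‖. Substituting
this turns the vector equation into the scalar one. -/
theorem isResultantVelocity_iff {x : M} {v : TangentSpace (𝓡 n) x}
    (hW : IsMildWind (η - η') (1 - η) (hnorm h x (gravWind h p g x))) :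
    IsResultantVelocity h p g η η' x v ↔ IsSlopeRootAt h p g η η' x v 1 := by
  set G := gravWind h p g x with hG
  set c := η - η' with hc
  set k := 1 - η with hk
  have hroot : IsSlopeRootAt h p g η η' x v 1 ↔ IsSlopeRoot c k (h.inner x v v) (h.inner x v G)
    (h.inner x G G) 1 := by rw [IsSlopeRootAt, hnorm_sq]
  rw [hroot]
  have hsq : windSq k (h.inner x v v) (h.inner x v G) (h.inner x G G) 1
      = h.inner x (v - k • G) (v - k • G) := by rw [← inner_sub_smul, mul_one]
  have hβ : h.inner x v G - k * 1 * h.inner x G G = h.inner x (v - k • G) G := by simp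
  constructor
  · rintro ⟨u, hu, hv⟩
    have hu1 : h.inner x u u = 1 := by rw [← hnorm_sq, hu, one_pow]
    set s := h.inner x G u with hs
    have hs1 : |s| ≤ hnorm h x G * 1 := by
      rw [mul_one, ← abs_of_nonneg (hnorm_nonneg h x G)]
      refine sq_le_sq.1 ?_
      have := sq_inner_le h x u G
      rwa [hu1, one_mul, h.symm x u G] at this
    have hpos : 0 < 1 + c * s := by
      linarith [(abs_le.1 (hW.abs_mul_le one_pos.le hs1)).1]
    have hY : v - k • G = (1 + c * s) • u := by
      rw [hv, activeWind, gravMAT, ← hG, hu1, div_one, add_smul, one_smul, mul_smul, ← hs,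
        ← hc, ← hk]
      abel
    have e1 : h.inner x (v - k • G) (v - k • G) = (1 + c * s) ^ 2 := by
      rw [hY]
      simp only [map_smul, smul_apply, smul_eq_mul, hu1]
      ring
    refine ⟨one_pos, by rw [hsq, e1]; positivity, ?_⟩
    rw [hβ, hsq, e1, Real.sqrt_sq hpos.le, hY]
    simp only [map_smul, smul_apply, smul_eq_mul]
    rw [h.symm x u G]
    ring
  · rintro ⟨-, hq, he⟩
    rw [hsq] at hq he
    rw [hβ, one_mul] at he
    set Y := v - k • G with hY
    set a := √(h.inner x Y Y) with ha
    have ha0 : 0 < a := Real.sqrt_pos.2 hq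
    have ha2 : h.inner x Y Y = a ^ 2 := (Real.sq_sqrt hq.le).symm
    have hu1 : h.inner x (a⁻¹ • Y) (a⁻¹ • Y) = 1 := by
      simp only [map_smul, smul_apply, smul_eq_mul, ha2]
      field_simp
    refine ⟨a⁻¹ • Y, by rw [hnorm, hu1, Real.sqrt_one], ?_⟩
    rw [activeWind, gravMAT, hu1, div_one, ← hG, ← hc, ← hk]
    have e2 : 1 + c * h.inner x G (a⁻¹ • Y) = a := by
      rw [map_smul, smul_eq_mul, h.symm x G Y]
      rw [ha2] at he
      field_simp
      linarith
    have e3 : a⁻¹ • Y + c • h.inner x G (a⁻¹ • Y) • a⁻¹ • Y = Y := by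
      have e4 : a⁻¹ • Y + c • h.inner x G (a⁻¹ • Y) • a⁻¹ • Y
          = (1 + c * h.inner x G (a⁻¹ • Y)) • a⁻¹ • Y := by rw [add_smul, one_smul, mul_smul]
      rw [e4, e2, smul_smul, mul_inv_cancel₀ ha0.ne', one_smul]
    rw [← add_assoc, e3, hY]
    abel

theorem IsSlopeRootAt.smul {x : M} {y : TangentSpace (𝓡 n) x} {z t : ℝ}
    (hz : IsSlopeRootAt h p g η η' x y z) (ht : 0 < t) :
    IsSlopeRootAt h p g η η' x (t • y) (t * z) := by
  have := IsSlopeRoot.smul hz ht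
  rw [IsSlopeRootAt]
  convert this using 1
  · simp only [map_smul, smul_apply, smul_eq_mul]; ring
  · simp only [map_smul, smul_apply, smul_eq_mul]

theorem IsSlopeRootAt.unique {x : M} (hW : IsMildWind (η - η') (1 - η) (hnorm h x (gravWind h p g x)))
    {y : TangentSpace (𝓡 n) x} {z₁ z₂ : ℝ} (h₁ : IsSlopeRootAt h p g η η' x y z₁)
    (h₂ : IsSlopeRootAt h p g η η' x y z₂) : z₁ = z₂ :=
  hW.isSlopeRoot_unique (riem_self_nonneg h x y) (sq_inner_le h x _ _) h₁ h₂

theorem exists_isSlopeRootAt {x : M}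
    (hW : IsMildWind (η - η') (1 - η) (hnorm h x (gravWind h p g x)))
    {y : TangentSpace (𝓡 n) x} (hy : y ≠ 0) : ∃ z, IsSlopeRootAt h p g η η' x y z :=
  hW.exists_isSlopeRoot (h.pos x y hy) (sq_inner_le h x _ _)

theorem not_isSlopeRootAt_zero {x : M}
    (hW : IsMildWind (η - η') (1 - η) (hnorm h x (gravWind h p g x))) {z : ℝ} :
    ¬IsSlopeRootAt h p g η η' x 0 z := by
  have := hW.not_isSlopeRoot_zero (b := 0) (z := z) (by simp)
  simpa [IsSlopeRootAt] using this

variable {F : TangentBundle (𝓡 n) M → ℝ}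

theorem IsSlopeMetric.map_zero (hF : IsSlopeMetric h p g η η' F) (x : M) : F ⟨x, 0⟩ = 0 := by
  have h1 := hF.homogeneous x 0 2 two_pos
  rw [smul_zero] at h1
  linarith

/-- If z is the root at y, then y/z has root 1 and is a resultant velocity. The indicatrix condition
and homogeneity then leave z as the only possible value at y. -/
theorem IsSlopeMetric.isSlopeRootAt (hF : IsSlopeMetric h p g η η' F) {x : M}
    (hW : IsMildWind (η - η') (1 - η) (hnorm h x (gravWind h p g x)))
    {y : TangentSpace (𝓡 n) x} (hy : y ≠ 0) : IsSlopeRootAt h p g η η' x y (F ⟨x, y⟩) := by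
  obtain ⟨z, hz⟩ := exists_isSlopeRootAt (p := p) (g := g) hW hy
  have hz0 := hz.pos
  have h1 := hz.smul (inv_pos.2 hz0)
  rw [inv_mul_cancel₀ hz0.ne'] at h1
  have h2 := (hF.indicatrix x _).2 ((isResultantVelocity_iff hW).2 h1)
  rw [hF.homogeneous x y _ (inv_pos.2 hz0), inv_mul_eq_one₀ hz0.ne'] at h2
  rwa [← h2]

theorem IsSlopeMetric.eq_slopeVal (hF : IsSlopeMetric h p g η η' F) {x : M}
    (hW : IsMildWind (η - η') (1 - η) (hnorm h x (gravWind h p g x))) (y : TangentSpace (𝓡 n) x) :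
    F ⟨x, y⟩ = slopeVal (η - η') (1 - η) (h.inner x y y) (h.inner x y (gravWind h p g x))
      (hnorm h x (gravWind h p g x) ^ 2) := by
  by_cases hy : y = 0
  · subst hy
    rw [hF.map_zero, slopeVal, dif_neg]
    rintro ⟨z, hz⟩
    exact not_isSlopeRootAt_zero hW hz
  · exact (hF.isSlopeRootAt hW hy).unique hW (isSlopeRoot_slopeVal (exists_isSlopeRootAt hW hy))

theorem isSlopeMetric_slopeVal
    (hW : ∀ x, IsMildWind (η - η') (1 - η) (hnorm h x (gravWind h p g x))) :
    IsSlopeMetric h p g η η' fun v => slopeVal (η - η') (1 - η) (h.inner v.1 v.2 v.2)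
      (h.inner v.1 v.2 (gravWind h p g v.1)) (hnorm h v.1 (gravWind h p g v.1) ^ 2) := by
  have hroot : ∀ x (y : TangentSpace (𝓡 n) x), y ≠ 0 → IsSlopeRootAt h p g η η' x y
      (slopeVal (η - η') (1 - η) (h.inner x y y) (h.inner x y (gravWind h p g x))
        (hnorm h x (gravWind h p g x) ^ 2)) := fun x y hy =>
    isSlopeRoot_slopeVal (exists_isSlopeRootAt (hW x) hy)
  have hzero : ∀ x, slopeVal (η - η') (1 - η) (h.inner x 0 0) (h.inner x 0 (gravWind h p g x))
        (hnorm h x (gravWind h p g x) ^ 2) = 0 := fun x => by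
    rw [slopeVal, dif_neg]
    rintro ⟨z, hz⟩
    exact not_isSlopeRootAt_zero (hW x) hz
  refine ⟨fun v => slopeVal_nonneg, fun x y t ht => ?_, fun x y => ?_⟩
  · by_cases hy : y = 0
    · subst hy
      simp only [smul_zero]
      rw [hzero, mul_zero]
    · exact (hroot x (t • y) (smul_ne_zero ht.ne' hy)).unique (hW x) ((hroot x y hy).smul ht)
  · rw [isResultantVelocity_iff (hW x)]
    by_cases hy : y = 0
    · subst hy
      refine ⟨fun h0 => ?_, fun h0 => absurd h0 (not_isSlopeRootAt_zero (hW x))⟩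
      simp only at h0
      rw [hzero] at h0
      exact absurd h0 zero_ne_one
    · exact ⟨fun h1 => h1 ▸ hroot x y hy, fun h1 => (hroot x y hy).unique (hW x) h1⟩

end SlopePointwise

/-! ### Smoothness of the metric, of y ↦ ⟨y, G⟩ and of ‖G‖². -/

section SmoothData

variable {n : ℕ} {M : Type*} [TopologicalSpace M] [ChartedSpace (EuclideanSpace ℝ (Fin n)) M]
  [IsManifold (𝓡 n) ∞ M]

theorem contMDiffOn_riem_inner (h : RiemMetric n M) {EM HM N : Type*} [NormedAddCommGroup EM]
    [NormedSpace ℝ EM] [TopologicalSpace HM] {IM : ModelWithCorners ℝ EM HM} [TopologicalSpace N]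
    [ChartedSpace HM N] {b : N → M} {v w : ∀ m, TangentSpace (𝓡 n) (b m)} {s : Set N}
    (hv : ContMDiffOn IM (𝓡 n).tangent ∞ (fun m => (⟨b m, v m⟩ : TangentBundle (𝓡 n) M)) s)
    (hw : ContMDiffOn IM (𝓡 n).tangent ∞ (fun m => (⟨b m, w m⟩ : TangentBundle (𝓡 n) M)) s) :
    ContMDiffOn IM 𝓘(ℝ, ℝ) ∞ (fun m => h.inner (b m) (v m) (w m)) s := by
  intro x hx
  have hb : ContMDiffWithinAt IM (𝓡 n) ∞ b s x := by
    have := hv x hx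
    simp only [contMDiffWithinAt_totalSpace] at this
    exact this.1
  have : ContMDiffWithinAt IM ((𝓡 n).prod 𝓘(ℝ)) ∞
      (fun m => TotalSpace.mk' ℝ (E := Bundle.Trivial M ℝ) (b m) (h.inner (b m) (v m) (w m)))
      s x := by
    apply ContMDiffWithinAt.clm_bundle_apply₂ (F₁ := Coord n) (F₂ := Coord n)
    · exact ContMDiffAt.comp_contMDiffWithinAt x h.contMDiff.contMDiffAt hb
    · exact hv x hx
    · exact hw x hx
  simp only [contMDiffWithinAt_totalSpace] at this
  exact this.2

theorem contMDiff_riem_self (h : RiemMetric n M) : ContMDiff (𝓡 n).tangent 𝓘(ℝ, ℝ) ∞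
    (fun v : TangentBundle (𝓡 n) M => h.inner v.1 v.2 v.2) := by
  rw [← contMDiffOn_univ]
  exact contMDiffOn_riem_inner h (b := fun v : TangentBundle (𝓡 n) M => v.1)
    contMDiffOn_id contMDiffOn_id

/-- The differential of a function. -/
def differential (p : M → ℝ) (x : M) (y : TangentSpace (𝓡 n) x) : ℝ :=
  mfderiv (𝓡 n) 𝓘(ℝ, ℝ) p x y

theorem contMDiff_differential {p : M → ℝ} (hp : ContMDiff (𝓡 n) 𝓘(ℝ, ℝ) ∞ p) :
    ContMDiff (𝓡 n).tangent 𝓘(ℝ, ℝ) ∞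
      (fun v : TangentBundle (𝓡 n) M => differential p v.1 v.2) := by
  have h1 := hp.contMDiff_tangentMap (m := ∞) (by simp)
  exact contMDiff_snd_tangentBundle_modelSpace ℝ 𝓘(ℝ, ℝ) |>.comp h1

/-- The metric in the chart at `x₀`. -/
def chartMetric (h : RiemMetric n M) (x₀ : M) (x : Coord n) : Coord n →L[ℝ] Coord n →L[ℝ] ℝ :=
  ∑ i, ∑ j, h.inner ((extChartAt (𝓡 n) x₀).symm x) (chartLift x₀ (x, coordVec i)).2
    (chartLift x₀ (x, coordVec j)).2 • (EuclideanSpace.proj i : Coord n →L[ℝ] ℝ).smulRight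
      (EuclideanSpace.proj j : Coord n →L[ℝ] ℝ)

theorem chartLift_eq_sum (x₀ : M) (x u : Coord n) :
    mfderiv 𝓘(ℝ, Coord n) (𝓡 n) (extChartAt (𝓡 n) x₀).symm x u =
      ∑ i, u i • mfderiv 𝓘(ℝ, Coord n) (𝓡 n) (extChartAt (𝓡 n) x₀).symm x (coordVec i) := by
  set L := mfderiv 𝓘(ℝ, Coord n) (𝓡 n) (extChartAt (𝓡 n) x₀).symm x
  refine (congrArg L (sum_smul_coordVec u)).symm.trans ?_
  exact (map_sum L _ _).trans (Finset.sum_congr rfl fun i _ => ContinuousLinearMap.map_smul L _ _)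

theorem chartMetric_apply (h : RiemMetric n M) (x₀ : M) (x u w : Coord n) :
    chartMetric h x₀ x u w = h.inner ((extChartAt (𝓡 n) x₀).symm x)
      (mfderiv 𝓘(ℝ, Coord n) (𝓡 n) (extChartAt (𝓡 n) x₀).symm x u)
      (mfderiv 𝓘(ℝ, Coord n) (𝓡 n) (extChartAt (𝓡 n) x₀).symm x w) := by
  have hproj : ∀ (i : Fin n) (u : Coord n), (EuclideanSpace.proj i : Coord n →L[ℝ] ℝ) u = u i :=
    fun _ _ => rfl
  rw [chartLift_eq_sum x₀ x u, chartLift_eq_sum x₀ x w]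
  simp only [chartMetric, chartLift, map_sum, sum_apply, map_smul, smul_apply,
    ContinuousLinearMap.smulRight_apply, hproj, smul_eq_mul, Finset.mul_sum]
  rw [Finset.sum_comm]
  refine Finset.sum_congr rfl fun i _ => Finset.sum_congr rfl fun j _ => ?_
  ring

theorem contMDiffOn_chartLift_const (x₀ : M) (u : Coord n) :
    ContMDiffOn 𝓘(ℝ, Coord n) (𝓡 n).tangent ∞ (fun x => chartLift x₀ (x, u))
      (extChartAt (𝓡 n) x₀).target :=
  (contMDiffOn_chartLift x₀).comp (t := (extChartAt (𝓡 n) x₀).target ×ˢ univ)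
    (contDiff_id.prodMk contDiff_const).contMDiff.contMDiffOn fun _ hx => ⟨hx, mem_univ _⟩

theorem contDiffOn_smul_fixed {X Y : Type*} [NormedAddCommGroup X] [NormedSpace ℝ X]
    [NormedAddCommGroup Y] [NormedSpace ℝ Y] {f : X → ℝ} {s : Set X} (hf : ContDiffOn ℝ ∞ f s)
    (C : Y) : ContDiffOn ℝ ∞ (fun x => f x • C) s :=
  hf.smul contDiffOn_const

theorem contDiffOn_chartMetric (h : RiemMetric n M) (x₀ : M) :
    ContDiffOn ℝ ∞ (chartMetric h x₀) (extChartAt (𝓡 n) x₀).target := by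
  unfold chartMetric
  refine ContDiffOn.sum fun i _ => ContDiffOn.sum fun j _ => ?_
  exact contDiffOn_smul_fixed (contMDiffOn_riem_inner h (contMDiffOn_chartLift_const x₀ (coordVec i))
    (contMDiffOn_chartLift_const x₀ (coordVec j))).contDiffOn _

/-- The squared norm of the gradient is smooth. -/
theorem contMDiff_gradient_sq (h : RiemMetric n M) {p : M → ℝ}
    (hp : ContMDiff (𝓡 n) 𝓘(ℝ, ℝ) ∞ p) : ContMDiff (𝓡 n) 𝓘(ℝ, ℝ) ∞
      (fun x => h.inner x (gradient h p x) (gradient h p x)) := by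
  intro x₀
  set φ := extChartAt (𝓡 n) x₀ with hφ
  have hx₀ : φ x₀ ∈ φ.target := mem_extChartAt_target (I := 𝓡 n) x₀
  have hT : IsOpen φ.target := isOpen_extChartAt_target x₀
  have hps : ContDiffOn ℝ ∞ (fun x => p (φ.symm x)) φ.target :=
    (hp.comp_contMDiffOn (contMDiffOn_extChartAt_symm (n := ∞) x₀)).contDiffOn
  have hd : ContDiffOn ℝ ∞ (fderiv ℝ fun x => p (φ.symm x)) φ.target :=
    hps.fderiv_of_isOpen hT (by simp)
  -- the gradient in coordinates
  have key : ∀ x ∈ φ.target, ∃ e : Coord n ≃L[ℝ] (Coord n →L[ℝ] ℝ),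
      (e : Coord n →L[ℝ] Coord n →L[ℝ] ℝ) = chartMetric h x₀ x ∧
      h.inner (φ.symm x) (gradient h p (φ.symm x)) (gradient h p (φ.symm x)) =
        fderiv ℝ (fun x => p (φ.symm x)) x
          ((chartMetric h x₀ x).inverse (fderiv ℝ (fun x => p (φ.symm x)) x)) := by
    intro x hx
    set L : Coord n →L[ℝ] TangentSpace (𝓡 n) (φ.symm x) :=
      mfderiv 𝓘(ℝ, Coord n) (𝓡 n) φ.symm x with hL
    have hLi : Function.Bijective L := (mfderiv_extChartAt_symm_isInvertible x₀ hx).bijective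
    have hpos : ∀ u, u ≠ 0 → 0 < chartMetric h x₀ x u u := fun u hu => by
      rw [chartMetric_apply]
      exact h.pos _ _ fun h0 => hu (hLi.1 (h0.trans (_root_.map_zero L).symm))
    have hinj : Function.Injective (chartMetric h x₀ x).toLinearMap := by
      rw [← LinearMap.ker_eq_bot, LinearMap.ker_eq_bot']
      intro w hw
      by_contra hne
      have h2 : chartMetric h x₀ x w w = 0 := by
        have : chartMetric h x₀ x w = 0 := hw
        rw [this]; rfl
      exact absurd h2 (hpos w hne).ne'
    have hdim : Module.finrank ℝ (Coord n) = Module.finrank ℝ (Coord n →L[ℝ] ℝ) := by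
      rw [← (LinearMap.toContinuousLinearMap (𝕜 := ℝ) (E := Coord n) (F' := ℝ)).finrank_eq]
      exact (Subspace.dual_finrank_eq (K := ℝ) (V := Coord n)).symm
    set e : Coord n ≃L[ℝ] (Coord n →L[ℝ] ℝ) := (LinearEquiv.ofInjectiveOfFinrankEq
      (chartMetric h x₀ x).toLinearMap hinj hdim).toContinuousLinearEquiv with he
    have hee : (e : Coord n →L[ℝ] Coord n →L[ℝ] ℝ) = chartMetric h x₀ x := by
      ext w w'
      rfl
    refine ⟨e, hee, ?_⟩
    have hchain : ∀ u, fderiv ℝ (fun x => p (φ.symm x)) x u =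
        mfderiv (𝓡 n) 𝓘(ℝ, ℝ) p (φ.symm x) (L u) := by
      intro u
      have hd1 : MDifferentiableAt 𝓘(ℝ, Coord n) (𝓡 n) φ.symm x :=
        ((contMDiffOn_extChartAt_symm (n := ∞) x₀).contMDiffAt (hT.mem_nhds hx)
          ).mdifferentiableAt (by simp)
      have hd2 : MDifferentiableAt (𝓡 n) 𝓘(ℝ, ℝ) p (φ.symm x) :=
        hp.contMDiffAt.mdifferentiableAt (by simp)
      have h1 := mfderiv_comp x hd2 hd1
      rw [← mfderiv_eq_fderiv]
      exact DFunLike.congr_fun h1 u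
    set q := (chartMetric h x₀ x).inverse (fderiv ℝ (fun x => p (φ.symm x)) x) with hq
    have hHq : chartMetric h x₀ x q = fderiv ℝ (fun x => p (φ.symm x)) x := by
      rw [hq, ← hee, ContinuousLinearMap.inverse_equiv]
      simp
    -- The gradient is a pointwise choice and carries no smoothness of its own. In coordinates it is
    -- the inverse metric applied to the differential, which depends smoothly on the point.
    have hgrad : gradient h p (φ.symm x) = L q := by
      have h3 : ∀ y, h.inner (φ.symm x) (gradient h p (φ.symm x) - L q) y = 0 := by
        intro y
        obtain ⟨w, rfl⟩ := hLi.2 y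
        rw [map_sub, sub_apply, inner_gradient, ← hchain, ← hHq, chartMetric_apply]
        exact sub_self _
      by_contra hne
      exact absurd (h3 _) (h.pos _ _ (sub_ne_zero.2 hne)).ne'
    rw [inner_gradient, hgrad, hchain]
  have hN : ContDiffAt ℝ ∞ (fun x => fderiv ℝ (fun x => p (φ.symm x)) x
      ((chartMetric h x₀ x).inverse (fderiv ℝ (fun x => p (φ.symm x)) x))) (φ x₀) := by
    obtain ⟨e, he, -⟩ := key _ hx₀
    have hI : ContDiffAt ℝ ∞ (fun x => (chartMetric h x₀ x).inverse) (φ x₀) := by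
      have := contDiffAt_map_inverse (𝕜 := ℝ) (n := ∞) e
      rw [he] at this
      exact this.comp (φ x₀) ((contDiffOn_chartMetric h x₀).contDiffAt (hT.mem_nhds hx₀))
    have hd' := hd.contDiffAt (hT.mem_nhds hx₀)
    exact hd'.clm_apply (hI.clm_apply hd')
  have h5 : ContMDiffAt (𝓡 n) 𝓘(ℝ, ℝ) ∞ (fun y => fderiv ℝ (fun x => p (φ.symm x)) (φ y)
      ((chartMetric h x₀ (φ y)).inverse (fderiv ℝ (fun x => p (φ.symm x)) (φ y)))) x₀ :=
    ContMDiffAt.comp (I' := 𝓘(ℝ, Coord n)) x₀ hN.contMDiffAt contMDiffAt_extChartAt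
  refine h5.congr_of_eventuallyEq ?_
  filter_upwards [(isOpen_extChartAt_source (I := 𝓡 n) x₀).mem_nhds
    (mem_extChartAt_source (I := 𝓡 n) x₀)] with y hy
  obtain ⟨e, -, h6⟩ := key (φ y) (φ.map_source hy)
  rw [φ.left_inv hy] at h6
  exact h6

variable (h : RiemMetric n M) {p : M → ℝ} (g : ℝ)

theorem inner_gravWind (x : M) (y : TangentSpace (𝓡 n) x) :
    h.inner x y (gravWind h p g x) = -(g * differential p x y) := by
  rw [gravWind, map_neg, map_smul, smul_eq_mul, h.symm, inner_gradient]
  rfl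

theorem contMDiff_inner_gravWind (hp : ContMDiff (𝓡 n) 𝓘(ℝ, ℝ) ∞ p) :
    ContMDiff (𝓡 n).tangent 𝓘(ℝ, ℝ) ∞
      (fun v : TangentBundle (𝓡 n) M => h.inner v.1 v.2 (gravWind h p g v.1)) := by
  simp only [inner_gravWind]
  exact (contMDiff_const.mul (contMDiff_differential hp)).neg

theorem contMDiff_hnorm_gravWind_sq (hp : ContMDiff (𝓡 n) 𝓘(ℝ, ℝ) ∞ p) :
    ContMDiff (𝓡 n) 𝓘(ℝ, ℝ) ∞ (fun x => hnorm h x (gravWind h p g x) ^ 2) := by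
  have h1 : ∀ x, hnorm h x (gravWind h p g x) ^ 2 =
      g ^ 2 * h.inner x (gradient h p x) (gradient h p x) := fun x => by
    rw [hnorm_sq, gravWind]
    simp only [map_neg, map_smul, neg_apply, smul_apply, smul_eq_mul]
    ring
  simp only [h1]
  exact contMDiff_const.mul (contMDiff_gradient_sq h hp)

end SmoothData

/-! ### Two-jets of functions of one variable, and the algebra behind strong convexity. -/

section Jets

/-- `f` has the value `f₀` and the first two derivatives `f₁`, `f₂` at `0`. -/
def HasJet (f : ℝ → ℝ) (f₀ f₁ f₂ : ℝ) : Prop :=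
  ∃ f' : ℝ → ℝ, f 0 = f₀ ∧ (∀ᶠ t in 𝓝 0, HasDerivAt f (f' t) t) ∧ f' 0 = f₁ ∧ HasDerivAt f' f₂ 0

namespace HasJet

variable {f g : ℝ → ℝ} {f₀ f₁ f₂ g₀ g₁ g₂ : ℝ}

theorem mul (hf : HasJet f f₀ f₁ f₂) (hg : HasJet g g₀ g₁ g₂) :
    HasJet (fun t => f t * g t) (f₀ * g₀) (f₁ * g₀ + f₀ * g₁)
      (f₂ * g₀ + 2 * (f₁ * g₁) + f₀ * g₂) := by
  obtain ⟨f', hf0, hf', hf1, hf2⟩ := hf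
  obtain ⟨g', hg0, hg', hg1, hg2⟩ := hg
  refine ⟨fun t => f' t * g t + f t * g' t, by simp only [hf0, hg0], ?_,
    by simp only [hf0, hg0, hf1, hg1], ?_⟩
  · filter_upwards [hf', hg'] with t h1 h2 using h1.mul h2
  · refine ((hf2.mul hg'.self_of_nhds).add (hf'.self_of_nhds.mul hg2)).congr_deriv ?_
    rw [hf0, hg0, hf1, hg1]
    ring

theorem add (hf : HasJet f f₀ f₁ f₂) (hg : HasJet g g₀ g₁ g₂) :
    HasJet (fun t => f t + g t) (f₀ + g₀) (f₁ + g₁) (f₂ + g₂) := by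
  obtain ⟨f', hf0, hf', hf1, hf2⟩ := hf
  obtain ⟨g', hg0, hg', hg1, hg2⟩ := hg
  refine ⟨fun t => f' t + g' t, by simp only [hf0, hg0], ?_, by simp only [hf1, hg1],
    hf2.add hg2⟩
  filter_upwards [hf', hg'] with t h1 h2 using h1.add h2

theorem const_mul (hf : HasJet f f₀ f₁ f₂) (r : ℝ) :
    HasJet (fun t => r * f t) (r * f₀) (r * f₁) (r * f₂) := by
  obtain ⟨f', hf0, hf', hf1, hf2⟩ := hf
  refine ⟨fun t => r * f' t, by simp only [hf0], ?_, by simp only [hf1], hf2.const_mul r⟩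
  filter_upwards [hf'] with t h1 using h1.const_mul r

theorem unique (hf : HasJet f f₀ f₁ f₂) (hg : HasJet g g₀ g₁ g₂) (h : f =ᶠ[𝓝 0] g) :
    f₀ = g₀ ∧ f₁ = g₁ ∧ f₂ = g₂ := by
  obtain ⟨f', hf0, hf', hf1, hf2⟩ := hf
  obtain ⟨g', hg0, hg', hg1, hg2⟩ := hg
  have h' : f' =ᶠ[𝓝 0] g' := by
    filter_upwards [hf', hg', h.eventuallyEq_nhds] with t h1 h2 h3
    exact h1.unique (h2.congr_of_eventuallyEq h3)
  exact ⟨by rw [← hf0, ← hg0, h.self_of_nhds], by rw [← hf1, ← hg1, h'.self_of_nhds],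
    hf2.unique (hg2.congr_of_eventuallyEq h')⟩

theorem of_contDiffAt (hf : ContDiffAt ℝ ∞ f 0) :
    HasJet f (f 0) (deriv f 0) (deriv (deriv f) 0) := by
  refine ⟨deriv f, rfl, ?_, rfl, ?_⟩
  · filter_upwards [(hf.of_le (m := 1) (by simp)).eventually (by simp)] with t ht
    exact (ht.differentiableAt (by simp)).hasDerivAt
  · have h1 : ContDiffAt ℝ ∞ (deriv f) 0 := by
      have := (hf.fderiv_right (m := ∞) (by simp)).clm_apply (contDiffAt_const (c := (1 : ℝ)))
      exact this
    exact (h1.differentiableAt (by simp)).hasDerivAt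

theorem iteratedDeriv_two (hf : HasJet f f₀ f₁ f₂) : iteratedDeriv 2 f 0 = f₂ := by
  obtain ⟨f', -, hf', -, hf2⟩ := hf
  rw [iteratedDeriv_succ, iteratedDeriv_one]
  have : deriv f =ᶠ[𝓝 0] f' := hf'.mono fun t ht => ht.deriv
  rw [this.deriv_eq, hf2.deriv]

theorem quadratic (r s t : ℝ) : HasJet (fun x => r + x * s + x ^ 2 * t) r s (2 * t) := by
  refine ⟨fun x => s + x * (2 * t), by simp, Eventually.of_forall fun x => ?_, by simp, ?_⟩
  · refine ((((hasDerivAt_id x).mul_const s).const_add r).add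
      (((hasDerivAt_id x).pow 2).mul_const t)).congr_deriv ?_
    simp
    ring
  · exact (((hasDerivAt_id (0 : ℝ)).mul_const (2 * t)).const_add s).congr_deriv (by ring)

end HasJet

/-- The algebra of strong convexity. -/
theorem convexity_algebra {c k N f₀ f₁ f₂ a₀ a₁ a₂ β₀ β₁ T W : ℝ} (ha : 0 < a₀)
    (hD : 0 < a₀ + c * β₀) (hf : 0 < 2 * a₀ - f₀)
    (hK : 0 < (a₀ + c * β₀) + (2 * a₀ - f₀) * k * β₀ / a₀ - f₀ * k * c * N)
    (h₀ : a₀ ^ 2 = f₀ * (a₀ + c * β₀))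
    (h₁ : 2 * (a₀ * a₁) = f₁ * (a₀ + c * β₀) + f₀ * (a₁ + c * β₁))
    (h₂ : 2 * (a₀ * a₂) + 2 * a₁ ^ 2 =
      f₂ * (a₀ + c * β₀) + 2 * (f₁ * (a₁ + c * β₁)) + f₀ * (a₂ + c * (-(k * N * f₂))))
    (hT : a₀ * a₂ = T - a₁ ^ 2 - k * f₂ * β₀) (hcs : a₁ ^ 2 ≤ T)
    (hW : f₁ = 0 → T = W) (hWpos : 0 < W) : 0 < f₁ ^ 2 + f₀ * f₂ := by
  set D := a₀ + c * β₀ with hDdef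
  set D₁ := a₁ + c * β₁ with hD₁
  have hf₀ : f₀ = a₀ ^ 2 / D := by rw [eq_div_iff hD.ne', h₀]
  have hf₀pos : 0 < f₀ := by rw [hf₀]; positivity
  have hf₁ : f₁ = (2 * (a₀ * a₁) - f₀ * D₁) / D := by rw [eq_div_iff hD.ne']; linarith
  have ha₂ : a₂ = (T - a₁ ^ 2 - k * f₂ * β₀) / a₀ := by rw [eq_div_iff ha.ne']; linarith
  -- Eliminating a₂ and f₁ from the twice differentiated equation. The factor of f₂ is the
  -- transversality expression, and the right side is a square plus the Cauchy–Schwarz defect T -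
  -- a₁² with a positive coefficient, so f₂ ≥ 0.
  have key : f₂ * (D + (2 * a₀ - f₀) * k * β₀ / a₀ - f₀ * k * c * N) =
      2 * (a₁ - a₀ * D₁ / D) ^ 2 + (2 * a₀ - f₀) * (T - a₁ ^ 2) / a₀ := by
    have e1 : f₂ * (D + (2 * a₀ - f₀) * k * β₀ / a₀ - f₀ * k * c * N) =
        2 * a₁ ^ 2 - 2 * (f₁ * D₁) + (2 * a₀ - f₀) * (a₂ + k * f₂ * β₀ / a₀) := by
      linear_combination -h₂
    have e2 : a₂ + k * f₂ * β₀ / a₀ = (T - a₁ ^ 2) / a₀ := by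
      rw [ha₂]; field_simp; ring
    have e3 : 2 * a₁ ^ 2 - 2 * (f₁ * D₁) = 2 * (a₁ - a₀ * D₁ / D) ^ 2 := by
      rw [hf₁, hf₀]; field_simp; ring
    rw [e1, e2, e3]
    ring
  have hr : 0 ≤ (2 * a₀ - f₀) * (T - a₁ ^ 2) / a₀ :=
    div_nonneg (mul_nonneg hf.le (by linarith)) ha.le
  have hf₂ : 0 ≤ f₂ := by
    refine nonneg_of_mul_nonneg_left (a := f₂) ?_ hK
    rw [key]
    positivity
  -- Equality requires f₁ = f₂ = 0. Then both terms on the right of `key` vanish, the once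
  -- differentiated equation gives a₁ = 0, and T = a₁² = 0 contradicts T = W > 0.
  by_contra hcon
  have hff : 0 ≤ f₀ * f₂ := mul_nonneg hf₀pos.le hf₂
  have hf₁0 : f₁ = 0 := by
    have := sq_nonneg f₁
    exact (pow_eq_zero_iff two_ne_zero).1 (by linarith)
  have hf₂0 : f₂ = 0 := by
    have := sq_nonneg f₁
    have h3 : f₀ * f₂ = 0 := by linarith
    exact (mul_eq_zero.1 h3).resolve_left hf₀pos.ne'
  rw [hf₂0, zero_mul] at key
  have k0 := sq_nonneg (a₁ - a₀ * D₁ / D)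
  have k1 : (a₁ - a₀ * D₁ / D) ^ 2 = 0 := by linarith
  have k2 : (2 * a₀ - f₀) * (T - a₁ ^ 2) / a₀ = 0 := by linarith
  have k3 : T = a₁ ^ 2 := by
    rcases (div_eq_zero_iff.1 k2) with h | h
    · rcases mul_eq_zero.1 h with h | h <;> linarith
    · linarith
  have k4 : a₁ = a₀ * D₁ / D := by
    have := pow_eq_zero_iff (two_ne_zero) |>.1 k1
    linarith
  have k5 : f₀ * D₁ = a₀ * a₁ := by rw [k4, hf₀]; field_simp
  rw [hf₁0, zero_mul, zero_add, k5] at h₁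
  have k6 : a₁ = 0 := by
    have : a₀ * a₁ = 0 := by linarith
    exact (mul_eq_zero.1 this).resolve_left ha.ne'
  have := hW hf₁0
  rw [k3, k6] at this
  norm_num at this
  linarith

end Jets

/-- Since (2a - z)(a + cβ) = a(a + 2cβ), this sign is exactly where 2|c|γ < 1 enters the convexity
argument. -/
theorem IsMildWind.root_lt {c k γ a β z : ℝ} (h : IsMildWind c k γ) (ha : 0 < a)
    (hβ : |β| ≤ γ * a) (hz : a ^ 2 = z * (a + c * β)) : 0 < 2 * a - z := by
  have h1 : |c * β| < a / 2 := by
    rw [abs_mul]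
    have h1 : |c| * |β| ≤ |c| * (γ * a) := by gcongr
    have h2 := mul_lt_mul_of_pos_right h.slide ha
    linarith
  have h2 := (abs_lt.1 h1).1
  have hD : 0 < a + c * β := by linarith
  have h3 : (2 * a - z) * (a + c * β) = a * (a + 2 * (c * β)) := by linear_combination hz
  exact (mul_pos_iff_of_pos_right hD).1 (by rw [h3]; exact mul_pos ha (by linarith))

/-! ### Under a mild wind the slope metric is a Finsler metric. -/

section SlopeIsFinsler

variable {n : ℕ} {M : Type*} [TopologicalSpace M] [ChartedSpace (EuclideanSpace ℝ (Fin n)) M]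
  [IsManifold (𝓡 n) ∞ M] {h : RiemMetric n M} {p : M → ℝ} {g η η' : ℝ}
  {F : TangentBundle (𝓡 n) M → ℝ}

/-- The implicit function gives a smooth local root in terms of (‖y‖², ⟨y, G⟩, ‖G‖²), and uniqueness
of roots identifies it with F nearby. -/
theorem IsSlopeMetric.contMDiffAt (hF : IsSlopeMetric h p g η η' F)
    (hp : ContMDiff (𝓡 n) 𝓘(ℝ, ℝ) ∞ p)
    (hW : ∀ x, IsMildWind (η - η') (1 - η) (hnorm h x (gravWind h p g x)))
    {v : TangentBundle (𝓡 n) M} (hv : v.2 ≠ 0) : ContMDiffAt (𝓡 n).tangent 𝓘(ℝ, ℝ) ∞ F v := by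
  obtain ⟨ψ, hψ, hev⟩ := (hW v.1).exists_contDiffAt_root (riem_self_nonneg h v.1 v.2)
    (sq_inner_le h v.1 _ _) (hF.isSlopeRootAt (hW v.1) hv)
  have hproj : ContMDiff (𝓡 n).tangent (𝓡 n) ∞ (fun v : TangentBundle (𝓡 n) M => v.1) :=
    contMDiff_proj _
  have hq : ContMDiff (𝓡 n).tangent 𝓘(ℝ, ℝ × ℝ × ℝ) ∞ (fun v : TangentBundle (𝓡 n) M =>
      (h.inner v.1 v.2 v.2, h.inner v.1 v.2 (gravWind h p g v.1),
        hnorm h v.1 (gravWind h p g v.1) ^ 2)) :=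
    (contMDiff_riem_self h).prodMk_space ((contMDiff_inner_gravWind h g hp).prodMk_space
      ((contMDiff_hnorm_gravWind_sq h g hp).comp hproj))
  have h1 := ContMDiffAt.comp v hψ.contMDiffAt hq.contMDiffAt
  refine h1.congr_of_eventuallyEq ?_
  filter_upwards [hq.continuous.continuousAt.eventually hev] with w hw
  have hw' : IsSlopeRootAt h p g η η' w.1 w.2 (ψ (h.inner w.1 w.2 w.2,
    h.inner w.1 w.2 (gravWind h p g w.1), hnorm h w.1 (gravWind h p g w.1) ^ 2)) := hw
  have hw2 : w.2 ≠ 0 := fun h0 => by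
    rw [h0] at hw'
    exact not_isSlopeRootAt_zero (hW w.1) hw'
  exact (hF.isSlopeRootAt (hW w.1) hw2).unique (hW w.1) hw'

theorem IsSlopeMetric.continuous (hF : IsSlopeMetric h p g η η' F)
    (hp : ContMDiff (𝓡 n) 𝓘(ℝ, ℝ) ∞ p)
    (hW : ∀ x, IsMildWind (η - η') (1 - η) (hnorm h x (gravWind h p g x))) : Continuous F := by
  rw [continuous_iff_continuousAt]
  intro v
  by_cases hv : v.2 = 0
  · have hFv : F v = 0 := by
      have := hF.map_zero v.1
      rwa [← hv] at this
    have hproj : ContMDiff (𝓡 n).tangent (𝓡 n) ∞ (fun v : TangentBundle (𝓡 n) M => v.1) :=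
      contMDiff_proj _
    have hγ : Continuous fun v : TangentBundle (𝓡 n) M => hnorm h v.1 (gravWind h p g v.1) := by
      have h1 := (((contMDiff_hnorm_gravWind_sq h g hp).comp hproj).continuous).sqrt
      refine h1.congr fun w => ?_
      exact Real.sqrt_sq (hnorm_nonneg h _ _)
    have hb : Continuous fun v : TangentBundle (𝓡 n) M => 3 * √(h.inner v.1 v.2 v.2) /
        (1 - (η - η' + (1 - η)) * hnorm h v.1 (gravWind h p g v.1)) := by
      refine (continuous_const.mul (contMDiff_riem_self h).continuous.sqrt).div
        (continuous_const.sub (continuous_const.mul hγ)) fun w => ?_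
      linarith [(hW w.1).total]
    rw [ContinuousAt, hFv]
    refine squeeze_zero hF.nonneg (fun w => ?_) ?_ (g := fun v => 3 * √(h.inner v.1 v.2 v.2) /
        (1 - (η - η' + (1 - η)) * hnorm h v.1 (gravWind h p g v.1)))
    · by_cases hw : w.2 = 0
      · have hFw : F w = 0 := by
          have := hF.map_zero w.1
          rwa [← hw] at this
        rw [hFw]
        exact div_nonneg (by positivity) (by linarith [(hW w.1).total])
      · exact (hW w.1).isSlopeRoot_le (riem_self_nonneg h w.1 w.2) (sq_inner_le h w.1 _ _)
          (hF.isSlopeRootAt (hW w.1) hw)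
    · have := hb.tendsto v
      rwa [hv, _root_.map_zero, Real.sqrt_zero, mul_zero, zero_div] at this
  · exact (hF.contMDiffAt hp hW hv).continuousAt

/-- Along the line y + tw let f be the metric and a the length of y + tw - kfG. The relations a² =
`windSq` and a² = f(a + cβ) hold near t = 0. Comparing their two-jets gives the hypotheses of
`convexity_algebra`. -/
theorem IsSlopeMetric.strongly_convex (hF : IsSlopeMetric h p g η η' F)
    (hW : ∀ x, IsMildWind (η - η') (1 - η) (hnorm h x (gravWind h p g x))) (x : M)
    (y w : TangentSpace (𝓡 n) x) (hy : y ≠ 0) (hw : w ≠ 0) :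
    0 < 1 / 2 * iteratedDeriv 2 (fun t : ℝ => F ⟨x, y + t • w⟩ ^ 2) 0 := by
  have hWx := hW x
  set G := gravWind h p g x with hG
  set c := η - η' with hc
  set k := 1 - η with hk
  set γ := hnorm h x G with hγ
  set N := γ ^ 2 with hN
  have hNG : h.inner x G G = N := (hnorm_sq h x G).symm
  set f : ℝ → ℝ := fun t => F ⟨x, y + t • w⟩ with hf
  set Q : ℝ → ℝ := fun t => h.inner x y y + t * (2 * h.inner x y w) + t ^ 2 * h.inner x w w with hQ
  set b : ℝ → ℝ := fun t => h.inner x y G + t * h.inner x w G + t ^ 2 * 0 with hb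
  have hQt : ∀ t : ℝ, h.inner x (y + t • w) (y + t • w) = Q t := fun t => by
    simp only [map_add, map_smul, add_apply, smul_apply, smul_eq_mul, hQ]
    rw [h.symm x w y]
    ring
  have hbt : ∀ t : ℝ, h.inner x (y + t • w) G = b t := fun t => by
    simp only [map_add, map_smul, add_apply, smul_apply, smul_eq_mul, hb]
    ring
  have hyt : ∀ᶠ t in 𝓝 (0 : ℝ), 0 < Q t := by
    have hc : ContinuousAt Q 0 := by fun_prop
    refine hc.eventually (lt_mem_nhds ?_)
    simpa [hQ] using h.pos x y hy
  have hroot : ∀ t, 0 < Q t → IsSlopeRoot c k (Q t) (b t) N (f t) := fun t ht => by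
    have hne : y + t • w ≠ 0 := fun h0 => by
      rw [← hQt, h0] at ht
      simp at ht
    have := hF.isSlopeRootAt hWx hne
    rwa [IsSlopeRootAt, hQt, hbt] at this
  have hbQ : ∀ t, b t ^ 2 ≤ Q t * γ ^ 2 := fun t => by
    rw [← hQt, ← hbt]; exact sq_inner_le h x _ _
  have hfs : ContDiffAt ℝ ∞ f 0 := by
    obtain ⟨ψ, hψ, hev⟩ := hWx.exists_contDiffAt_root hyt.self_of_nhds.le (hbQ 0)
      (hroot 0 hyt.self_of_nhds)
    have hq : ContDiff ℝ ∞ fun t => (Q t, b t, N) := by fun_prop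
    refine (ContDiffAt.comp (0 : ℝ) (g := ψ) hψ hq.contDiffAt).congr_of_eventuallyEq ?_
    filter_upwards [hyt, hq.continuous.continuousAt.eventually hev] with t h1 h2
    exact hWx.isSlopeRoot_unique h1.le (hbQ t) (hroot t h1) h2
  set P : ℝ → ℝ := fun t => windSq k (Q t) (b t) N (f t) with hP
  have hPpos : 0 < P 0 := (hroot 0 hyt.self_of_nhds).sq_pos
  have hPs : ContDiffAt ℝ ∞ P 0 := by
    have hQs : ContDiffAt ℝ ∞ Q 0 := by fun_prop
    have hbs : ContDiffAt ℝ ∞ b 0 := by fun_prop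
    simp only [hP, windSq]
    fun_prop
  set a : ℝ → ℝ := fun t => √(P t) with ha
  have has : ContDiffAt ℝ ∞ a 0 := hPs.sqrt hPpos.ne'
  obtain ⟨f₁, f₂, jf⟩ : ∃ f₁ f₂, HasJet f (f 0) f₁ f₂ := ⟨_, _, HasJet.of_contDiffAt hfs⟩
  obtain ⟨a₁, a₂, ja⟩ : ∃ a₁ a₂, HasJet a (a 0) a₁ a₂ := ⟨_, _, HasJet.of_contDiffAt has⟩
  have jQ : HasJet Q _ _ _ := HasJet.quadratic _ _ _
  have jb : HasJet b _ _ _ := HasJet.quadratic _ _ _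
  have jP := (jQ.add ((jf.mul jb).const_mul (-2 * k))).add ((jf.mul jf).const_mul (k ^ 2 * N))
  have jβ := jb.add (jf.const_mul (-(k * N)))
  have jR := jf.mul (ja.add (jβ.const_mul c))
  have eaP := (ja.mul ja).unique jP (by
    have := hPs.continuousAt.eventually (lt_mem_nhds hPpos)
    filter_upwards [this] with t ht
    simp only [ha]
    rw [Real.mul_self_sqrt ht.le]
    simp only [hP, windSq]
    ring)
  have eR := (ja.mul ja).unique jR (by
    filter_upwards [hyt] with t ht
    have h1 := hroot t ht
    have h2 : a t * a t = P t := Real.mul_self_sqrt h1.sq_pos.le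
    have h3 : P t = f t * (a t + c * (b t - k * f t * N)) := h1.eq
    rw [h2, h3]
    ring)
  set f₀ := f 0 with hf0
  set a₀ := a 0 with ha0
  set β₀ := h.inner x y G - k * N * f₀ with hβ0
  have ha0pos : 0 < a₀ := Real.sqrt_pos.2 hPpos
  have hβle : |β₀| ≤ γ * a₀ := by
    have := hWx.abs_sub_le hyt.self_of_nhds.le (hbQ 0) f₀
    have e : b 0 - k * f₀ * γ ^ 2 = β₀ := by simp only [hb, hβ0, hN]; ring
    rwa [e] at this
  have hcβ := abs_le.1 (hWx.abs_mul_le ha0pos.le hβle)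
  have e0 : a₀ ^ 2 = f₀ * (a₀ + c * β₀) := by rw [hβ0]; linear_combination eR.1
  have hD : 0 < a₀ + c * β₀ := by linarith
  have h2af : 0 < 2 * a₀ - f₀ := hWx.root_lt ha0pos hβle e0
  -- The second vector is the derivative of the first along the line, so their inner product is
  -- a₀a₁, and Cauchy–Schwarz becomes a₁² ≤ T.
  have hT := riem_cauchy_schwarz h x (y - (k * f₀) • G) (w - (k * f₁) • G)
  have hYY : h.inner x (y - (k * f₀) • G) (y - (k * f₀) • G) = a₀ ^ 2 := by
    rw [inner_sub_smul, hNG]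
    have := eaP.1
    rw [sq, this, windSq]
    ring
  have hTT : h.inner x (w - (k * f₁) • G) (w - (k * f₁) • G) =
      h.inner x w w - 2 * k * f₁ * h.inner x w G + k ^ 2 * f₁ ^ 2 * N := by
    rw [inner_sub_smul, hNG, windSq]
  have hYT : h.inner x (y - (k * f₀) • G) (w - (k * f₁) • G) = a₀ * a₁ := by
    simp only [map_sub, map_smul, sub_apply, smul_apply, smul_eq_mul, hNG]
    rw [h.symm x G w]
    linear_combination -eaP.2.1 / 2
  have jF := (jf.mul jf).iteratedDeriv_two
  have hsq : (fun t : ℝ => F ⟨x, y + t • w⟩ ^ 2) = fun t => f t * f t := by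
    funext t; rw [hf, sq]
  rw [hsq, jF]
  have := convexity_algebra (c := c) (k := k) (N := N) (f₀ := f₀) (f₁ := f₁) (f₂ := f₂) (a₀ := a₀)
    (a₁ := a₁) (a₂ := a₂) (β₀ := β₀) (β₁ := h.inner x w G - k * N * f₁)
    (T := h.inner x (w - (k * f₁) • G) (w - (k * f₁) • G)) (W := h.inner x w w)
    ha0pos hD h2af (hWx.transversal ha0pos hβle e0) e0
    (by rw [hβ0]; linear_combination eR.2.1)
    (by rw [hβ0]; linear_combination eR.2.2)
    (by rw [hTT, hβ0]; linear_combination eaP.2.2 / 2)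
    (by
      rw [hYY, hYT, mul_pow] at hT
      exact le_of_mul_le_mul_left hT (by positivity))
    (fun h0 => by rw [hTT, h0]; ring) (h.pos x w hw)
  linarith

theorem IsSlopeMetric.isFinslerMetric (hF : IsSlopeMetric h p g η η' F)
    (hp : ContMDiff (𝓡 n) 𝓘(ℝ, ℝ) ∞ p)
    (hW : ∀ x, IsMildWind (η - η') (1 - η) (hnorm h x (gravWind h p g x))) :
    IsFinslerMetric F :=
  ⟨hF.nonneg, hF.continuous hp hW, fun _ hv => (hF.contMDiffAt hp hW hv).contMDiffWithinAt,
    hF.homogeneous, hF.strongly_convex hW⟩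

end SlopeIsFinsler

/-! ### Strong convexity at the axis of a limaçon. -/

section ConvexIndicatrix

variable {V : Type*} [NormedAddCommGroup V] [NormedSpace ℝ V]

theorem fderiv_fderiv_add_fderiv_eq_zero {E : V → ℝ} {v v' : ℝ → V} {v'' : V}
    (hE : ContDiffAt ℝ ∞ E (v 0)) (hv : ∀ t, HasDerivAt v (v' t) t) (hv' : HasDerivAt v' v'' 0)
    (h1 : ∀ t, E (v t) = 1) :
    fderiv ℝ (fderiv ℝ E) (v 0) (v' 0) (v' 0) + fderiv ℝ E (v 0) v'' = 0 := by
  have h2 : ∀ᶠ t in 𝓝 (0 : ℝ), fderiv ℝ E (v t) (v' t) = 0 := by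
    have h3 := (hv 0).continuousAt.eventually
      ((hE.of_le (m := 1) (by simp)).eventually (by simp))
    filter_upwards [h3] with t ht
    have h4 := (ht.differentiableAt (by simp)).hasFDerivAt.comp_hasDerivAt t (hv t)
    exact h4.unique ((hasDerivAt_const t (1 : ℝ)).congr_of_eventuallyEq
      (Eventually.of_forall h1))
  have h5 : HasDerivAt (fun t => fderiv ℝ E (v t)) (fderiv ℝ (fderiv ℝ E) (v 0) (v' 0)) 0 :=
    ((hE.fderiv_right (m := ∞) (by simp)).differentiableAt (by simp)).hasFDerivAt.comp_hasDerivAt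
      0 (hv 0)
  exact (h5.clm_apply hv').unique ((hasDerivAt_const (0 : ℝ) (0 : ℝ)).congr_of_eventuallyEq h2)

/-- A limaçon with a strongly convex interior is not indented. -/
theorem one_add_two_mul_pos_of_convex {Φ : V → ℝ}
    (hom : ∀ (y : V) (c : ℝ), 0 < c → Φ (c • y) = c * Φ y)
    (hsm : ∀ y, y ≠ 0 → ContDiffAt ℝ ∞ Φ y)
    (hconv : ∀ y w, y ≠ 0 → w ≠ 0 → 0 < iteratedDeriv 2 (fun t : ℝ => Φ (y + t • w) ^ 2) 0)
    {e e₁ : V} (he : e ≠ 0) (he₁ : e₁ ≠ 0) {a m : ℝ} (hm : 0 < 1 + a + m)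
    (hΦ : ∀ t : ℝ, Φ ((1 + a * Real.cos t) • (Real.cos t • e + Real.sin t • e₁) + m • e) = 1) :
    0 < 1 + 2 * a := by
  set E : V → ℝ := fun y => Φ y ^ 2 with hE
  set v : ℝ → V := fun t => (1 + a * Real.cos t) • (Real.cos t • e + Real.sin t • e₁) + m • e
    with hv
  set v' : ℝ → V := fun t => (1 + a * Real.cos t) • (-Real.sin t • e + Real.cos t • e₁) +
    (a * -Real.sin t) • (Real.cos t • e + Real.sin t • e₁) with hv'
  have hv0 : v 0 = (1 + a + m) • e := by
    simp only [hv, Real.cos_zero, Real.sin_zero, mul_one, one_smul, zero_smul, add_zero]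
    rw [← add_smul]
  have hv'0 : v' 0 = (1 + a) • e₁ := by simp [hv']
  have hv0ne : v 0 ≠ 0 := by rw [hv0]; exact smul_ne_zero hm.ne' he
  have hEs : ContDiffAt ℝ ∞ E (v 0) := (hsm _ hv0ne).pow 2
  have dc : ∀ t, HasDerivAt (fun t => 1 + a * Real.cos t) (a * -Real.sin t) t := fun t =>
    ((Real.hasDerivAt_cos t).const_mul a).const_add 1
  have du : ∀ t, HasDerivAt (fun t => Real.cos t • e + Real.sin t • e₁)
      (-Real.sin t • e + Real.cos t • e₁) t := fun t =>
    ((Real.hasDerivAt_cos t).smul_const e).add ((Real.hasDerivAt_sin t).smul_const e₁)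
  have dv : ∀ t, HasDerivAt v (v' t) t := fun t => ((dc t).smul (du t)).add_const _
  have dv' : HasDerivAt v' (-(1 + 2 * a) • e) 0 := by
    have du' : HasDerivAt (fun t => -Real.sin t • e + Real.cos t • e₁)
        (-Real.cos 0 • e + -Real.sin 0 • e₁) 0 :=
      ((Real.hasDerivAt_sin 0).neg.smul_const e).add ((Real.hasDerivAt_cos 0).smul_const e₁)
    have ds : HasDerivAt (fun t => a * -Real.sin t) (a * -Real.cos 0) 0 :=
      ((Real.hasDerivAt_sin 0).neg).const_mul a
    refine (((dc 0).smul du').add (ds.smul (du 0))).congr_deriv ?_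
    simp only [Real.cos_zero, Real.sin_zero, neg_zero, mul_zero, zero_smul, add_zero, zero_add]
    module
  -- At t = 0 the curve has acceleration -(1 + 2a)e. Differentiating Φ² = 1 twice along it gives
  -- Hess(v', v') = (1 + 2a) dE(e), and dE(e) > 0 by Euler's identity.
  have key := fderiv_fderiv_add_fderiv_eq_zero hEs dv dv' fun t => by
    simp only [hE, hv, hΦ t, one_pow]
  have heul : fderiv ℝ E (v 0) (v 0) = 2 := by
    have h1 : HasDerivAt (fun t : ℝ => E (t • v 0)) (fderiv ℝ E (v 0) (v 0)) 1 := by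
      have h2 : HasFDerivAt E (fderiv ℝ E (v 0)) ((1 : ℝ) • v 0) := by
        rw [one_smul]; exact (hEs.differentiableAt (by simp)).hasFDerivAt
      have h3 := h2.comp_hasDerivAt (1 : ℝ) ((hasDerivAt_id (1 : ℝ)).smul_const (v 0))
      rw [one_smul] at h3
      exact h3
    have h3 : HasDerivAt (fun t : ℝ => t ^ 2) 2 1 := by simpa using hasDerivAt_pow 2 (1 : ℝ)
    refine h1.unique (h3.congr_of_eventuallyEq ?_)
    filter_upwards [lt_mem_nhds (one_pos : (0 : ℝ) < 1)] with t ht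
    have h4 : Φ (v 0) = 1 := hΦ 0
    simp only [hE, hom _ _ ht, h4, mul_one]
  rw [map_smul, smul_eq_mul] at key
  have he2 : (1 + a + m) * fderiv ℝ E (v 0) e = 2 := by
    rw [← smul_eq_mul, ← map_smul, ← hv0, heul]
  have hepos : 0 < fderiv ℝ E (v 0) e := by
    refine (mul_pos_iff_of_pos_left hm).1 ?_
    rw [he2]; norm_num
  by_contra hle
  -- If 1 + a = 0, then v'(0) vanishes and the Hessian gives no information, but the same identity
  -- already reads dE(e) = 0.
  by_cases ha : 1 + a = 0
  · rw [hv'0, ha, zero_smul, _root_.map_zero, zero_add] at key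
    have : a = -1 := by linarith
    rw [this] at key
    linarith
  · have hne : v' 0 ≠ 0 := by rw [hv'0]; exact smul_ne_zero ha he₁
    have h5 := hconv (v 0) (v' 0) hv0ne hne
    rw [show (fun t : ℝ => Φ (v 0 + t • v' 0) ^ 2) = fun t : ℝ => E (v 0 + t • v' 0) from rfl,
      iteratedDeriv_two_comp_line hEs] at h5
    nlinarith

end ConvexIndicatrix

/-! ### A strongly convex slope metric forces a mild wind. -/

section FinslerImpliesWind

variable {n : ℕ} {M : Type*} [TopologicalSpace M] [ChartedSpace (EuclideanSpace ℝ (Fin n)) M]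
  [IsManifold (𝓡 n) ∞ M] {h : RiemMetric n M} {p : M → ℝ} {g η η' : ℝ}
  {F : TangentBundle (𝓡 n) M → ℝ}

theorem contMDiff_fiber (x : M) : ContMDiff 𝓘(ℝ, Coord n) (𝓡 n).tangent ∞
    (fun y : Coord n => (⟨x, y⟩ : TangentBundle (𝓡 n) M)) := by
  intro y
  rw [contMDiffAt_totalSpace]
  refine ⟨contMDiffAt_const, ?_⟩
  have h1 : ∀ y : Coord n, (trivializationAt (Coord n) (TangentSpace (𝓡 n)) x
      (⟨x, y⟩ : TangentBundle (𝓡 n) M)).2 =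
      (trivializationAt (Coord n) (TangentSpace (𝓡 n)) x).continuousLinearMapAt ℝ x y := fun y =>
    (congrFun ((trivializationAt (Coord n) (TangentSpace (𝓡 n)) x).coe_linearMapAt_of_mem
      (R := ℝ) (mem_baseSet_trivializationAt (Coord n) (TangentSpace (𝓡 n)) x)) y).symm
  have h2 : ContDiff ℝ ∞ (fun y : Coord n =>
      ((trivializationAt (Coord n) (TangentSpace (𝓡 n)) x).continuousLinearMapAt ℝ x :
        Coord n →L[ℝ] Coord n) y) := ContinuousLinearMap.contDiff _
  exact (h2.contMDiff.contMDiffAt (x := y)).congr_of_eventuallyEq (Eventually.of_forall h1)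

theorem IsFinslerMetric.contDiffAt_fiber (hF : IsFinslerMetric F) (x : M) {y : Coord n}
    (hy : y ≠ 0) : ContDiffAt ℝ ∞ (fun y : Coord n => F ⟨x, y⟩) y := by
  have h1 : ContMDiffOn 𝓘(ℝ, Coord n) 𝓘(ℝ, ℝ) ∞ (fun y : Coord n => F ⟨x, y⟩) {y | y ≠ 0} :=
    hF.smooth.comp (contMDiff_fiber x).contMDiffOn fun y hy => hy
  exact h1.contDiffOn.contDiffAt (isOpen_ne.mem_nhds hy)

theorem isResultantVelocity_of_unit {x : M} {u : TangentSpace (𝓡 n) x} (hu : h.inner x u u = 1) :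
    IsResultantVelocity h p g η η' x ((1 + (η - η') * h.inner x (gravWind h p g x) u) • u +
      (1 - η) • gravWind h p g x) := by
  refine ⟨u, by rw [hnorm, hu, Real.sqrt_one], ?_⟩
  rw [activeWind, gravMAT, hu, div_one, add_smul, one_smul, mul_smul]
  abel

/-- This is where dimension greater than one is used: on a line there is no direction transverse to
the wind in which to test convexity. -/
theorem exists_orthogonal_unit (hn : 1 < n) (x : M) (e : TangentSpace (𝓡 n) x) :
    ∃ e₁ : TangentSpace (𝓡 n) x, h.inner x e e₁ = 0 ∧ h.inner x e₁ e₁ = 1 := by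
  obtain ⟨w, hw, hw0⟩ : ∃ w : TangentSpace (𝓡 n) x, h.inner x e w = 0 ∧ w ≠ 0 := by
    let f : Coord n →ₗ[ℝ] ℝ := (h.inner x e).toLinearMap
    have h1 : LinearMap.ker f ≠ ⊥ := LinearMap.ker_ne_bot_of_finrank_lt (by simpa using hn)
    obtain ⟨w, hw, hw0⟩ := (Submodule.ne_bot_iff _).1 h1
    exact ⟨w, hw, hw0⟩
  have hp := h.pos x w hw0
  have hs := Real.sqrt_pos.2 hp
  refine ⟨(√(h.inner x w w))⁻¹ • w, by rw [map_smul, hw, smul_zero], ?_⟩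
  rw [map_smul, map_smul, smul_apply, smul_eq_mul, smul_eq_mul]
  nth_rw 3 [← Real.mul_self_sqrt hp.le]
  field_simp

/-- The wind is mild if the slope metric is a Finsler metric. -/
theorem IsSlopeMetric.isMildWind (hn : 1 < n) (hF : IsSlopeMetric h p g η η' F)
    (hFin : IsFinslerMetric F) (hη : η ≤ 1) (hη' : η' ≤ 1) (x : M) :
    IsMildWind (η - η') (1 - η) (hnorm h x (gravWind h p g x)) := by
  set G := gravWind h p g x with hG
  set γ := hnorm h x G with hγ
  set c := η - η' with hc
  set k := 1 - η with hk
  have hγ0 : 0 ≤ γ := hnorm_nonneg h x G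
  have hGG : h.inner x G G = γ ^ 2 := (hnorm_sq h x G).symm
  rcases hγ0.eq_or_lt with h0 | hpos
  · exact ⟨by linarith, hγ0, by rw [← h0]; norm_num, by rw [← h0]; norm_num⟩
  obtain ⟨e, he⟩ : ∃ e : TangentSpace (𝓡 n) x, e = γ⁻¹ • G := ⟨_, rfl⟩
  have hkG : ∀ r : ℝ, r • G = (r * γ) • e := fun r => by
    rw [he, smul_smul, mul_assoc, mul_inv_cancel₀ hpos.ne', mul_one]
  have hee : h.inner x e e = 1 := by
    rw [he, map_smul, map_smul, smul_apply, smul_eq_mul, smul_eq_mul, hGG]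
    field_simp
  have hene : e ≠ 0 := fun h0 => by rw [h0] at hee; simp at hee
  have hGeq : h.inner x G e = γ := by
    rw [he, map_smul, smul_eq_mul, hGG]
    field_simp
  have hone : ∀ u : TangentSpace (𝓡 n) x, h.inner x u u = 1 →
      F ⟨x, (1 + c * h.inner x G u) • u + k • G⟩ = 1 := fun u hu =>
    (hF.indicatrix x _).2 (isResultantVelocity_of_unit hu)
  -- The self-velocities e and -e give resultant velocities along e whose coefficients differ by 2.
  -- If (c + k)γ ≥ 1, the smaller coefficient is nonnegative: zero contradicts F(0) = 0, and a
  -- positive one contradicts homogeneity, both values of F being 1.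
  have htot : (c + k) * γ < 1 := by
    by_contra hcon
    have h1 := hone e hee
    have h2 := hone (-e) (by simp [hee])
    rw [hGeq, hkG, ← add_smul] at h1
    rw [map_neg, hGeq, hkG, smul_neg, ← neg_smul, ← add_smul, mul_neg] at h2
    rcases (show 0 ≤ -(1 + -(c * γ)) + k * γ by nlinarith).eq_or_lt with h3 | h3
    · rw [← h3, zero_smul, hF.map_zero] at h2
      exact zero_ne_one h2
    · rw [hF.homogeneous x e _ h3] at h2
      rw [hF.homogeneous x e _ (by linarith)] at h1
      have h4 : F ⟨x, e⟩ = 0 := by linarith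
      rw [h4, mul_zero] at h1
      exact zero_ne_one h1
  obtain ⟨e₁, he₁, he₁1⟩ := exists_orthogonal_unit (h := h) hn x e
  have he₁ne : e₁ ≠ 0 := fun h0 => by rw [h0] at he₁1; simp at he₁1
  -- In the plane of G and a vector orthogonal to it the resultant velocities form a translated
  -- limaçon. The signs ε = ±1 select the two points on its axis and give 1 ± 2cγ > 0.
  have hlim : ∀ ε : ℝ, ε ^ 2 = 1 → 0 < 1 + c * (ε * γ) + k * (ε * γ) →
      0 < 1 + 2 * (c * (ε * γ)) := by
    intro ε hε hμ
    have hε0 : ε ≠ 0 := fun h0 => by rw [h0] at hε; norm_num at hε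
    refine one_add_two_mul_pos_of_convex (V := Coord n) (Φ := fun y => F ⟨x, y⟩) (e := ε • e)
      (e₁ := e₁) (m := k * (ε * γ)) (fun y r hr => hFin.homogeneous x y r hr)
      (fun y hy => hFin.contDiffAt_fiber x hy) (fun y w hy hw => ?_)
      (smul_ne_zero hε0 hene) he₁ne hμ fun t => ?_
    · exact pos_of_mul_pos_right (hFin.strongly_convex x y w hy hw) (by norm_num)
    · have hu : h.inner x (Real.cos t • ε • e + Real.sin t • e₁)
          (Real.cos t • ε • e + Real.sin t • e₁) = 1 := by
        simp only [map_add, map_smul, add_apply, smul_apply, smul_eq_mul, hee, he₁1, he₁,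
          h.symm x e₁ e]
        linear_combination Real.cos t ^ 2 * hε + Real.sin_sq_add_cos_sq t
      have hGu : h.inner x G (Real.cos t • ε • e + Real.sin t • e₁) = ε * γ * Real.cos t := by
        have hGe₁ : h.inner x G e₁ = 0 := by
          have h3 := congrArg (fun w => h.inner x w e₁) (hkG 1)
          simp only [one_smul, map_smul, smul_apply, he₁, smul_zero] at h3
          exact h3
        simp only [map_add, map_smul, hGeq, hGe₁, smul_eq_mul]
        ring
      have h2 := hone _ hu
      rw [hGu] at h2
      have hkε : k • G = (k * (ε * γ)) • ε • e := by
        rw [hkG, smul_smul]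
        congr 1
        linear_combination -k * γ * hε
      rw [← mul_assoc, hkε] at h2
      exact h2
  have hkc : 0 ≤ c + k := by rw [hc, hk]; linarith
  have p1 := hlim 1 (by norm_num) (by nlinarith)
  have p2 := hlim (-1) (by norm_num) (by nlinarith)
  refine ⟨by linarith, hγ0, ?_, htot⟩
  rcases abs_cases c with ⟨hc', -⟩ | ⟨hc', -⟩ <;> rw [hc'] <;> nlinarith

end FinslerImpliesWind

/-! ### The diagram of the traction coefficients. -/

section Diagram

theorem domS_eq : domS = domD1 ∪ domD2 ∪ domD3 ∪ domD4 := by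
  ext ⟨a, b⟩
  simp only [domD1, domD2, domD3, domD4, mem_union, mem_ofPred_eq]
  refine ⟨fun hS => ?_, by rintro (((h | h) | h) | h) <;> exact h.1⟩
  have ⟨ha, hb⟩ : a ∈ Icc (0 : ℝ) 1 ∧ b ∈ Icc (0 : ℝ) 1 := hS.1
  rcases le_or_gt b a with h1 | h1
  · rcases le_or_gt b (2 * a - 1) with h2 | h2
    · exact Or.inl (Or.inr ⟨hS, by linarith [hb.1], h2⟩)
    · exact Or.inl (Or.inl (Or.inl ⟨hS, h1, h2⟩))
  · rcases le_or_gt a ((3 * b - 1) / 2) with h2 | h2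
    · exact Or.inr ⟨hS, by linarith [ha.1], h2⟩
    · exact Or.inl (Or.inl (Or.inr ⟨hS, h2, h1⟩))

theorem disjoint_domD1_domD2 : Disjoint domD1 domD2 :=
  disjoint_left.2 fun _ h h' => by linarith [h.2.1, h'.2.2]

theorem disjoint_domD1_domD3 : Disjoint domD1 domD3 :=
  disjoint_left.2 fun _ h h' => by linarith [h.2.2, h'.2.2]

/-- The line bounding this set meets the diagonal only at the removed corner (1, 1), which makes the
inequality strict. -/
theorem lt_of_mem_domD4 {q : ℝ × ℝ} (h : q ∈ domD4) : q.1 < q.2 := by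
  obtain ⟨a, b⟩ := q
  obtain ⟨⟨⟨-, hb⟩, hne⟩, -, h2⟩ := h
  have hb1 : b ≤ 1 := hb.2
  simp only at h2 ⊢
  rcases hb1.eq_or_lt with rfl | hlt
  · exact lt_of_le_of_ne (by linarith) fun h1 => hne (by rw [h1]; rfl)
  · linarith

theorem lt_of_mem_domD3 {q : ℝ × ℝ} (h : q ∈ domD3) : q.2 < q.1 := by
  obtain ⟨a, b⟩ := q
  obtain ⟨⟨⟨ha, -⟩, hne⟩, -, h2⟩ := h
  have ha1 : a ≤ 1 := ha.2
  simp only at h2 ⊢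
  rcases ha1.eq_or_lt with rfl | hlt
  · exact lt_of_le_of_ne (by linarith) fun h1 => hne (by rw [h1]; rfl)
  · linarith

theorem disjoint_domD1_domD4 : Disjoint domD1 domD4 :=
  disjoint_left.2 fun _ h h' => by linarith [h.2.1, lt_of_mem_domD4 h']

theorem disjoint_domD2_domD3 : Disjoint domD2 domD3 :=
  disjoint_left.2 fun _ h h' => by linarith [h.2.2, lt_of_mem_domD3 h']

theorem disjoint_domD2_domD4 : Disjoint domD2 domD4 :=
  disjoint_left.2 fun _ h h' => by linarith [h.2.1, h'.2.2]

theorem disjoint_domD3_domD4 : Disjoint domD3 domD4 :=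
  disjoint_left.2 fun _ h h' => by linarith [lt_of_mem_domD3 h, lt_of_mem_domD4 h']

variable {n : ℕ} {M : Type*} [TopologicalSpace M] [ChartedSpace (EuclideanSpace ℝ (Fin n)) M]
  [IsManifold (𝓡 n) ∞ M] {h : RiemMetric n M} {p : M → ℝ} {g η η' : ℝ}

/-- The wind condition says that the wind is mild everywhere. -/
theorem windCondition_iff (hη : η ∈ Icc (0 : ℝ) 1) (hη' : η' ∈ Icc (0 : ℝ) 1) :
    WindCondition h p g η η' ↔
      ∀ x, IsMildWind (η - η') (1 - η) (hnorm h x (gravWind h p g x)) := by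
  have hmild : ∀ x, IsMildWind (η - η') (1 - η) (hnorm h x (gravWind h p g x)) ↔
      2 * |η - η'| * hnorm h x (gravWind h p g x) < 1 ∧
        (1 - η') * hnorm h x (gravWind h p g x) < 1 := fun x => by
    have e : η - η' + (1 - η) = 1 - η' := by ring
    refine ⟨fun hm => ⟨hm.slide, e ▸ hm.total⟩, fun hm =>
      ⟨by linarith [hη.2], hnorm_nonneg h x _, hm.1, e.symm ▸ hm.2⟩⟩
  simp only [hmild]
  have h12 : (η, η') ∈ domD1 ∪ domD2 → ((∀ x : M, hnorm h x (gravWind h p g x) < 1 / (1 - η')) ↔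
      ∀ x : M, 2 * |η - η'| * hnorm h x (gravWind h p g x) < 1 ∧
        (1 - η') * hnorm h x (gravWind h p g x) < 1) := by
    intro hD
    -- On the first two sets the total wind bound implies the sliding bound; on the other two the
    -- comparison is reversed.
    have hlt : 2 * |η - η'| < 1 - η' := by
      rcases hD with ⟨-, h1, h2⟩ | ⟨-, h1, h2⟩ <;> simp only at h1 h2
      · rw [abs_of_nonneg (by linarith)]; linarith
      · rw [abs_of_neg (by linarith)]; linarith
    have hpos : 0 < 1 - η' := lt_of_le_of_lt (by positivity) hlt
    refine forall_congr' fun x => ?_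
    rw [lt_div_iff₀' hpos]
    exact ⟨fun h1 => ⟨(mul_le_mul_of_nonneg_right hlt.le (hnorm_nonneg h x _)).trans_lt h1, h1⟩,
      fun h1 => h1.2⟩
  have h34 : (η, η') ∈ domD3 ∪ domD4 →
      ((∀ x : M, hnorm h x (gravWind h p g x) < 1 / (2 * |η - η'|)) ↔
      ∀ x : M, 2 * |η - η'| * hnorm h x (gravWind h p g x) < 1 ∧
        (1 - η') * hnorm h x (gravWind h p g x) < 1) := by
    intro hD
    have hle : 1 - η' ≤ 2 * |η - η'| ∧ 0 < 2 * |η - η'| := by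
      rcases hD with hD | hD
      · have h1 := lt_of_mem_domD3 hD
        have h2 := hD.2.2
        simp only at h1 h2
        rw [abs_of_nonneg (by linarith)]
        exact ⟨by linarith, by linarith⟩
      · have h1 := lt_of_mem_domD4 hD
        have h2 := hD.2.2
        simp only at h1 h2
        rw [abs_of_neg (by linarith)]
        exact ⟨by linarith, by linarith⟩
    refine forall_congr' fun x => ?_
    rw [lt_div_iff₀' hle.2]
    exact ⟨fun h1 => ⟨h1, (mul_le_mul_of_nonneg_right hle.1 (hnorm_nonneg h x _)).trans_lt h1⟩,
      fun h1 => h1.1⟩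
  constructor
  · rintro (⟨hD, hw⟩ | ⟨hD, hw⟩ | hD)
    · exact (h12 hD).1 hw
    · exact (h34 hD).1 hw
    · rw [Prod.mk.injEq] at hD
      rw [hD.1, hD.2]
      simp
  · intro hw
    by_cases hD : (η, η') = (1, 1)
    · exact Or.inr (Or.inr hD)
    · have hS : (η, η') ∈ domS := ⟨⟨hη, hη'⟩, hD⟩
      rw [domS_eq, union_assoc] at hS
      rcases hS with hD | hD
      · exact Or.inl ⟨hD, (h12 hD).2 hw⟩
      · exact Or.inr (Or.inl ⟨hD, (h34 hD).2 hw⟩)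

end Diagram

/-! ### The irrational equation and its unique Finsler solution. -/

section SlopeEquation

variable {n : ℕ} {M : Type*} [TopologicalSpace M] [ChartedSpace (EuclideanSpace ℝ (Fin n)) M]
  [IsManifold (𝓡 n) ∞ M] {h : RiemMetric n M} {p : M → ℝ} {g η η' : ℝ}
  {F : TangentBundle (𝓡 n) M → ℝ}

theorem mul_beta (hg : g ≠ 0) (x : M) (y : TangentSpace (𝓡 n) x) :
    g * beta h p g x y = -h.inner x y (gravWind h p g x) := by
  rw [beta]
  field_simp

/-- The irrational equation in terms of the length of `y - k z G`. -/
theorem slopeEq_iff (hg : g ≠ 0) {x : M} {y : TangentSpace (𝓡 n) x} {z : ℝ} :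
    z * √(hnorm h x y ^ 2 + 2 * (1 - η) * g * beta h p g x y * z
        + (1 - η) ^ 2 * hnorm h x (gravWind h p g x) ^ 2 * z ^ 2)
      = hnorm h x y ^ 2 + (2 - η - η') * g * beta h p g x y * z
        + (1 - η) * (1 - η') * hnorm h x (gravWind h p g x) ^ 2 * z ^ 2 ↔
    windSq (1 - η) (h.inner x y y) (h.inner x y (gravWind h p g x))
        (hnorm h x (gravWind h p g x) ^ 2) z
      = z * (√(windSq (1 - η) (h.inner x y y) (h.inner x y (gravWind h p g x))
        (hnorm h x (gravWind h p g x) ^ 2) z) + (η - η') * (h.inner x y (gravWind h p g x)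
          - (1 - η) * z * hnorm h x (gravWind h p g x) ^ 2)) := by
  have hb := mul_beta (h := h) (p := p) hg x y
  have e1 : hnorm h x y ^ 2 + 2 * (1 - η) * g * beta h p g x y * z
        + (1 - η) ^ 2 * hnorm h x (gravWind h p g x) ^ 2 * z ^ 2
      = windSq (1 - η) (h.inner x y y) (h.inner x y (gravWind h p g x))
        (hnorm h x (gravWind h p g x) ^ 2) z := by
    rw [windSq, hnorm_sq h x y]
    linear_combination 2 * (1 - η) * z * hb
  have e2 : hnorm h x y ^ 2 + (2 - η - η') * g * beta h p g x y * z
        + (1 - η) * (1 - η') * hnorm h x (gravWind h p g x) ^ 2 * z ^ 2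
      = windSq (1 - η) (h.inner x y y) (h.inner x y (gravWind h p g x))
        (hnorm h x (gravWind h p g x) ^ 2) z - z * ((η - η') * (h.inner x y (gravWind h p g x)
          - (1 - η) * z * hnorm h x (gravWind h p g x) ^ 2)) := by
    rw [windSq, hnorm_sq h x y]
    linear_combination (2 - η - η') * z * hb
  rw [e1, e2, mul_add]
  constructor <;> intro h3 <;> linarith

theorem IsSlopeMetric.satisfiesSlopeEq (hF : IsSlopeMetric h p g η η' F) (hg : g ≠ 0)
    (hW : ∀ x, IsMildWind (η - η') (1 - η) (hnorm h x (gravWind h p g x))) :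
    SatisfiesSlopeEq h p g η η' F := by
  intro x y
  by_cases hy : y = 0
  · subst hy
    rw [hF.map_zero]
    simp [hnorm, beta]
  · exact (slopeEq_iff hg).2 (hF.isSlopeRootAt (hW x) hy).eq

/-- The slope metric is the only Finsler metric which solves the irrational equation. -/
theorem IsSlopeMetric.eq_of_satisfiesSlopeEq (hn : 1 < n) (hF : IsSlopeMetric h p g η η' F)
    (hFin : IsFinslerMetric F) (hg : g ≠ 0)
    (hW : ∀ x, IsMildWind (η - η') (1 - η) (hnorm h x (gravWind h p g x)))
    {F' : TangentBundle (𝓡 n) M → ℝ} (hF' : IsFinslerMetric F')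
    (hE : SatisfiesSlopeEq h p g η η' F') : F' = F := by
  funext ⟨x, y⟩
  have hpt : ∀ y : TangentSpace (𝓡 n) x, y ≠ 0 →
      y - ((1 - η) * F' ⟨x, y⟩) • gravWind h p g x ≠ 0 → F' ⟨x, y⟩ = F ⟨x, y⟩ := by
    intro y hy hne
    refine IsSlopeRootAt.unique (hW x) ⟨hF'.pos hy, ?_, (slopeEq_iff hg).1 (hE x y)⟩
      (hF.isSlopeRootAt (hW x) hy)
    rw [hnorm_sq, ← inner_sub_smul]
    exact h.pos x _ hne
  by_cases hy : y = 0
  · subst hy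
    exact (hF'.map_zero x).trans (hF.map_zero x).symm
  by_cases hne : y - ((1 - η) * F' ⟨x, y⟩) • gravWind h p g x ≠ 0
  · exact hpt y hy hne
  -- When y = kF'(y)G both sides of the reduced equation can vanish, and it no longer determines
  -- F'(y). Moving y off the line of G by a small orthogonal vector gives a nondegenerate point, and
  -- continuity of both metrics transfers the equality back.
  rw [not_not, sub_eq_zero] at hne
  obtain ⟨w, hGw, hww⟩ := exists_orthogonal_unit (h := h) hn x (gravWind h p g x)
  have hyw : h.inner x y w = 0 := by
    rw [hne, map_smul, smul_apply, hGw, smul_zero]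
  have hline : ∀ t ∈ Ioi (0 : ℝ), F' ⟨x, y + t • w⟩ = F ⟨x, y + t • w⟩ := by
    intro t ht
    have e1 : h.inner x (y + t • w) w = t := by
      rw [map_add, map_smul, add_apply, smul_apply, hyw, hww, zero_add, smul_eq_mul, mul_one]
    refine hpt _ (fun h0 => ?_) fun h0 => ?_
    · rw [h0, _root_.map_zero] at e1
      exact (ne_of_gt ht) e1.symm
    · have e2 := congrArg (fun u => h.inner x u w) h0
      simp only [map_sub, map_smul, sub_apply, smul_apply, hGw, smul_zero, sub_zero, e1,
        _root_.map_zero, zero_apply] at e2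
      exact (ne_of_gt ht) e2
  have hcont : Continuous fun t : ℝ => (⟨x, y + t • w⟩ : TangentBundle (𝓡 n) M) :=
    (contMDiff_fiber x).continuous.comp (f := fun t : ℝ => (show Coord n from y + t • w))
      (continuous_const.add (continuous_id.smul continuous_const) :
        Continuous fun t : ℝ => (show Coord n from y) + t • (show Coord n from w))
  have hmem : (0 : ℝ) ∈ closure (Ioi (0 : ℝ)) := by
    rw [closure_Ioi]; exact le_refl (0 : ℝ)
  have h0 : F' ⟨x, y + (0 : ℝ) • w⟩ = F ⟨x, y + (0 : ℝ) • w⟩ := closure_minimal hline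
    (isClosed_eq (hF'.continuous.comp hcont) (hFin.continuous.comp hcont)) hmem
  have e0 : y + (0 : ℝ) • w = y := by rw [zero_smul, add_zero]
  rwa [e0] at h0

end SlopeEquation

/-! ### Explicit formulas at the corners of the square. -/

section Corners

variable {n : ℕ} {M : Type*} [TopologicalSpace M] [ChartedSpace (EuclideanSpace ℝ (Fin n)) M]
  [IsManifold (𝓡 n) ∞ M] {h : RiemMetric n M} {p : M → ℝ} {g : ℝ}
  {F : TangentBundle (𝓡 n) M → ℝ}

theorem IsSlopeMetric.eq_hnorm (hF : IsSlopeMetric h p g 1 1 F)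
    (hW : ∀ x, IsMildWind (1 - 1) (1 - 1) (hnorm h x (gravWind h p g x))) (x : M)
    (y : TangentSpace (𝓡 n) x) : F ⟨x, y⟩ = hnorm h x y := by
  by_cases hy : y = 0
  · subst hy
    rw [hF.map_zero]
    simp [hnorm]
  · have hr := hF.isSlopeRootAt (hW x) hy
    have h1 := hr.eq
    have h2 := Real.sqrt_pos.2 (h.pos x y hy)
    simp only [windSq, sub_self, mul_zero, zero_mul, sub_zero, ne_eq, OfNat.ofNat_ne_zero,
      not_false_eq_true, zero_pow, add_zero] at h1
    rw [← hnorm_sq, hnorm] at h1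
    rw [hnorm]
    rw [Real.sqrt_sq h2.le] at h1
    exact (mul_right_cancel₀ h2.ne' ((sq _).symm.trans h1)).symm

theorem IsSlopeMetric.eq_matsumoto (hF : IsSlopeMetric h p g 1 0 F) (hg : g ≠ 0)
    (hW : ∀ x, IsMildWind (1 - 0) (1 - 1) (hnorm h x (gravWind h p g x))) (x : M)
    (y : TangentSpace (𝓡 n) x) :
    F ⟨x, y⟩ = hnorm h x y ^ 2 / (hnorm h x y - g * beta h p g x y) := by
  by_cases hy : y = 0
  · subst hy
    rw [hF.map_zero]
    simp [hnorm]
  · have hr := hF.isSlopeRootAt (hW x) hy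
    have h1 := hr.eq
    have h2 := Real.sqrt_pos.2 (h.pos x y hy)
    simp only [windSq, sub_self, mul_zero, zero_mul, sub_zero, ne_eq, OfNat.ofNat_ne_zero,
      not_false_eq_true, zero_pow, add_zero, one_mul] at h1
    have h3 : hnorm h x y + h.inner x y (gravWind h p g x) ≠ 0 := fun h0 => by
      rw [← hnorm, h0, mul_zero] at h1
      exact (h.pos x y hy).ne' h1
    rw [mul_beta hg, sub_neg_eq_add, eq_div_iff h3, hnorm_sq, h1]
    rfl

theorem IsSlopeMetric.isMatsumotoMetric (hF : IsSlopeMetric h p g 1 0 F) (hg : g ≠ 0)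
    (hp : ContMDiff (𝓡 n) 𝓘(ℝ, ℝ) ∞ p)
    (hW : ∀ x, IsMildWind (1 - 0) (1 - 1) (hnorm h x (gravWind h p g x))) :
    IsMatsumotoMetric F := by
  have hb : ∀ (x : M) (y : TangentSpace (𝓡 n) x),
      (-h.inner x (gravWind h p g x)) y = -h.inner x y (gravWind h p g x) := fun x y => by
    rw [neg_apply, h.symm]
  refine ⟨h, fun x => (-h.inner x (gravWind h p g x)).toLinearMap, ?_, fun x y hy => ?_,
    fun x y => ?_⟩
  · exact (contMDiff_inner_gravWind h g hp).neg.congr fun v => hb v.1 v.2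
  · change |(-h.inner x (gravWind h p g x)) y| < _
    rw [hb, abs_neg]
    have h1 := (hW x).slide
    have h2 : 0 < hnorm h x y := Real.sqrt_pos.2 (h.pos x y hy)
    have h3 : |h.inner x y (gravWind h p g x)| ≤
        |hnorm h x y * hnorm h x (gravWind h p g x)| := by
      refine sq_le_sq.1 ?_
      rw [mul_pow, hnorm_sq h x y]
      exact sq_inner_le h x _ _
    rw [abs_of_nonneg (mul_nonneg h2.le (hnorm_nonneg h x _))] at h3
    norm_num at h1
    nlinarith
  · rw [hF.eq_matsumoto hg hW, mul_beta hg]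
    exact congrArg (fun r => hnorm h x y ^ 2 / (hnorm h x y - r)) (hb x y).symm

theorem IsSlopeMetric.isCrossSlopeMetric (hF : IsSlopeMetric h p g 0 1 F) (hg : g ≠ 0)
    (hFin : IsFinslerMetric F)
    (hW : ∀ x, IsMildWind (0 - 1) (1 - 0) (hnorm h x (gravWind h p g x))) :
    IsCrossSlopeMetric h p g F := by
  refine ⟨hFin, fun x y => ?_, fun x y => ?_⟩
  · rw [hF.indicatrix, IsResultantVelocity]
    refine exists_congr fun u => and_congr_right fun _ => ?_
    have e : activeWind h p g 0 1 x u = gravWind h p g x - gravMAT h p g x u := by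
      rw [activeWind]; module
    rw [e]
  · have := hF.satisfiesSlopeEq hg hW x y
    norm_num at this
    exact this

/-- For c = 0, k = 1 the equation says ‖y - zG‖ = z, a quadratic equation in z with leading
coefficient λ = 1 - ‖G‖² > 0; the formula is its positive root. -/
theorem IsSlopeMetric.eq_randers (hF : IsSlopeMetric h p g 0 0 F)
    (hW : ∀ x, IsMildWind (0 - 0) (1 - 0) (hnorm h x (gravWind h p g x))) (x : M)
    (y : TangentSpace (𝓡 n) x) :
    F ⟨x, y⟩ = (√(h.inner x y (gravWind h p g x) ^ 2
        + (1 - hnorm h x (gravWind h p g x) ^ 2) * hnorm h x y ^ 2)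
      - h.inner x y (gravWind h p g x)) / (1 - hnorm h x (gravWind h p g x) ^ 2) := by
  by_cases hy : y = 0
  · subst hy
    rw [hF.map_zero]
    simp [hnorm]
  · have hr := hF.isSlopeRootAt (hW x) hy
    have hN : 0 < 1 - hnorm h x (gravWind h p g x) ^ 2 := by
      have := (hW x).total
      nlinarith [hnorm_nonneg h x (gravWind h p g x)]
    obtain ⟨hz, hq, he⟩ := hr
    rw [sub_self, zero_mul, add_zero] at he
    have hs := Real.sqrt_pos.2 hq
    have hz2 := mul_right_cancel₀ hs.ne' ((Real.mul_self_sqrt hq.le).trans he)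
    rw [Real.sqrt_eq_iff_mul_self_eq hq.le hz.le, windSq] at hz2
    rw [eq_div_iff hN.ne', eq_sub_iff_add_eq, eq_comm, Real.sqrt_eq_iff_mul_self_eq_of_pos]
    · rw [hnorm_sq h x y]
      linear_combination (hnorm h x (gravWind h p g x) ^ 2 - 1) * hz2
    · have hA := h.pos x y hy
      by_contra hle
      nlinarith [mul_pos hz hN]

end Corners

/-! ### Smooth fields of bilinear forms from smooth quadratic forms. -/

section BilinearForms

variable {n : ℕ} {M : Type*} [TopologicalSpace M] [ChartedSpace (EuclideanSpace ℝ (Fin n)) M]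
  [IsManifold (𝓡 n) ∞ M]

theorem bilin_eq_sum (B : Coord n →L[ℝ] Coord n →L[ℝ] ℝ) :
    B = ∑ i, ∑ j, B (coordVec i) (coordVec j) • (EuclideanSpace.proj i : Coord n →L[ℝ] ℝ).smulRight
      (EuclideanSpace.proj j : Coord n →L[ℝ] ℝ) := by
  have hproj : ∀ (i : Fin n) (u : Coord n), (EuclideanSpace.proj i : Coord n →L[ℝ] ℝ) u = u i :=
    fun _ _ => rfl
  ext u w
  conv_lhs => rw [← sum_smul_coordVec u, ← sum_smul_coordVec w]
  simp only [map_sum, sum_apply, map_smul, smul_apply,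
    ContinuousLinearMap.smulRight_apply, hproj, smul_eq_mul, Finset.mul_sum]
  rw [Finset.sum_comm]
  refine Finset.sum_congr rfl fun i _ => Finset.sum_congr rfl fun j _ => ?_
  ring

/-- A field of symmetric bilinear forms is smooth if its quadratic form is. -/
theorem contMDiff_bilin (B : ∀ x : M, TangentSpace (𝓡 n) x →L[ℝ] TangentSpace (𝓡 n) x →L[ℝ] ℝ)
    (hsymm : ∀ x u w, B x u w = B x w u)
    (hB : ContMDiff (𝓡 n).tangent 𝓘(ℝ, ℝ) ∞
      (fun v : TangentBundle (𝓡 n) M => B v.1 v.2 v.2)) :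
    ContMDiff (𝓡 n) ((𝓡 n).prod 𝓘(ℝ, Coord n →L[ℝ] Coord n →L[ℝ] ℝ)) ∞
      (fun x => TotalSpace.mk' (Coord n →L[ℝ] Coord n →L[ℝ] ℝ)
        (E := fun x : M => TangentSpace (𝓡 n) x →L[ℝ] TangentSpace (𝓡 n) x →L[ℝ] ℝ) x (B x)) := by
  intro x₀
  rw [contMDiffAt_hom_bundle]
  refine ⟨contMDiffAt_id, ?_⟩
  set e := trivializationAt (Coord n) (TangentSpace (𝓡 n)) x₀ with he
  have hx₀ : e.baseSet ∈ 𝓝 x₀ := e.open_baseSet.mem_nhds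
    (mem_baseSet_trivializationAt (Coord n) (TangentSpace (𝓡 n)) x₀)
  have hsec : ∀ u : Coord n, ContMDiffAt (𝓡 n) (𝓡 n).tangent ∞
      (fun x => (⟨x, e.symm x u⟩ : TangentBundle (𝓡 n) M)) x₀ := by
    intro u
    have h1 : ContMDiffOn (𝓡 n) ((𝓡 n).prod 𝓘(ℝ, Coord n)) ∞
        (fun x => e.toOpenPartialHomeomorph.symm (x, u)) e.baseSet :=
      (e.contMDiffOn_symm (IB := 𝓡 n) (n := ∞)).comp
        (contMDiff_id.prodMk contMDiff_const).contMDiffOn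
        fun x hx => e.mem_target.2 hx
    refine (h1.contMDiffAt hx₀).congr_of_eventuallyEq ?_
    filter_upwards [hx₀] with x hx using e.mk_symm hx u
  have hquad : ∀ u : Coord n, ContMDiffAt (𝓡 n) 𝓘(ℝ, ℝ) ∞
      (fun x => B x (e.symm x u) (e.symm x u)) x₀ := fun u => (hB _).comp x₀ (hsec u)
  -- Polarization over a local frame recovers the matrix coefficients from the quadratic form.
  have hpol : ∀ u w : Coord n, ContMDiffAt (𝓡 n) 𝓘(ℝ, ℝ) ∞
      (fun x => B x (e.symm x u) (e.symm x w)) x₀ := by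
    intro u w
    have h1 := contMDiffAt_const (c := (1 / 2 : ℝ)).mul
      (((hquad (u + w)).sub (hquad u)).sub (hquad w))
    refine h1.congr_of_eventuallyEq ?_
    filter_upwards [hx₀] with x hx
    have h2 : e.symm x (u + w) = e.symm x u + e.symm x w := by
      have h3 := (e.symmₗ ℝ x).map_add u w
      rwa [e.coe_symmₗ (R := ℝ) hx] at h3
    simp only [h2, map_add, add_apply, hsymm x (e.symm x w) (e.symm x u), Pi.mul_apply]
    ring
  have hsum : ContMDiffAt (𝓡 n) 𝓘(ℝ, Coord n →L[ℝ] Coord n →L[ℝ] ℝ) ∞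
      (fun x => ∑ i, ∑ j, B x (e.symm x (coordVec i)) (e.symm x (coordVec j)) •
        (EuclideanSpace.proj i : Coord n →L[ℝ] ℝ).smulRight
          (EuclideanSpace.proj j : Coord n →L[ℝ] ℝ)) x₀ :=
    ContMDiffAt.sum fun i _ => ContMDiffAt.sum fun j _ =>
      (hpol (coordVec i) (coordVec j)).smul contMDiffAt_const
  refine hsum.congr_of_eventuallyEq ?_
  filter_upwards [hx₀] with x hx
  rw [bilin_eq_sum (ContinuousLinearMap.inCoordinates _ _ _ _ _ _ _ _ _)]
  refine Finset.sum_congr rfl fun i _ => Finset.sum_congr rfl fun j _ => ?_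
  congr 1
  refine (inCoordinates_apply_eq₂ hx hx (mem_univ _)).trans ?_
  simp
  rfl

end BilinearForms

/-! ### The Randers metric of Zermelo navigation. -/

section Randers

variable {n : ℕ} {M : Type*} [TopologicalSpace M] [ChartedSpace (EuclideanSpace ℝ (Fin n)) M]
  [IsManifold (𝓡 n) ∞ M] {p : M → ℝ} {g : ℝ} {F : TangentBundle (𝓡 n) M → ℝ}

/-- The bilinear form `(h(·, G) ⊗ h(·, G) + λ h) / λ²`, `λ = 1 - |G|²`, of Zermelo navigation. -/
def zermeloForm (h : RiemMetric n M) (p : M → ℝ) (g : ℝ) (x : M) :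
    TangentSpace (𝓡 n) x →L[ℝ] TangentSpace (𝓡 n) x →L[ℝ] ℝ :=
  ((1 - hnorm h x (gravWind h p g x) ^ 2) ^ 2)⁻¹ •
    ((h.inner x (gravWind h p g x)).smulRight (h.inner x (gravWind h p g x)) +
      (1 - hnorm h x (gravWind h p g x) ^ 2) • h.inner x)

theorem zermeloForm_apply (h : RiemMetric n M) (x : M) (u w : TangentSpace (𝓡 n) x) :
    zermeloForm h p g x u w = ((1 - hnorm h x (gravWind h p g x) ^ 2) ^ 2)⁻¹ *
      (h.inner x u (gravWind h p g x) * h.inner x w (gravWind h p g x) +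
        (1 - hnorm h x (gravWind h p g x) ^ 2) * h.inner x u w) := by
  rw [h.symm x u (gravWind h p g x), h.symm x w (gravWind h p g x)]
  rfl

/-- The Riemannian metric of Zermelo navigation. -/
def zermeloMetric (h : RiemMetric n M) (g : ℝ) (hp : ContMDiff (𝓡 n) 𝓘(ℝ, ℝ) ∞ p)
    (hN : ∀ x, 0 < 1 - hnorm h x (gravWind h p g x) ^ 2) : RiemMetric n M where
  inner := zermeloForm h p g
  symm x u w := by
    rw [zermeloForm_apply, zermeloForm_apply, h.symm x u w]
    ring
  pos x u hu := by
    rw [zermeloForm_apply]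
    have h1 := hN x
    have h2 := mul_pos h1 (h.pos x u hu)
    have h3 := mul_self_nonneg (h.inner x u (gravWind h p g x))
    positivity
  isVonNBounded x := by
    -- The new unit ball lies in that of h: λ h(u, u) ≤ ⟨u, G⟩² + λ h(u, u) < λ² and λ ≤ 1.
    refine (h.isVonNBounded x).subset fun u hu => ?_
    have h1 := hN x
    change zermeloForm h p g x u u < 1 at hu
    change h.inner x u u < 1
    rw [zermeloForm_apply, inv_mul_lt_iff₀ (by positivity)] at hu
    have h3 := mul_self_nonneg (h.inner x u (gravWind h p g x))
    have h4 := sq_nonneg (hnorm h x (gravWind h p g x))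
    nlinarith
  contMDiff := by
    refine contMDiff_bilin _ (fun x u w => ?_) ?_
    · rw [zermeloForm_apply, zermeloForm_apply, h.symm x u w]
      ring
    · have hl : ContMDiff (𝓡 n).tangent 𝓘(ℝ, ℝ) ∞ (fun v : TangentBundle (𝓡 n) M =>
          1 - hnorm h v.1 (gravWind h p g v.1) ^ 2) :=
        contMDiff_const.sub ((contMDiff_hnorm_gravWind_sq h g hp).comp
          (contMDiff_proj (TangentSpace (𝓡 n))))
      have hb := contMDiff_inner_gravWind h g hp
      refine ((hl.pow 2).inv₀ fun v => (pow_pos (hN v.1) 2).ne').mul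
        ((hb.mul hb).add (hl.mul (contMDiff_riem_self h))) |>.congr fun v => ?_
      exact zermeloForm_apply h v.1 v.2 v.2

variable {h : RiemMetric n M}

theorem IsSlopeMetric.isRandersMetric (hF : IsSlopeMetric h p g 0 0 F)
    (hp : ContMDiff (𝓡 n) 𝓘(ℝ, ℝ) ∞ p)
    (hW : ∀ x, IsMildWind (0 - 0) (1 - 0) (hnorm h x (gravWind h p g x))) :
    IsRandersMetric F := by
  have hN : ∀ x, 0 < 1 - hnorm h x (gravWind h p g x) ^ 2 := fun x => by
    have := (hW x).total
    nlinarith [hnorm_nonneg h x (gravWind h p g x)]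
  set l : M → ℝ := fun x => 1 - hnorm h x (gravWind h p g x) ^ 2 with hl
  have hb : ∀ (x : M) (y : TangentSpace (𝓡 n) x),
      (-(l x)⁻¹ • h.inner x (gravWind h p g x)) y =
        -(l x)⁻¹ * h.inner x y (gravWind h p g x) := fun x y => by
    rw [smul_apply, h.symm, smul_eq_mul]
  have ha : ∀ (x : M) (y : TangentSpace (𝓡 n) x), hnorm (zermeloMetric h g hp hN) x y =
      √(h.inner x y (gravWind h p g x) ^ 2 + l x * hnorm h x y ^ 2) / l x := fun x y => by
    have h1 : (zermeloMetric h g hp hN).inner x y y =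
        (h.inner x y (gravWind h p g x) ^ 2 + l x * hnorm h x y ^ 2) / l x ^ 2 := by
      refine (zermeloForm_apply h x y y).trans ?_
      rw [hnorm_sq h x y, div_eq_inv_mul, sq (h.inner x y _)]
    rw [hnorm, h1, Real.sqrt_div' _ (sq_nonneg _), Real.sqrt_sq (hN x).le]
  refine ⟨zermeloMetric h g hp hN, fun x => (-(l x)⁻¹ • h.inner x (gravWind h p g x)).toLinearMap,
    ?_, fun x y hy => ?_, fun x y => ?_⟩
  · have hls : ContMDiff (𝓡 n).tangent 𝓘(ℝ, ℝ) ∞ (fun v : TangentBundle (𝓡 n) M => l v.1) :=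
      contMDiff_const.sub ((contMDiff_hnorm_gravWind_sq h g hp).comp
        (contMDiff_proj (TangentSpace (𝓡 n))))
    exact (((hls.inv₀ fun v => (hN v.1).ne').neg).mul (contMDiff_inner_gravWind h g hp)).congr
      fun v => hb v.1 v.2
  · change |(-(l x)⁻¹ • h.inner x (gravWind h p g x)) y| < _
    have h1 := hN x
    rw [hb, ha, abs_mul, abs_neg, abs_of_pos (inv_pos.2 h1), div_eq_inv_mul]
    refine mul_lt_mul_of_pos_left ?_ (inv_pos.2 h1)
    refine Real.lt_sqrt_of_sq_lt ?_
    have h2 := mul_pos h1 (h.pos x y hy)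
    rw [sq_abs, hnorm_sq]
    linarith
  · rw [hF.eq_randers hW, ha]
    refine Eq.trans ?_ (congrArg _ (hb x y).symm)
    rw [sub_div, sub_eq_add_neg, div_eq_inv_mul (h.inner x y _), neg_mul]

end Randers

/-! ### Trajectories as unit-speed paths, and uniqueness of the slope metric. -/

section Navigation

variable {n : ℕ} {M : Type*} [TopologicalSpace M] [ChartedSpace (EuclideanSpace ℝ (Fin n)) M]
  [IsManifold (𝓡 n) ∞ M] {h : RiemMetric n M} {p : M → ℝ} {g η η' : ℝ}
  {F : TangentBundle (𝓡 n) M → ℝ}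

/-- The indicatrix condition is the whole content: time for the craft is arc length for F. -/
theorem IsSlopeMetric.isTrajectoryOn_iff (hF : IsSlopeMetric h p g η η' F) {γ : ℝ → M} {a b : ℝ} :
    IsTrajectoryOn h p g η η' γ a b ↔ IsUnitPath F γ a b := by
  refine exists_congr fun P => forall₂_congr fun c d => forall₄_congr fun _ _ _ _ => ?_
  exact ⟨fun h1 => ⟨h1.1, fun t ht => (hF.indicatrix _ _).2 (h1.2 t ht)⟩,
    fun h1 => ⟨h1.1, fun t ht => (hF.indicatrix _ _).1 (h1.2 t ht)⟩⟩

theorem IsSlopeMetric.isTimeMinimalOn_iff (hF : IsSlopeMetric h p g η η' F) {γ : ℝ → M} {a b : ℝ} :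
    IsTimeMinimalOn h p g η η' γ a b ↔ IsShortestOn F γ a b := by
  simp only [IsTimeMinimalOn, IsShortestOn, hF.isTrajectoryOn_iff]

theorem IsSlopeMetric.isLocallyTimeMinimalOn_iff (hF : IsSlopeMetric h p g η η' F) {γ : ℝ → M}
    {a b : ℝ} : IsLocallyTimeMinimalOn h p g η η' γ a b ↔ IsLocallyShortestOn F γ a b := by
  simp only [IsLocallyTimeMinimalOn, IsLocallyShortestOn, hF.isTrajectoryOn_iff,
    hF.isTimeMinimalOn_iff]

/-- There is exactly one slope metric if the wind is mild. -/
theorem existsUnique_isSlopeMetric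
    (hW : ∀ x, IsMildWind (η - η') (1 - η) (hnorm h x (gravWind h p g x))) :
    ∃! F, IsSlopeMetric h p g η η' F :=
  ⟨_, isSlopeMetric_slopeVal hW, fun _ hF => funext fun v => hF.eq_slopeVal (hW v.1) v.2⟩

end Navigation

end SlopeNav

end

theorem theorem1p1 {n : ℕ} (hn : 1 < n) {M : Type*} [TopologicalSpace M] [T2Space M]
    [ChartedSpace (EuclideanSpace ℝ (Fin n)) M] [IsManifold (𝓡 n) ∞ M]
    (h : SlopeNav.RiemMetric n M) (p : M → ℝ) (hp : ContMDiff (𝓡 n) 𝓘(ℝ, ℝ) ∞ p)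
    (g : ℝ) (hg : 0 < g) (η η' : ℝ) (hη : η ∈ Icc (0 : ℝ) 1) (hη' : η' ∈ Icc (0 : ℝ) 1) :
    -- the four sets partition the square without its corner
    (SlopeNav.domS = SlopeNav.domD1 ∪ SlopeNav.domD2 ∪ SlopeNav.domD3 ∪ SlopeNav.domD4 ∧
        Disjoint SlopeNav.domD1 SlopeNav.domD2 ∧ Disjoint SlopeNav.domD1 SlopeNav.domD3 ∧
        Disjoint SlopeNav.domD1 SlopeNav.domD4 ∧ Disjoint SlopeNav.domD2 SlopeNav.domD3 ∧
        Disjoint SlopeNav.domD2 SlopeNav.domD4 ∧ Disjoint SlopeNav.domD3 SlopeNav.domD4) ∧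
    -- existence and uniqueness of the slope metric under the wind condition
    (SlopeNav.WindCondition h p g η η' → ∃! F, SlopeNav.IsSlopeMetric h p g η η' F) ∧
    ∀ F : TangentBundle (𝓡 n) M → ℝ, SlopeNav.IsSlopeMetric h p g η η' F →
      -- it is a (strongly convex) Finsler metric exactly under the wind condition
      (SlopeNav.IsFinslerMetric F ↔ SlopeNav.WindCondition h p g η η') ∧
      (SlopeNav.WindCondition h p g η η' →
        -- it is the Finsler metric given implicitly by the irrational equation
        SlopeNav.SatisfiesSlopeEq h p g η η' F ∧
        (∀ F' : TangentBundle (𝓡 n) M → ℝ, SlopeNav.IsFinslerMetric F' →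
          SlopeNav.SatisfiesSlopeEq h p g η η' F' → F' = F) ∧
        -- the time-minimal paths are its geodesics
        (∀ (γ : ℝ → M) (a b : ℝ), a < b →
          (SlopeNav.IsTimeMinimalOn h p g η η' γ a b →
            SlopeNav.IsGeodesicOn F γ a b ∧
              ∀ t ∈ Ioo a b, F ⟨γ t, SlopeNav.velocity γ t⟩ = 1) ∧
          (SlopeNav.IsLocallyTimeMinimalOn h p g η η' γ a b ↔
            SlopeNav.IsGeodesicOn F γ a b ∧
              ∀ t ∈ Ioo a b, F ⟨γ t, SlopeNav.velocity γ t⟩ = 1)) ∧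
        -- the four corners of the square
        (η = 0 → η' = 0 → SlopeNav.IsRandersMetric F ∧
          ∀ (x : M) (y : TangentSpace (𝓡 n) x),
            F ⟨x, y⟩ =
              (Real.sqrt (h.inner x y (SlopeNav.gravWind h p g x) ^ 2
                  + (1 - SlopeNav.hnorm h x (SlopeNav.gravWind h p g x) ^ 2)
                    * SlopeNav.hnorm h x y ^ 2)
                - h.inner x y (SlopeNav.gravWind h p g x))
              / (1 - SlopeNav.hnorm h x (SlopeNav.gravWind h p g x) ^ 2)) ∧
        (η = 1 → η' = 0 → SlopeNav.IsMatsumotoMetric F ∧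
          ∀ (x : M) (y : TangentSpace (𝓡 n) x),
            F ⟨x, y⟩ = SlopeNav.hnorm h x y ^ 2
              / (SlopeNav.hnorm h x y - g * SlopeNav.beta h p g x y)) ∧
        (η = 0 → η' = 1 → SlopeNav.IsCrossSlopeMetric h p g F) ∧
        (η = 1 → η' = 1 → ∀ (x : M) (y : TangentSpace (𝓡 n) x),
          F ⟨x, y⟩ = SlopeNav.hnorm h x y)) := by
  have hwc := SlopeNav.windCondition_iff (h := h) (p := p) (g := g) hη hη'
  refine ⟨⟨SlopeNav.domS_eq, SlopeNav.disjoint_domD1_domD2, SlopeNav.disjoint_domD1_domD3,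
    SlopeNav.disjoint_domD1_domD4, SlopeNav.disjoint_domD2_domD3, SlopeNav.disjoint_domD2_domD4,
    SlopeNav.disjoint_domD3_domD4⟩, fun hW => SlopeNav.existsUnique_isSlopeMetric (hwc.1 hW),
    fun F hF => ⟨⟨fun hFin => hwc.2 (hF.isMildWind hn hFin hη.2 hη'.2),
      fun hW => hF.isFinslerMetric hp (hwc.1 hW)⟩, fun hW => ?_⟩⟩
  have hm := hwc.1 hW
  have hFin := hF.isFinslerMetric hp hm
  refine ⟨hF.satisfiesSlopeEq hg.ne' hm,
    fun F' hF' hE => hF.eq_of_satisfiesSlopeEq hn hFin hg.ne' hm hF' hE,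
    fun γ a b hab => ⟨fun hγ => ?_, ?_⟩, ?_, ?_, ?_, ?_⟩
  · exact (SlopeNav.isLocallyShortestOn_iff hFin hab).1
      (hF.isTimeMinimalOn_iff.1 hγ).isLocallyShortestOn
  · exact hF.isLocallyTimeMinimalOn_iff.trans (SlopeNav.isLocallyShortestOn_iff hFin hab)
  · rintro rfl rfl
    exact ⟨hF.isRandersMetric hp hm, hF.eq_randers hm⟩
  · rintro rfl rfl
    exact ⟨hF.isMatsumotoMetric hg.ne' hp hm, hF.eq_matsumoto hg.ne' hm⟩
  · rintro rfl rfl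
    exact hF.isCrossSlopeMetric hg.ne' hFin hm
  · rintro rfl rfl
    exact hF.eq_hnorm hm
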